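/- \textbf{Setting.} An instance $I$ of single-source buy-at-bulk consists of a finite undirected graph $G=(V,E)$ with nonnegative rational edge lengths $l_e$, integer demands $d_v\ge 0$, not all zero, with set of demand nodes $\mathcal D=\{v: d_v>0\}$, and a root $r$ that is joined in $G$ to every demand node; $N$ is the size of its binary encoding. Put $D=2^{\lceil\log_2\sum_v d_v\rceil}$. Let $\mathcal T$ be the set of trees in $G$ containing $\mathcal D\cup\{r\}$; for $T\in\mathcal T$ let $x_{T,e}$ be the flow on $e$ when every $v$ sends $d_v$ to $r$ along its path in $T$. For a function $f$ put $f(T)=\sum_{e\in T} l_e f(x_{T,e})$, and let $T_f^*\in\mathcal T$ minimize $f(T)$. Let $\mathcal F$ be the set of functions $f$ that are concave and nondecreasing on $[0,\infty)$ with $f(0)=0$. Let $A_i(x)=\min\{x,2^i\}$ for $0\le i\le\log_2 D$, and $T_i^*=T_{A_i}^*$. Let $c$ be a real constant. Let $\mathcal A$ be a randomized polynomial-time algorithm that, given an instance and rationals $\alpha_0,\dots,\alpha_{\log_2 D}\ge 0$, always outputs a tree $T_{\mathcal A}\in\mathcal T$, such that $$\mathbf E\Big[\sum_i\alpha_iA_i(T_{\mathcal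 A})\Big]\le c\sum_i\alpha_iA_i(T_i^*).$$ Let $\mathcal R$ be a (possibly randomized) polynomial-time algorithm for single-sink rent-or-buy with expected approximation ratio $\pi_{RoB}$: given an instance and an integer $M\ge 0$, it always outputs a tree $T\in\mathcal T$, with $\mathbf E[g(T)]\le\pi_{RoB}\,g(T_g^*)$ for $g(x)=\min\{x,M\}$. \textbf{Theorem.} For every $c$ there are a randomized algorithm $\mathcal Q$, which uses $\mathcal A$ and $\mathcal R$ only as subroutines, and a polynomial $q$, both depending only on $c$, such that for all $\mathcal A$, $\mathcal R$, $\pi_{RoB}$ as above the following holds. (The time of $\mathcal Q$ includes the time spent in the subroutines.) \begin{enumerate} \item On every instance, $\mathcal Q$ halts with probability $1$, and it then outputs explicitly a probability distribution $\{x_T\}$ on $\mathcal T$ with at most $1+\log_2 D$ trees in its support. \item The expected oblivious approximation ratio is at most $2c\pi_{RoB}$: for every instance and every $f\in\mathcal F$, $\mathbf E\big[\sum_T x_Tf(T)\big]\le 2c\,\pi_{RoB}\,f(T_f^*)$, the expectation being over the coin tosses of $\mathcal Q$ and of its subroutines. If moreover the ratio $\pi_{RoB}$ of $\mathcal R$ holds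 for every outcome of its coin tosses, then with probability $1$ the output satisfies $\sum_T x_Tf(T)\le 2c\,\pi_{RoB}\,f(T_f^*)$ for all $f\in\mathcal F$ simultaneously. \item $\mathcal Q$ runs in polynomial time with high probability: for every $k$ there is a polynomial $p$ (which may depend on $\mathcal A$ and $\mathcal R$) such that on every instance the running time exceeds $p(N)$ with probability at most $N^{-k}$. \item $\mathcal Q$ makes $O(\mathrm{poly}(\log D))$ calls to $\mathcal A$ with high probability: on every instance and for every integer $t\ge 0$, it makes more than $t\,q(\log_2 D)$ calls with probability at most $2^{-t}$ (so, with $t=\lceil k\log_2 D\rceil$, at most $\mathrm{poly}(\log D)$ calls except with probability at most $D^{-k}$). \end{enumerate} -/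

import Mathlib

open MeasureTheory
open scoped ENNReal

noncomputable section

/-! ### A model of randomized computation

Data are finite binary trees with integers at the leaves; programs are built from primitive
operations by composition, pairing, branching and unbounded loops, may toss fair coins, and may
call subroutines.  Time is charged by bit size, so that polynomial time here is the usual one. -/

/-- Data handled by programs: integers and ordered pairs. -/
inductive Val : Type
  | int (z : ℤ)
  | pair (a b : Val)
  deriving DecidableEq

namespace Val

/-- The number of bits needed to write a datum down, up to a constant factor. -/
def size : Val → ℕ
  | int z => z.natAbs.size + 1
  | pair a b => a.size + b.size + 1

/-- First component; `0` for an integer. -/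
def fst : Val → Val
  | pair a _ => a
  | int _ => int 0

/-- Second component; `0` for an integer. -/
def snd : Val → Val
  | pair _ b => b
  | int _ => int 0

/-- The integer at a leaf; `0` for a pair. -/
def toInt : Val → ℤ
  | int z => z
  | pair _ _ => 0

/-- Finite lists are written as nested pairs ending in `0`. -/
def ofList : List Val → Val
  | [] => int 0
  | a :: l => pair a (ofList l)

/-- Reading a list. -/
def toList : Val → List Val
  | int _ => []
  | pair a b => a :: b.toList

/-- A rational is written as numerator and denominator in lowest terms. -/
def ofRat (q : ℚ≥0) : Val := pair (int q.num) (int q.den)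

/-- Reading a rational, not necessarily in lowest terms. -/
def toRat (v : Val) : ℚ := (v.fst.toInt : ℚ) / (v.snd.toInt : ℚ)

theorem toList_ofList (l : List Val) : (ofList l).toList = l := by
  induction l with
  | nil => rfl
  | cons a l ih => simp [ofList, toList, ih]

theorem toRat_ofRat (q : ℚ≥0) : (ofRat q).toRat = (q : ℚ) := by
  simp only [toRat, ofRat, fst, snd, toInt]
  have h := Rat.num_div_den (q : ℚ)
  exact_mod_cast h

end Val

/-- Primitive operations. The arithmetic ones act on a pair of integers. -/
inductive Op : Type
  | ident
  | const (v : Val)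
  | fst
  | snd
  | isPair
  | add
  | sub
  | mul
  | div
  | le

/-- The value of a primitive operation (`div` rounds down for a positive divisor, and truth values
are `1` and `0`). -/
def Op.eval : Op → Val → Val
  | ident, v => v
  | const w, _ => w
  | fst, v => v.fst
  | snd, v => v.snd
  | isPair, .pair _ _ => .int 1
  | isPair, .int _ => .int 0
  | add, v => .int (v.fst.toInt + v.snd.toInt)
  | sub, v => .int (v.fst.toInt - v.snd.toInt)
  | mul, v => .int (v.fst.toInt * v.snd.toInt)
  | div, v => .int (v.fst.toInt / v.snd.toInt)
  | le, v => .int (if v.fst.toInt ≤ v.snd.toInt then 1 else 0)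

/-- Programs that may call subroutines with names in `ι`. -/
inductive Prog (ι : Type) : Type
  | op (o : Op)
  | coin
  | seq (p q : Prog ι)
  | fork (p q : Prog ι)
  | ite (g p q : Prog ι)
  | while (g p : Prog ι)
  | call (i : ι)

/-- What is recorded of a halting run: the output, the time used, and how often each subroutine
was called. -/
structure Outcome (ι : Type) : Type where
  val : Val
  time : ℕ
  calls : ι → ℕ

instance (ι : Type) : MeasurableSpace (Outcome ι) := ⊤

/-- The outcome `b` of a later part of a run, with the costs of the earlier part `a` added. -/
def Outcome.after {ι : Type} (a b : Outcome ι) : Outcome ι :=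
  ⟨b.val, a.time + b.time + 1, a.calls + b.calls⟩

/-- The part of the outcome distribution of a loop with guard `G` and body `P` that comes from
runs whose body is executed exactly `n` times. -/
def loopRun {ι : Type} (G P : Val → Measure (Outcome ι)) : ℕ → Val → Measure (Outcome ι)
  | 0, v => (G v).bind fun a =>
      if a.val = .int 0 then Measure.dirac ⟨v, a.time + 1, a.calls⟩ else 0
  | n + 1, v => (G v).bind fun a =>
      if a.val = .int 0 then 0
      else (P v).bind fun b => (loopRun G P n b.val).map fun o => a.after (b.after o)

open Classical in
/-- The distribution of the outcome of a program on a given input.  Its total mass is the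
probability that the program halts.  A primitive operation is charged the square of the size of
its argument (schoolbook arithmetic) plus the size of its result, and a call is charged the
running time of the subroutine together with the size of its argument and its result.  Distinct
calls, like distinct tosses of the coin, are independent. -/
def Prog.runWith {ι : Type} (sub : ι → Val → Measure (Outcome Empty)) :
    Prog ι → Val → Measure (Outcome ι)
  | op o, v => Measure.dirac ⟨o.eval v, v.size ^ 2 + (o.eval v).size, 0⟩
  | coin, _ =>
      (2⁻¹ : ℝ≥0∞) • Measure.dirac ⟨.int 0, 1, 0⟩ + (2⁻¹ : ℝ≥0∞) • Measure.dirac ⟨.int 1, 1, 0⟩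
  | seq p q, v =>
      (p.runWith sub v).bind fun a => (q.runWith sub a.val).map fun b => a.after b
  | fork p q, v =>
      (p.runWith sub v).bind fun a => (q.runWith sub v).map fun b =>
        a.after ⟨.pair a.val b.val, b.time, b.calls⟩
  | ite g p q, v =>
      (g.runWith sub v).bind fun a =>
        (if a.val = .int 0 then q.runWith sub v else p.runWith sub v).map fun b => a.after b
  | .while g p, v => Measure.sum fun n => loopRun (g.runWith sub) (p.runWith sub) n v
  | call i, v =>
      (sub i v).map fun o => ⟨o.val, o.time + v.size + o.val.size, Pi.single i 1⟩

/-- The outcome distribution of a program without subroutines. -/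
def Prog.run (A : Prog Empty) : Val → Measure (Outcome Empty) := A.runWith fun i _ => i.elim

/-- The outcome distribution of a program whose subroutines are programs themselves. -/
def Prog.runSub {ι : Type} (Q : Prog ι) (S : ι → Prog Empty) : Val → Measure (Outcome ι) :=
  Q.runWith fun i => (S i).run

/-! ### Single-source buy-at-bulk -/

/-- An instance: a finite undirected graph with nonnegative rational edge lengths, integer demands
(the demand nodes are the nodes of positive demand; there is at least one), and a root that is
joined to all of them. -/
structure BaB : Type where
  n : ℕ
  graph : SimpleGraph (Fin n)
  len : Sym2 (Fin n) → ℚ≥0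
  demand : Fin n → ℕ
  root : Fin n
  exists_demand : ∃ v, 0 < demand v
  reachable : ∀ v, 0 < demand v → graph.Reachable v root

namespace BaB

/-- The binary logarithm of the total demand rounded up to a power of two. -/
def logD (I : BaB) : ℕ := Nat.clog 2 (∑ v, I.demand v)

/-- A tree in the graph that contains the root and all demand nodes, given by its edges (a vertex
without edges, other than the root, does not belong to the tree). -/
structure IsTree (I : BaB) (T : SimpleGraph (Fin I.n)) : Prop where
  le : T ≤ I.graph
  acyclic : T.IsAcyclic
  connected : ∀ u v, T.Adj u v → T.Reachable u I.root
  spans : ∀ v, 0 < I.demand v → T.Reachable v I.root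

open Classical in
/-- The amount of flow that is routed over `e` when each node sends its demand to the root along
its path in `T`. -/
def flow (I : BaB) (T : SimpleGraph (Fin I.n)) (e : Sym2 (Fin I.n)) : ℕ :=
  ∑ v with ∃ p : T.Walk v I.root, p.IsPath ∧ e ∈ p.edges, I.demand v

open Classical in
/-- The cost `f(T)` of the tree `T` under the cost function `f`. -/
def cost (I : BaB) (f : ℝ → ℝ) (T : SimpleGraph (Fin I.n)) : ℝ :=
  ∑ e with e ∈ T.edgeSet, (I.len e : ℝ) * f (I.flow T e)

/-- The cost of an optimal tree under `f`. -/
def opt (I : BaB) (f : ℝ → ℝ) : ℝ := sInf (I.cost f '' {T | I.IsTree T})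

open Classical in
/-- An instance as input data: the size of the graph, the matrix of edge lengths (a non-edge is
marked by an integer), the demands and the root. -/
def encode (I : BaB) : Val :=
  .pair (.int I.n)
    (.pair
      (.ofList (List.ofFn fun u => .ofList (List.ofFn fun v =>
        if I.graph.Adj u v then .ofRat (I.len s(u, v)) else .int 0)))
      (.pair
        (.ofList (List.ofFn fun v => .int (I.demand v)))
        (.int (I.root : ℕ))))

/-- The graph described by a list of pairs of end points. -/
def readTree (I : BaB) (w : Val) : SimpleGraph (Fin I.n) :=
  SimpleGraph.fromEdgeSet
    {e | ∃ u v : Fin I.n, e = s(u, v) ∧ Val.pair (.int (u : ℕ)) (.int (v : ℕ)) ∈ w.toList}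

/-- The weighted family of graphs described by a list of pairs (tree, weight). -/
def readDist (I : BaB) (w : Val) : List (SimpleGraph (Fin I.n) × ℚ) :=
  w.toList.map fun x => (I.readTree x.fst, x.snd.toRat)

/-- A list of weighted trees that is a probability distribution on the trees of the instance. -/
def IsDist (I : BaB) (L : List (SimpleGraph (Fin I.n) × ℚ)) : Prop :=
  (∀ x ∈ L, I.IsTree x.1 ∧ 0 ≤ x.2) ∧ (L.map fun x => x.2).sum = 1

/-- The expected cost of a random tree with distribution `L`. -/
def distCost (I : BaB) (f : ℝ → ℝ) (L : List (SimpleGraph (Fin I.n) × ℚ)) : ℝ :=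
  (L.map fun x => (x.2 : ℝ) * I.cost f x.1).sum

/-- The trees of an instance exist. -/
theorem exists_isTree (I : BaB) : ∃ T, I.IsTree T := by
  obtain ⟨F, hFG, hF, hr⟩ := I.graph.exists_isAcyclic_reachable_eq_le
  let T : SimpleGraph (Fin I.n) :=
    { Adj := fun u v => F.Adj u v ∧ F.Reachable u I.root
      symm := ⟨fun u v h => ⟨h.1.symm, h.1.symm.reachable.trans h.2⟩⟩
      loopless := ⟨fun u h => F.irrefl h.1⟩ }
  have hTF : T ≤ F := fun u v h => h.1
  have key : ∀ u v : Fin I.n, ∀ p : F.Walk u v, v = I.root → T.Reachable u v := by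
    intro u v p
    induction p with
    | nil => intro _; exact SimpleGraph.Reachable.refl _
    | cons h p ih =>
      intro e
      have hT : T.Adj _ _ := ⟨h, h.reachable.trans (e ▸ p.reachable)⟩
      exact hT.reachable.trans (ih e)
  have key' : ∀ u, F.Reachable u I.root → T.Reachable u I.root := fun u ⟨p⟩ => key u _ p rfl
  exact ⟨T, hTF.trans hFG, hF.anti hTF, fun u v h => key' u h.2,
    fun v hv => key' v (hr ▸ I.reachable v hv)⟩

/-- The optimal cost is attained. -/
theorem exists_cost_eq_opt (I : BaB) (f : ℝ → ℝ) : ∃ T, I.IsTree T ∧ I.cost f T = I.opt f := by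
  obtain ⟨T₀, h₀⟩ := I.exists_isTree
  have h := Set.Nonempty.csInf_mem (s := I.cost f '' {T | I.IsTree T}) ⟨_, T₀, h₀, rfl⟩
    ((Set.toFinite _).image _)
  obtain ⟨T, hT, e⟩ := h
  exact ⟨T, hT, e⟩

end BaB

/-- The aggregation functions: concave and nondecreasing on `[0, ∞)`, and `0` at `0`. -/
structure IsAggregation (f : ℝ → ℝ) : Prop where
  concave : ConcaveOn ℝ (Set.Ici 0) f
  mono : MonotoneOn f (Set.Ici 0)
  zero : f 0 = 0

/-- The rent-or-buy cost function with threshold `M`. -/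
def rentOrBuy (M : ℕ) (x : ℝ) : ℝ := min x M

/-- The `i`-th atomic cost function. -/
def atomic (i : ℕ) : ℝ → ℝ := rentOrBuy (2 ^ i)

/-- The randomized program `R` is a polynomial-time algorithm for single-source rent-or-buy, with
approximation ratio `ρ` in expectation. -/
def IsRentOrBuyApprox (R : Prog Empty) (ρ : ℝ) : Prop :=
  ∃ p : Polynomial ℕ, ∀ (I : BaB) (M : ℕ),
    let w : Val := .pair I.encode (.int M)
    R.run w Set.univ = 1 ∧
    (∀ᵐ o ∂(R.run w), o.time ≤ p.eval w.size ∧ I.IsTree (I.readTree o.val)) ∧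
    ∫⁻ o, ENNReal.ofReal (I.cost (rentOrBuy M) (I.readTree o.val)) ∂(R.run w) ≤
      ENNReal.ofReal (ρ * I.opt (rentOrBuy M))

/-- The ratio `ρ` of a rent-or-buy algorithm is guaranteed for every outcome of its coin tosses. -/
def IsSureRentOrBuyApprox (R : Prog Empty) (ρ : ℝ) : Prop :=
  ∀ (I : BaB) (M : ℕ), ∀ᵐ o ∂(R.run (.pair I.encode (.int M))),
    I.cost (rentOrBuy M) (I.readTree o.val) ≤ ρ * I.opt (rentOrBuy M)

/-- The randomized program `A` is a polynomial-time algorithm that, given an instance and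
nonnegative coefficients `α₀, …, α_{log D}`, finds a tree with
`E[∑ αᵢ Aᵢ(T)] ≤ c ∑ αᵢ Aᵢ(Tᵢ*)`. -/
def IsMultiApprox (A : Prog Empty) (c : ℝ) : Prop :=
  ∃ p : Polynomial ℕ, ∀ (I : BaB) (α : Fin (1 + I.logD) → ℚ≥0),
    let w : Val := .pair I.encode (.ofList (List.ofFn fun i => .ofRat (α i)))
    A.run w Set.univ = 1 ∧
    (∀ᵐ o ∂(A.run w), o.time ≤ p.eval w.size ∧ I.IsTree (I.readTree o.val)) ∧
    ∫⁻ o, ENNReal.ofReal (∑ i, (α i : ℝ) * I.cost (atomic i) (I.readTree o.val)) ∂(A.run w) ≤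
      ENNReal.ofReal (c * ∑ i, (α i : ℝ) * I.opt (atomic i))

/-- The names of the two subroutines. -/
inductive Subroutine : Type
  | multi
  | rob
  deriving DecidableEq

/-- The two subroutines, `A` and `R`. -/
def Subroutine.prog (A R : Prog Empty) : Subroutine → Prog Empty
  | .multi => A
  | .rob => R

end

/-!
On the integers up to the total demand, every aggregation function `f` agrees up to the factor
`5 / 4` with its piecewise linear interpolation at the powers of two, and this interpolation is a
combination of the atomic functions `A₀, …, A_L` with nonnegative coefficients
(`IsAggregation.interpolation_le_and_le`, `IsAggregation.atomicCoeff_nonneg`).  A distribution on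
trees whose expected cost is at most `γ` times the optimal one for every `Aᵢ` is therefore within
`5 γ / 4` of the optimum for every `f`.  It remains to find such a distribution efficiently.

The rent-or-buy algorithm, called once for each `Aᵢ`, yields trees whose costs serve as estimates of
the optimal costs (`exists_collect`); they exceed these costs by at most the factor `ρ`, in
expectation or surely.  Costs are normalized by the estimates.  A tree with a vanishing atomic cost is free under
every cost function (`BaB.cost_eq_zero`), so that the estimates may be assumed to be positive.

Finding the distribution is now a packing problem with one constraint for each `Aᵢ`, for which the
multi-objective algorithm is an oracle: for any weights of the constraints it returns a tree whose
expected weighted normalized cost is at most `c` times the total weight.  By Markov's inequality,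
the tree satisfies this up to a factor `5 / 4` and roundings with probability at least `1 / 5`
(`Context.measure_not_accepts_le`); otherwise it is discarded.  The weights are the amounts by which
the total costs of the trees found so far exceed a level slightly above, so that the sum of the
squares of these amounts grows only linearly with the number of trees
(`Context.potential_le_of_add`).  When polynomially many trees in `log D` have been accepted, the
averages of the normalized costs are below `22 k / 400` with `k = ⌈25 c⌉` (`Context.Sampled.below`).
The number of calls has an exponential tail, because in each round a potential decreases in
expectation by a constant factor (`CallLoop.tail_le`).

If there are more trees than constraints, then one of them is not needed, as in Carathéodory's
theorem (`exists_solution_apply_eq_zero`).  Instead of solving linear equations, the algorithm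
tries all trees, and chooses multiplicities for the others greedily by the same rule as above
(`Context.below_greedy`).  This loses a little in the level, which rises to `24 k / 400` altogether
(`Context.iterate_reduceStep_spec`).  The resulting ratio is
`(5 / 4) * (24 / 400) * 26 c * ρ = 1.95 c ρ`.

All deterministic parts are shown to run in polynomial time by means of closure properties of the
predicate `PT`.  The results of the subroutines are processed further, so that their length has to
be bounded.  A bound for the time alone does not give this immediately, since a program may copy,
in constant time, an input that it does not read; but a program that halts within bounded time
cannot iterate this, and the length of its output is at most linear in the length of its input and
its running time (`exists_ae_size_le`).
-/

noncomputable section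

/-! ### Polynomially bounded quantities and polynomial-time functions -/

/-- Types whose elements can be written down as data for programs.  The encoding need not be
injective: `ℕ`, `ℤ` and `Bool` share codes, and only the size of the code and the action of programs
on it matter. -/
class Code (α : Type) where
  enc : α → Val

open Code

/-- The size of an element of an encoded type. -/
def esize {α : Type} [Code α] (a : α) : ℕ := (enc a).size

instance : Code Val := ⟨id⟩
instance : Code ℤ := ⟨Val.int⟩
instance : Code ℕ := ⟨fun n => Val.int n⟩
instance : Code Bool := ⟨fun b => Val.int (if b then 1 else 0)⟩
instance {α β : Type} [Code α] [Code β] : Code (α × β) := ⟨fun p => .pair (enc p.1) (enc p.2)⟩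
instance {α : Type} [Code α] : Code (List α) := ⟨fun l => Val.ofList (l.map enc)⟩
instance : Code BaB := ⟨BaB.encode⟩

section basics
variable {α β γ δ σ : Type} [Code α] [Code β] [Code γ] [Code δ] [Code σ]

theorem Val.size_pos (v : Val) : 0 < v.size := by
  cases v <;> simp [Val.size]

@[simp] theorem esize_prod (p : α × β) : esize p = esize p.1 + esize p.2 + 1 := rfl
@[simp] theorem esize_nil : esize ([] : List α) = 1 := by simp [esize, enc, Val.ofList, Val.size]
@[simp] theorem esize_cons (a : α) (l : List α) : esize (a :: l) = esize a + esize l + 1 := rfl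
theorem esize_nat (n : ℕ) : esize n = n.size + 1 := by simp [esize, enc, Val.size]
theorem esize_bool (b : Bool) : esize b ≤ 2 := by cases b <;> simp [esize, enc, Val.size]
theorem esize_val (v : Val) : esize v = v.size := rfl

theorem polynomial_eval_mono (p : Polynomial ℕ) {a b : ℕ} (h : a ≤ b) : p.eval a ≤ p.eval b := by
  simp only [Polynomial.eval_eq_sum, Polynomial.sum]
  gcongr

/-- A quantity is polynomially bounded in the size of its argument. -/
@[fun_prop]
def PolyBounded (f : α → ℕ) : Prop := ∃ p : Polynomial ℕ, ∀ a, f a ≤ p.eval (esize a)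

namespace PolyBounded

theorem mono {f g : α → ℕ} (hg : PolyBounded g) (h : ∀ a, f a ≤ g a) : PolyBounded f :=
  hg.imp fun _ hp a => (h a).trans (hp a)

@[fun_prop]
theorem const (n : ℕ) : PolyBounded (fun _ : α => n) := ⟨.C n, fun a => by simp⟩

@[fun_prop]
theorem size_self : PolyBounded (fun a : α => esize a) := ⟨.X, fun a => by simp⟩

@[fun_prop]
theorem add {f g : α → ℕ} (hf : PolyBounded f) (hg : PolyBounded g) :
    PolyBounded (fun a => f a + g a) := by
  obtain ⟨p, hp⟩ := hf
  obtain ⟨q, hq⟩ := hg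
  exact ⟨p + q, fun a => by simpa using add_le_add (hp a) (hq a)⟩

@[fun_prop]
theorem mul {f g : α → ℕ} (hf : PolyBounded f) (hg : PolyBounded g) :
    PolyBounded (fun a => f a * g a) := by
  obtain ⟨p, hp⟩ := hf
  obtain ⟨q, hq⟩ := hg
  exact ⟨p * q, fun a => by simpa using Nat.mul_le_mul (hp a) (hq a)⟩

@[fun_prop]
theorem pow {f : α → ℕ} (hf : PolyBounded f) (n : ℕ) : PolyBounded (fun a => f a ^ n) := by
  obtain ⟨p, hp⟩ := hf
  exact ⟨p ^ n, fun a => by simpa using Nat.pow_le_pow_left (hp a) n⟩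

theorem eval {f : α → ℕ} (hf : PolyBounded f) (q : Polynomial ℕ) :
    PolyBounded (fun a => q.eval (f a)) := by
  obtain ⟨p, hp⟩ := hf
  exact ⟨q.comp p, fun a => by
    rw [Polynomial.eval_comp]; exact polynomial_eval_mono q (hp a)⟩

theorem comp {f : β → ℕ} {g : α → β} (hf : PolyBounded f) (hg : PolyBounded fun a => esize (g a)) :
    PolyBounded (fun a => f (g a)) := by
  obtain ⟨p, hp⟩ := hf
  exact (hg.eval p).mono fun a => hp _

end PolyBounded

/-- A function is computed by a deterministic program in polynomial time, without calls of
subroutines, so that the outcome does not depend on them.  A bound for the size of the value is part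
of the definition: it does not follow from the bound for the time without further work, and
without it such functions could not be composed. -/
@[fun_prop]
def PT (f : α → β) : Prop :=
  ∃ (p : Prog Subroutine) (T : Polynomial ℕ), ∀ a,
    esize (f a) ≤ T.eval (esize a) ∧
    ∀ sub, ∃ t ≤ T.eval (esize a), p.runWith sub (enc a) = Measure.dirac ⟨enc (f a), t, 0⟩

theorem Outcome.measurable {ι : Type} {β : Type*} [MeasurableSpace β] (f : Outcome ι → β) :
    Measurable f := measurable_from_top

theorem runWith_seq_dirac {ι : Type} {sub : ι → Val → Measure (Outcome Empty)} {p q : Prog ι}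
    {v : Val} {a b : Outcome ι} (hp : p.runWith sub v = Measure.dirac a)
    (hq : q.runWith sub a.val = Measure.dirac b) :
    (Prog.seq p q).runWith sub v = Measure.dirac (a.after b) := by
  rw [Prog.runWith, hp, Measure.dirac_bind (Outcome.measurable _), hq,
    Measure.map_dirac' (Outcome.measurable _)]

theorem runWith_fork_dirac {ι : Type} {sub : ι → Val → Measure (Outcome Empty)} {p q : Prog ι}
    {v : Val} {a b : Outcome ι} (hp : p.runWith sub v = Measure.dirac a)
    (hq : q.runWith sub v = Measure.dirac b) :
    (Prog.fork p q).runWith sub v =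
      Measure.dirac (a.after ⟨.pair a.val b.val, b.time, b.calls⟩) := by
  rw [Prog.runWith, hp, Measure.dirac_bind (Outcome.measurable _), hq,
    Measure.map_dirac' (Outcome.measurable _)]

theorem runWith_ite_dirac {ι : Type} {sub : ι → Val → Measure (Outcome Empty)} {g p q : Prog ι}
    {v : Val} {a b : Outcome ι} (hg : g.runWith sub v = Measure.dirac a)
    (h : (if a.val = .int 0 then q else p).runWith sub v = Measure.dirac b) :
    (Prog.ite g p q).runWith sub v = Measure.dirac (a.after b) := by
  rw [Prog.runWith, hg, Measure.dirac_bind (Outcome.measurable _)]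
  split_ifs at h ⊢ <;> rw [h, Measure.map_dirac' (Outcome.measurable _)]

/-- A loop whose guard and body are deterministic along the orbit `x 0, …, x N`. -/
theorem sum_loopRun_dirac {ι : Type} {G P : Val → Measure (Outcome ι)} {B : ℕ} (N : ℕ)
    (x : ℕ → Val)
    (hG : ∀ k ≤ N, ∃ t ≤ B, G (x k) = Measure.dirac ⟨.int (if k < N then 1 else 0), t, 0⟩)
    (hP : ∀ k < N, ∃ t ≤ B, P (x k) = Measure.dirac ⟨x (k + 1), t, 0⟩) :
    ∃ t ≤ (N + 1) * (2 * B + 3),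
      Measure.sum (fun n => loopRun G P n (x 0)) = Measure.dirac ⟨x N, t, 0⟩ := by
  suffices H : ∃ t ≤ (N + 1) * (2 * B + 3), ∀ n,
      loopRun G P n (x 0) = if n = N then Measure.dirac ⟨x N, t, 0⟩ else 0 by
    obtain ⟨t, ht, h⟩ := H
    refine ⟨t, ht, ?_⟩
    ext s hs
    rw [Measure.sum_apply _ hs, tsum_eq_single N]
    · simp [h]
    · intro n hn
      simp [h, hn]
  induction N generalizing x with
  | zero =>
    obtain ⟨t, ht, h⟩ := hG 0 le_rfl
    refine ⟨t + 1, by omega, fun n => ?_⟩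
    cases n with
    | zero => simp [loopRun, h, Measure.dirac_bind (Outcome.measurable _)]
    | succ n => simp [loopRun, h, Measure.dirac_bind (Outcome.measurable _)]
  | succ N ih =>
    obtain ⟨t, ht, h⟩ := hG 0 (Nat.zero_le _)
    obtain ⟨t', ht', h'⟩ := hP 0 (Nat.succ_pos _)
    obtain ⟨u, hu, ih⟩ := ih (fun k => x (k + 1))
      (fun k hk => by simpa using hG (k + 1) (by omega)) (fun k hk => hP (k + 1) (by omega))
    refine ⟨t + (t' + u + 1) + 1, by nlinarith, fun n => ?_⟩
    cases n with
    | zero => simp [loopRun, h, Measure.dirac_bind (Outcome.measurable _)]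
    | succ n =>
      simp only [loopRun, h, Measure.dirac_bind (Outcome.measurable _), h']
      simp only [Nat.succ_pos, if_true, zero_add] at ih ⊢
      rw [ih]
      by_cases hn : n = N
      · simp [hn, Measure.map_dirac' (Outcome.measurable _), Outcome.after]
      · simp [hn]

namespace PT

theorem size {f : α → β} (hf : PT f) : PolyBounded (fun a => esize (f a)) := by
  obtain ⟨p, T, h⟩ := hf
  exact ⟨T, fun a => (h a).1⟩

theorem congr {f g : α → β} (hf : PT f) (h : ∀ a, g a = f a) : PT g := by
  have : g = f := funext h
  rwa [this]

/-- The basic building block: a primitive operation. -/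
theorem op {f : α → β} (o : Op) (h : ∀ a, o.eval (enc a) = enc (f a))
    (hs : PolyBounded fun a => esize (f a)) : PT f := by
  obtain ⟨T, hT⟩ := hs
  refine ⟨.op o, .X ^ 2 + T, fun a => ⟨?_, fun sub => ⟨esize a ^ 2 + esize (f a), ?_, ?_⟩⟩⟩
  · have : esize (f a) ≤ T.eval (esize a) := hT a
    simp; omega
  · have := hT a; simpa using this
  · rw [Prog.runWith, h]; rfl

@[fun_prop]
theorem id' : PT (fun a : α => a) := op .ident (fun _ => rfl) .size_self

@[fun_prop]
theorem const (b : β) : PT (fun _ : α => b) := op (.const (enc b)) (fun _ => rfl) (.const _)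

@[fun_prop]
theorem comp {g : β → γ} {f : α → β} (hg : PT g) (hf : PT f) : PT (fun a => g (f a)) := by
  obtain ⟨p, T, hp⟩ := hf
  obtain ⟨q, U, hq⟩ := hg
  refine ⟨.seq p q, T + U.comp T + 1, fun a => ⟨?_, fun sub => ?_⟩⟩
  · have h1 := (hq (f a)).1
    have h2 := polynomial_eval_mono U (hp a).1
    simp only [Polynomial.eval_add, Polynomial.eval_comp, Polynomial.eval_one]
    omega
  · obtain ⟨t, ht, h⟩ := (hp a).2 sub
    obtain ⟨u, hu, h'⟩ := (hq (f a)).2 sub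
    refine ⟨t + u + 1, ?_, ?_⟩
    · have h2 := polynomial_eval_mono U (hp a).1
      simp only [Polynomial.eval_add, Polynomial.eval_comp, Polynomial.eval_one]
      omega
    · rw [runWith_seq_dirac h h']; simp [Outcome.after]

@[fun_prop]
theorem prodMk {f : α → β} {g : α → γ} (hf : PT f) (hg : PT g) : PT (fun a => (f a, g a)) := by
  obtain ⟨p, T, hp⟩ := hf
  obtain ⟨q, U, hq⟩ := hg
  refine ⟨.fork p q, T + U + 1, fun a => ⟨?_, fun sub => ?_⟩⟩
  · have h1 := (hq a).1
    have h2 := (hp a).1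
    simp
    omega
  · obtain ⟨t, ht, h⟩ := (hp a).2 sub
    obtain ⟨u, hu, h'⟩ := (hq a).2 sub
    refine ⟨t + u + 1, ?_, ?_⟩
    · simp
      omega
    · rw [runWith_fork_dirac h h']; simp [Outcome.after]; rfl

@[fun_prop]
theorem fst {f : α → β × γ} (hf : PT f) : PT (fun a => (f a).1) :=
  comp (op .fst (fun _ => rfl)
    (PolyBounded.size_self.mono fun a => by simp; omega)) hf

@[fun_prop]
theorem snd {f : α → β × γ} (hf : PT f) : PT (fun a => (f a).2) :=
  comp (op .snd (fun _ => rfl)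
    (PolyBounded.size_self.mono fun a => by simp; omega)) hf

theorem enc_bool_eq_zero (b : Bool) : (enc b = Val.int 0) ↔ b = false := by
  cases b <;> simp [enc]

@[fun_prop]
theorem cond {c : α → Bool} {f g : α → β} (hc : PT c) (hf : PT f) (hg : PT g) :
    PT (fun a => if c a then f a else g a) := by
  obtain ⟨r, S, hr⟩ := hc
  obtain ⟨p, T, hp⟩ := hf
  obtain ⟨q, U, hq⟩ := hg
  refine ⟨.ite r p q, S + T + U + 1, fun a => ⟨?_, fun sub => ?_⟩⟩
  · have h1 := (hq a).1
    have h2 := (hp a).1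
    simp
    split_ifs <;> omega
  · obtain ⟨s, hs, h''⟩ := (hr a).2 sub
    obtain ⟨t, ht, h⟩ := (hp a).2 sub
    obtain ⟨u, hu, h'⟩ := (hq a).2 sub
    by_cases hca : c a = true
    · refine ⟨s + t + 1, ?_, ?_⟩
      · simp; omega
      · rw [runWith_ite_dirac h'' (b := ⟨enc (f a), t, 0⟩)]
        · simp [Outcome.after, hca]
        · rw [if_neg (by simp [enc_bool_eq_zero, hca]), h]
    · refine ⟨s + u + 1, ?_, ?_⟩
      · simp; omega
      · rw [runWith_ite_dirac h'' (b := ⟨enc (g a), u, 0⟩)]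
        · simp [Outcome.after, hca]
        · rw [if_pos (by simp [enc_bool_eq_zero, hca]), h']

/-- The basic form of iteration: a loop that runs `n a` times, the guard `c` being true before each
round and false in the end.  The number of rounds and the size of all intermediate states have to
be polynomially bounded. -/
theorem loop {c : σ → Bool} {f : σ → σ} {i : α → σ} (hc : PT c) (hf : PT f) (hi : PT i)
    (n : α → ℕ) (hn : PolyBounded n) (h1 : ∀ a, ∀ k < n a, c (f^[k] (i a)) = true)
    (h0 : ∀ a, c (f^[n a] (i a)) = false) (s : α → ℕ) (hs : PolyBounded s)
    (hle : ∀ a, ∀ k ≤ n a, esize (f^[k] (i a)) ≤ s a) : PT (fun a => f^[n a] (i a)) := by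
  obtain ⟨r, S, hr⟩ := hc
  obtain ⟨p, T, hp⟩ := hf
  obtain ⟨q, U, hq⟩ := hi
  obtain ⟨W, hW⟩ := hs
  obtain ⟨M, hM⟩ := hn
  refine ⟨.seq q (.while r p), U + W + (M + 1) * (2 * (S.comp W + T.comp W) + 3) + 1,
    fun a => ⟨?_, fun sub => ?_⟩⟩
  · have h1 := (hle a _ le_rfl).trans (hW a)
    simp only [Polynomial.eval_add]
    omega
  · obtain ⟨u, hu, h⟩ := (hq a).2 sub
    obtain ⟨t, ht, h'⟩ := sum_loopRun_dirac (G := r.runWith sub) (P := p.runWith sub)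
      (B := S.eval (W.eval (esize a)) + T.eval (W.eval (esize a))) (n a)
      (fun k => enc (f^[k] (i a))) (fun k hk => by
        obtain ⟨t, ht, h⟩ := (hr (f^[k] (i a))).2 sub
        refine ⟨t, ?_, ?_⟩
        · have := polynomial_eval_mono S ((hle a k hk).trans (hW a))
          omega
        · rw [h]
          split_ifs with hkn
          · rw [h1 a k hkn]; rfl
          · obtain rfl : k = n a := by omega
            rw [h0 a]; rfl) (fun k hk => by
        obtain ⟨t, ht, h⟩ := (hp (f^[k] (i a))).2 sub
        refine ⟨t, ?_, ?_⟩
        · have := polynomial_eval_mono T ((hle a k hk.le).trans (hW a))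
          omega
        · rw [h, Function.iterate_succ_apply'])
    refine ⟨u + t + 1, ?_, ?_⟩
    · have : (n a + 1) * (2 * (S.eval (W.eval (esize a)) + T.eval (W.eval (esize a))) + 3) ≤
        (M.eval (esize a) + 1) * (2 * (S.eval (W.eval (esize a)) + T.eval (W.eval (esize a))) + 3) :=
        Nat.mul_le_mul_right _ (by have := hM a; omega)
      simp [Polynomial.eval_comp]
      omega
    · rw [runWith_seq_dirac h (b := ⟨enc (f^[n a] (i a)), t, 0⟩)]
      · simp [Outcome.after]
      · rw [Prog.runWith]
        exact h'

end PT
end basics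

/-! ### Arithmetic in polynomial time -/

section scalars
variable {α β γ δ σ : Type} [Code α] [Code β] [Code γ] [Code δ] [Code σ]

theorem Nat.size_add_le (a b : ℕ) : (a + b).size ≤ a.size + b.size + 1 := by
  rw [Nat.size_le]
  have ha := Nat.lt_size_self a
  have hb := Nat.lt_size_self b
  have h1 : 2 ^ a.size ≤ 2 ^ (a.size + b.size) := Nat.pow_le_pow_right (by norm_num) (by omega)
  have h2 : 2 ^ b.size ≤ 2 ^ (a.size + b.size) := Nat.pow_le_pow_right (by norm_num) (by omega)
  rw [pow_succ]
  omega

theorem Nat.size_mul_le (a b : ℕ) : (a * b).size ≤ a.size + b.size := by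
  rw [Nat.size_le, pow_add]
  exact Nat.mul_lt_mul'' (Nat.lt_size_self a) (Nat.lt_size_self b)

theorem Nat.size_le_self (n : ℕ) : n.size ≤ n :=
  Nat.size_le.2 n.lt_two_pow_self

/-- The number of bits of a natural number is polynomially bounded in the size of the argument. -/
@[fun_prop]
def PolyBits (f : α → ℕ) : Prop := PolyBounded fun a => (f a).size

namespace PolyBits

@[fun_prop]
theorem const (n : ℕ) : PolyBits (fun _ : α => n) := PolyBounded.const _

@[fun_prop]
theorem add {f g : α → ℕ} (hf : PolyBits f) (hg : PolyBits g) : PolyBits (fun a => f a + g a) :=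
  ((PolyBounded.add hf hg).add (.const 1)).mono fun _ => Nat.size_add_le _ _

@[fun_prop]
theorem mul {f g : α → ℕ} (hf : PolyBits f) (hg : PolyBits g) : PolyBits (fun a => f a * g a) :=
  (PolyBounded.add hf hg).mono fun _ => Nat.size_mul_le _ _

theorem of_polyBounded {f : α → ℕ} (hf : PolyBounded f) : PolyBits f :=
  PolyBounded.mono hf fun _ => Nat.size_le_self _

end PolyBits

namespace PT

theorem polyBits {f : α → ℕ} (hf : PT f) : PolyBits f :=
  hf.size.mono fun a => by rw [esize_nat]; omega

/-- Computability in polynomial time is a property of the codes of the values. -/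
theorem of_enc {f : α → β} (h : PT fun a => (enc (f a) : Val)) : PT f := h

@[fun_prop]
theorem enc {f : α → β} (h : PT f) : PT fun a => (Code.enc (f a) : Val) := h

@[fun_prop]
theorem valFst {f : α → Val} (hf : PT f) : PT (fun a => (f a).fst) :=
  comp (op .fst (fun _ => rfl) (PolyBounded.size_self.mono fun a => by
    cases a <;> simp [Val.fst, esize, Code.enc, Val.size]; omega)) hf

@[fun_prop]
theorem valSnd {f : α → Val} (hf : PT f) : PT (fun a => (f a).snd) :=
  comp (op .snd (fun _ => rfl) (PolyBounded.size_self.mono fun a => by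
    cases a <;> simp [Val.snd, esize, Code.enc, Val.size]; omega)) hf

/-- Whether a datum is a pair. -/
def _root_.Val.isPair : Val → Bool
  | .pair _ _ => true
  | .int _ => false

@[fun_prop]
theorem isPair {f : α → Val} (hf : PT f) : PT (fun a => (f a).isPair) :=
  comp (op .isPair (fun v => by cases v <;> rfl)
    ((PolyBounded.const 2).mono fun a => esize_bool _)) hf

theorem esize_int (z : ℤ) : esize z = z.natAbs.size + 1 := rfl

@[fun_prop]
theorem intAdd {f g : α → ℤ} (hf : PT f) (hg : PT g) : PT (fun a => f a + g a) :=
  comp (g := fun p : ℤ × ℤ => p.1 + p.2) (op .add (fun _ => rfl)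
    (PolyBounded.size_self.mono fun a => by
    have h1 := Nat.size_le_size (Int.natAbs_add_le a.1 a.2)
    have h2 := Nat.size_add_le a.1.natAbs a.2.natAbs
    simp only [esize_int, esize_prod]; omega)) (prodMk hf hg)

@[fun_prop]
theorem intSub {f g : α → ℤ} (hf : PT f) (hg : PT g) : PT (fun a => f a - g a) :=
  comp (g := fun p : ℤ × ℤ => p.1 - p.2) (op .sub (fun _ => rfl)
    (PolyBounded.size_self.mono fun a => by
    have h1 := Nat.size_le_size (Int.natAbs_sub_le a.1 a.2)
    have h2 := Nat.size_add_le a.1.natAbs a.2.natAbs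
    simp only [esize_int, esize_prod]; omega)) (prodMk hf hg)

@[fun_prop]
theorem intMul {f g : α → ℤ} (hf : PT f) (hg : PT g) : PT (fun a => f a * g a) :=
  comp (g := fun p : ℤ × ℤ => p.1 * p.2) (op .mul (fun _ => rfl)
    (PolyBounded.size_self.mono fun a => by
    have h2 := Nat.size_mul_le a.1.natAbs a.2.natAbs
    simp only [esize_int, esize_prod, Int.natAbs_mul]; omega)) (prodMk hf hg)

@[fun_prop]
theorem intDiv {f g : α → ℤ} (hf : PT f) (hg : PT g) : PT (fun a => f a / g a) :=
  comp (g := fun p : ℤ × ℤ => p.1 / p.2) (op .div (fun _ => rfl)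
    (PolyBounded.size_self.mono fun a => by
    have h2 := Nat.size_le_size (Int.natAbs_ediv_le_natAbs a.1 a.2)
    simp only [esize_int, esize_prod]; omega)) (prodMk hf hg)

@[fun_prop]
theorem intLe {f g : α → ℤ} (hf : PT f) (hg : PT g) : PT (fun a => decide (f a ≤ g a)) :=
  comp (g := fun p : ℤ × ℤ => decide (p.1 ≤ p.2)) (op .le (fun p => by
    by_cases h : p.1 ≤ p.2 <;> simp [Op.eval, Code.enc, Val.fst, Val.snd, Val.toInt, h])
    ((PolyBounded.const 2).mono fun a => esize_bool _)) (prodMk hf hg)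

@[fun_prop]
theorem valToInt {f : α → Val} (hf : PT f) : PT (fun a => (f a).toInt) := by
  -- adding `0` to the first component of a pair reads the integer at a leaf
  have h : PT (fun v : Val => v.toInt) :=
    comp (g := fun p : Val × Val => p.1.toInt + p.2.toInt)
      (f := fun v : Val => (v, Val.int 0)) (op .add (fun _ => rfl)
      (PolyBounded.size_self.mono fun p => by
        have key : ∀ v : Val, v.toInt.natAbs.size + 1 ≤ v.size := by
          intro v; cases v <;> simp [Val.toInt, Val.size]
        have h1 := Nat.size_le_size (Int.natAbs_add_le p.1.toInt p.2.toInt)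
        have h2 := Nat.size_add_le p.1.toInt.natAbs p.2.toInt.natAbs
        have h3 := key p.1
        have h4 := key p.2
        simp only [esize_int, esize_prod, esize_val]; omega)) (by fun_prop)
      |>.congr (fun v => by simp [Val.toInt])
  exact comp h hf

@[fun_prop]
theorem ite {p : α → Prop} [∀ a, Decidable (p a)] {f g : α → β} (hp : PT fun a => decide (p a))
    (hf : PT f) (hg : PT g) : PT (fun a => if p a then f a else g a) :=
  (cond hp hf hg).congr fun a => by simp

@[fun_prop]
theorem decide_bool {b : α → Bool} (hb : PT b) : PT (fun a => decide (b a = true)) :=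
  hb.congr fun a => by simp

@[fun_prop]
theorem and {b c : α → Bool} (hb : PT b) (hc : PT c) : PT (fun a => b a && c a) :=
  (cond hb hc (const false)).congr fun a => by cases b a <;> simp

@[fun_prop]
theorem or {b c : α → Bool} (hb : PT b) (hc : PT c) : PT (fun a => b a || c a) :=
  (cond hb (const true) hc).congr fun a => by cases b a <;> simp

@[fun_prop]
theorem not {b : α → Bool} (hb : PT b) : PT (fun a => !b a) :=
  (cond hb (const false) (const true)).congr fun a => by cases b a <;> simp

@[fun_prop]
theorem decide_and {p q : α → Prop} [∀ a, Decidable (p a)] [∀ a, Decidable (q a)]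
    (hp : PT fun a => decide (p a)) (hq : PT fun a => decide (q a)) :
    PT (fun a => decide (p a ∧ q a)) := (hp.and hq).congr fun a => by simp

@[fun_prop]
theorem decide_or {p q : α → Prop} [∀ a, Decidable (p a)] [∀ a, Decidable (q a)]
    (hp : PT fun a => decide (p a)) (hq : PT fun a => decide (q a)) :
    PT (fun a => decide (p a ∨ q a)) := (hp.or hq).congr fun a => by simp

@[fun_prop]
theorem decide_not {p : α → Prop} [∀ a, Decidable (p a)]
    (hp : PT fun a => decide (p a)) :
    PT (fun a => decide (¬ p a)) := hp.not.congr fun a => by simp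

@[fun_prop]
theorem natCast {f : α → ℕ} (hf : PT f) : PT (fun a => (f a : ℤ)) := hf

/-- Negative integers are mapped to `0`, as in `Int.toNat`; with this, the arithmetic of natural
numbers, truncated subtraction included, is reduced to that of the integers. -/
@[fun_prop]
theorem toNat {f : α → ℤ} (hf : PT f) : PT (fun a => (f a).toNat) := by
  have h : PT (fun a => if decide (f a ≤ 0) then (0 : ℤ) else f a) := by fun_prop
  refine of_enc (PT.enc h |>.congr fun a => ?_)
  change Val.int _ = Val.int _
  congr 1
  by_cases h : f a ≤ 0
  · simp [h]
  · simp [h]; omega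

@[fun_prop]
theorem natAdd {f g : α → ℕ} (hf : PT f) (hg : PT g) : PT (fun a => f a + g a) :=
  (intAdd hf.natCast hg.natCast).toNat.congr fun a => by omega

@[fun_prop]
theorem natSub {f g : α → ℕ} (hf : PT f) (hg : PT g) : PT (fun a => f a - g a) :=
  (intSub hf.natCast hg.natCast).toNat.congr fun a => by omega

@[fun_prop]
theorem natMul {f g : α → ℕ} (hf : PT f) (hg : PT g) : PT (fun a => f a * g a) :=
  (intMul hf.natCast hg.natCast).toNat.congr fun a => by
    rw [← Nat.cast_mul, Int.toNat_natCast]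

@[fun_prop]
theorem natDiv {f g : α → ℕ} (hf : PT f) (hg : PT g) : PT (fun a => f a / g a) :=
  (intDiv hf.natCast hg.natCast).toNat.congr fun a => by
    rw [← Int.natCast_ediv, Int.toNat_natCast]

@[fun_prop]
theorem natPow {f : α → ℕ} (hf : PT f) (n : ℕ) : PT (fun a => f a ^ n) := by
  induction n with
  | zero => simpa using const 1
  | succ n ih => simpa [pow_succ] using natMul ih hf

@[fun_prop]
theorem natLe {f g : α → ℕ} (hf : PT f) (hg : PT g) : PT (fun a => decide (f a ≤ g a)) :=
  (intLe hf.natCast hg.natCast).congr fun a => by simp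

@[fun_prop]
theorem natLt {f g : α → ℕ} (hf : PT f) (hg : PT g) : PT (fun a => decide (f a < g a)) :=
  (natLe (natAdd hf (const 1)) hg).congr fun a => by simp only [decide_eq_decide]; omega

@[fun_prop]
theorem natEq {f g : α → ℕ} (hf : PT f) (hg : PT g) : PT (fun a => decide (f a = g a)) :=
  (and (natLe hf hg) (natLe hg hf)).congr fun a => by
    rw [← Bool.decide_and]; simp only [decide_eq_decide]; omega

@[fun_prop]
theorem intEq {f g : α → ℤ} (hf : PT f) (hg : PT g) : PT (fun a => decide (f a = g a)) :=
  (and (intLe hf hg) (intLe hg hf)).congr fun a => by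
    rw [← Bool.decide_and]; simp only [decide_eq_decide]; omega

@[fun_prop]
theorem natMin {f g : α → ℕ} (hf : PT f) (hg : PT g) : PT (fun a => min (f a) (g a)) :=
  (ite (natLe hf hg) hf hg).congr fun a => by rw [min_def]

@[fun_prop]
theorem natMax {f g : α → ℕ} (hf : PT f) (hg : PT g) : PT (fun a => max (f a) (g a)) :=
  (ite (natLe hf hg) hg hf).congr fun a => by rw [max_def]

end PT
end scalars

/-! ### Lists in polynomial time -/

section lists
variable {α β γ δ σ : Type} [Code α] [Code β] [Code γ] [Code δ] [Code σ]

instance : Inhabited Val := ⟨.int 0⟩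

theorem esize_list (l : List α) : esize l = (l.map fun x => esize x + 1).sum + 1 := by
  induction l with
  | nil => simp
  | cons a l ih => simp [ih]; omega

theorem esize_le_of_mem {l : List α} {x : α} (h : x ∈ l) : esize x < esize l := by
  rw [esize_list]
  have := List.single_le_sum (l := l.map fun x => esize x + 1) (by simp) _ (List.mem_map_of_mem h)
  omega

theorem length_lt_esize (l : List α) : l.length < esize l := by
  induction l with
  | nil => simp
  | cons a l ih => simp; omega

theorem esize_le_of_sublist {l l' : List α} (h : l'.Sublist l) : esize l' ≤ esize l := by
  induction h with
  | slnil => simp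
  | cons a h ih => simp; omega
  | cons_cons a h ih => simp; omega

theorem esize_append (l l' : List α) : esize (l ++ l') + 1 = esize l + esize l' := by
  induction l with
  | nil => simp; omega
  | cons a l ih => simp at ih ⊢; omega

theorem esize_reverse (l : List α) : esize l.reverse = esize l := by
  rw [esize_list, esize_list, List.map_reverse, List.sum_reverse]

theorem esize_list_le {l : List α} {b : ℕ} (h : ∀ x ∈ l, esize x ≤ b) :
    esize l ≤ l.length * (b + 1) + 1 := by
  induction l with
  | nil => simp
  | cons a l ih =>
    have h1 := ih fun x hx => h x (by simp [hx])
    have h2 := h a (by simp)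
    simp only [esize_cons, List.length_cons]
    linarith

namespace PT

@[fun_prop]
theorem cons {f : α → β} {l : α → List β} (hf : PT f) (hl : PT l) : PT fun a => f a :: l a :=
  prodMk hf hl

@[fun_prop]
theorem tail {l : α → List β} (hl : PT l) : PT fun a => (l a).tail :=
  of_enc ((valSnd hl.enc).congr fun a => by cases h : l a <;> rfl)

@[fun_prop]
theorem headD {l : α → List β} (hl : PT l) (d : β) : PT fun a => (l a).headD d :=
  of_enc ((cond (isPair hl.enc) (valFst hl.enc) (const (Code.enc d))).congr fun a => by
    cases h : l a <;> rfl)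

@[fun_prop]
theorem isEmpty {l : α → List β} (hl : PT l) : PT fun a => (l a).isEmpty :=
  (not (isPair hl.enc)).congr fun a => by cases h : l a <;> rfl

/-- A fold is a loop over triples of the argument, the rest of the list, and the state.  The size of
all intermediate states has to be polynomially bounded. -/
theorem foldl [Inhabited β] {l : α → List β} {i : α → σ} {g : α → σ → β → σ} (hl : PT l)
    (hi : PT i) (hg : PT fun p : α × σ × β => g p.1 p.2.1 p.2.2) (s : α → ℕ) (hs : PolyBounded s)
    (h : ∀ a l', l' <+: l a → esize (l'.foldl (g a) (i a)) ≤ s a) :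
    PT fun a => (l a).foldl (g a) (i a) := by
  let f : α × List β × σ → α × List β × σ :=
    fun p => (p.1, p.2.1.tail, g p.1 p.2.2 (p.2.1.headD default))
  have hf : PT f := by
    have : PT fun p : α × List β × σ => g p.1 p.2.2 (p.2.1.headD default) :=
      comp (f := fun p : α × List β × σ => (p.1, p.2.2, p.2.1.headD default)) hg (by fun_prop)
    fun_prop
  have key : ∀ a, ∀ k ≤ (l a).length, f^[k] (a, l a, i a) =
      (a, (l a).drop k, ((l a).take k).foldl (g a) (i a)) := by
    intro a k hk
    induction k with
    | zero => simp
    | succ k ih =>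
      rw [Function.iterate_succ_apply', ih (by omega)]
      simp only [f]
      rw [List.take_add_one, List.foldl_append]
      simp only [List.tail_drop]
      have : (l a)[k]? = some (l a)[k] := List.getElem?_eq_getElem (by omega)
      rw [List.drop_eq_getElem_cons (i := k) (l := l a) (by omega)]
      simp [this]
  have := loop (c := fun p : α × List β × σ => !p.2.1.isEmpty) (f := f)
    (i := fun a => (a, l a, i a)) (by fun_prop) hf (by fun_prop) (fun a => (l a).length)
    (hl.size.mono fun a => (length_lt_esize _).le) (fun a k hk => by
      rw [key a k hk.le]; simpa using hk) (fun a => by rw [key a _ le_rfl]; simp)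
    (fun a => esize a + esize (l a) + s a + 2) (by have := hl.size; fun_prop) (fun a k hk => by
      rw [key a k hk]
      have h1 := h a _ (List.take_prefix k (l a))
      have h2 := esize_le_of_sublist (List.drop_sublist k (l a))
      simp only [esize_prod]; omega)
  exact (this.snd.snd).congr fun a => by rw [key a _ le_rfl]; simp

@[fun_prop]
theorem reverse [Inhabited β] {l : α → List β} (hl : PT l) : PT fun a => (l a).reverse := by
  have e : ∀ l l' : List β, l.foldl (fun s x => x :: s) l' = l.reverse ++ l' := by
    intro l
    induction l with
    | nil => simp
    | cons a l ih => intro l'; simp [ih]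
  refine (foldl (g := fun _ s x => x :: s) (i := fun _ => []) hl (by fun_prop) (by fun_prop)
    (fun a => esize (l a)) hl.size fun a l' h => ?_).congr fun a => ?_
  · rw [e, List.append_nil, esize_reverse]
    exact esize_le_of_sublist h.sublist
  · rw [e, List.append_nil]

@[fun_prop]
theorem append [Inhabited β] {l l' : α → List β} (hl : PT l) (hl' : PT l') :
    PT fun a => l a ++ l' a := by
  have e : ∀ l l' : List β, l.foldl (fun s x => x :: s) l' = l.reverse ++ l' := by
    intro l
    induction l with
    | nil => simp
    | cons a l ih => intro l'; simp [ih]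
  refine (foldl (l := fun a => (l a).reverse) (g := fun _ s x => x :: s) (by fun_prop) hl'
    (by fun_prop) (fun a => esize (l a) + esize (l' a))
    (by have := hl.size; have := hl'.size; fun_prop) fun a m h => ?_).congr fun a => ?_
  · rw [e]
    have := esize_append m.reverse (l' a)
    have h2 := esize_le_of_sublist h.sublist
    rw [esize_reverse] at this h2
    omega
  · rw [e, List.reverse_reverse]

@[fun_prop]
theorem length [Inhabited β] {l : α → List β} (hl : PT l) : PT fun a => (l a).length := by
  have e : ∀ (l : List β) (n : ℕ), l.foldl (fun s _ => s + 1) n = n + l.length := by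
    intro l
    induction l with
    | nil => simp
    | cons a l ih => intro n; simp only [List.foldl_cons, ih, List.length_cons]; omega
  refine (foldl (g := fun _ s _ => s + 1) (i := fun _ => 0) hl (by fun_prop) (by fun_prop)
    (fun a => esize (l a) + 1) (by have := hl.size; fun_prop) fun a l' h => ?_).congr fun a => ?_
  · rw [e, esize_nat]
    have := Nat.size_le_self (0 + l'.length)
    have h2 := length_lt_esize l'
    have h2 := esize_le_of_sublist h.sublist
    omega
  · rw [e, zero_add]

theorem map [Inhabited β] [Inhabited γ] {l : α → List β} {g : α → β → γ} (hl : PT l)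
    (hg : PT fun p : α × β => g p.1 p.2) : PT fun a => (l a).map (g a) := by
  have e : ∀ a (l : List β), l.foldl (fun s x => g a x :: s) [] = (l.map (g a)).reverse := by
    intro a l
    have : ∀ l', l.foldl (fun s x => g a x :: s) l' = (l.map (g a)).reverse ++ l' := by
      induction l with
      | nil => simp
      | cons a l ih => intro l'; simp [ih]
    simp [this]
  obtain ⟨T, hT⟩ := hg.size
  have : PT fun a => (l a).foldl (fun s x => g a x :: s) [] := by
    refine foldl (i := fun _ => []) hl (by fun_prop) ?_
      (fun a => esize (l a) * (T.eval (esize a + esize (l a) + 1) + 1) + 1) ?_ fun a l' h => ?_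
    · have : PT fun p : α × List γ × β => g p.1 p.2.2 :=
        comp (f := fun p : α × List γ × β => (p.1, p.2.2)) hg (by fun_prop)
      fun_prop
    · have := hl.size
      have := PolyBounded.eval (α := α) (f := fun a => esize a + esize (l a) + 1) (by fun_prop) T
      fun_prop
    · rw [e, esize_reverse]
      have h1 : esize (l'.map (g a)) ≤
          (l'.map (g a)).length * (T.eval (esize a + esize (l a) + 1) + 1) + 1 := by
        refine esize_list_le fun y hy => ?_
        obtain ⟨x, hx, rfl⟩ := List.mem_map.1 hy
        refine (hT (a, x)).trans (polynomial_eval_mono T ?_)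
        have := esize_le_of_mem (h.subset hx)
        simp; omega
      have h2 := length_lt_esize l'
      have h3 := esize_le_of_sublist h.sublist
      rw [List.length_map] at h1
      refine h1.trans ?_
      gcongr
      omega
  exact this.reverse.congr fun a => by rw [e, List.reverse_reverse]

@[fun_prop]
theorem listSum {l : α → List ℕ} (hl : PT l) : PT fun a => (l a).sum := by
  have e : ∀ l : List ℕ, l.sum.size ≤ esize l := by
    intro l
    induction l with
    | nil => simp
    | cons a l ih =>
      have := Nat.size_add_le a l.sum
      simp [esize_nat]; omega
  refine (foldl (g := fun _ s x => s + x) (i := fun _ => 0) hl (by fun_prop) (by fun_prop)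
    (fun a => esize (l a) + 1) (by have := hl.size; fun_prop) fun a l' h => ?_).congr fun a => ?_
  · have : l'.foldl (fun s x => s + x) 0 = l'.sum := (List.sum_eq_foldl (xs := l')).symm
    rw [this, esize_nat]
    have h2 := esize_le_of_sublist h.sublist
    have := e l'
    omega
  · exact List.sum_eq_foldl

@[fun_prop]
theorem listProd {l : α → List ℕ} (hl : PT l) : PT fun a => (l a).prod := by
  have e : ∀ l : List ℕ, l.prod.size ≤ esize l := by
    intro l
    induction l with
    | nil => simp
    | cons a l ih =>
      have := Nat.size_mul_le a l.prod
      simp [esize_nat]; omega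
  refine (foldl (g := fun _ s x => s * x) (i := fun _ => 1) hl (by fun_prop) (by fun_prop)
    (fun a => esize (l a) + 1) (by have := hl.size; fun_prop) fun a l' h => ?_).congr fun a => ?_
  · have : l'.foldl (fun s x => s * x) 1 = l'.prod := (List.prod_eq_foldl (xs := l')).symm
    rw [this, esize_nat]
    have h2 := esize_le_of_sublist h.sublist
    have := e l'
    omega
  · exact List.prod_eq_foldl

/-- The number itself has to be polynomially bounded, and not only the number of its bits. -/
theorem range {n : α → ℕ} (hn : PT n) (hb : PolyBounded n) : PT fun a => List.range (n a) := by
  let f : ℕ × List ℕ → ℕ × List ℕ := fun p => (p.1 - 1, (p.1 - 1) :: p.2)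
  have key : ∀ n, ∀ k ≤ n, f^[k] (n, []) = (n - k, List.range' (n - k) k) := by
    intro n k hk
    induction k with
    | zero => simp
    | succ k ih =>
      rw [Function.iterate_succ_apply', ih (by omega)]
      simp only [f, List.range'_succ]
      refine Prod.ext (by simp; omega) ?_
      simp only
      rw [show n - (k + 1) = n - k - 1 by omega, show n - k - 1 + 1 = n - k by omega]
  have := loop (c := fun p : ℕ × List ℕ => decide (0 < p.1)) (f := f)
    (i := fun a => (n a, [])) (by fun_prop) (by fun_prop) (by fun_prop) n hb (fun a k hk => by
      rw [key _ k hk.le]; simpa using hk) (fun a => by rw [key _ _ le_rfl]; simp)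
    (fun a => n a + 1 + (n a * (n a + 2) + 1) + 1) (by fun_prop) (fun a k hk => by
      rw [key _ k hk]
      have h1 := Nat.size_le_self (n a - k)
      have h2 : esize (List.range' (n a - k) k) ≤
          (List.range' (n a - k) k).length * (n a + 1 + 1) + 1 := esize_list_le fun x hx => by
        have := Nat.size_le_self x
        rw [List.mem_range'_1] at hx
        rw [esize_nat]; omega
      have h3 : k * (n a + 1 + 1) ≤ n a * (n a + 2) := Nat.mul_le_mul hk le_rfl
      simp only [List.length_range'] at h2
      simp only [esize_prod, esize_nat]; omega)
  exact this.snd.congr fun a => by rw [key _ _ le_rfl]; simp [List.range_eq_range']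

theorem sum_range {n : α → ℕ} {f : α → ℕ → ℕ} (hn : PT n) (hb : PolyBounded n)
    (hf : PT fun p : α × ℕ => f p.1 p.2) : PT fun a => ∑ i ∈ Finset.range (n a), f a i :=
  (map (range hn hb) hf).listSum

theorem prod_range {n : α → ℕ} {f : α → ℕ → ℕ} (hn : PT n) (hb : PolyBounded n)
    (hf : PT fun p : α × ℕ => f p.1 p.2) : PT fun a => ∏ i ∈ Finset.range (n a), f a i :=
  (map (range hn hb) hf).listProd

theorem exists_lt {n : α → ℕ} {p : α → ℕ → Prop} [∀ a, DecidablePred (p a)] (hn : PT n)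
    (hb : PolyBounded n) (hp : PT fun q : α × ℕ => decide (p q.1 q.2)) :
    PT fun a => decide (∃ i < n a, p a i) := by
  have := sum_range (f := fun a i => if p a i then 1 else 0) hn hb (by fun_prop)
  have : PT fun a => decide (0 < ∑ i ∈ Finset.range (n a), if p a i then 1 else 0) := by fun_prop
  refine this.congr fun a => ?_
  rw [decide_eq_decide, Finset.sum_pos_iff]
  simp only [Finset.mem_range]
  refine exists_congr fun i => and_congr_right fun _ => ?_
  split_ifs with h <;> simp [h]

theorem forall_lt {n : α → ℕ} {p : α → ℕ → Prop} [∀ a, DecidablePred (p a)] (hn : PT n)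
    (hb : PolyBounded n) (hp : PT fun q : α × ℕ => decide (p q.1 q.2)) :
    PT fun a => decide (∀ i < n a, p a i) := by
  have := not (exists_lt (p := fun a i => ¬ p a i) hn hb (by fun_prop))
  refine this.congr fun a => ?_
  rw [← _root_.decide_not, decide_eq_decide]
  simp

/-- The number of iterations and the size of all intermediate states have to be polynomially
bounded. -/
theorem iterate {n : α → ℕ} {f : α → σ → σ} {i : α → σ} (hn : PT n) (hb : PolyBounded n)
    (hf : PT fun p : α × σ => f p.1 p.2) (hi : PT i) (s : α → ℕ) (hs : PolyBounded s)
    (h : ∀ a, ∀ k ≤ n a, esize ((f a)^[k] (i a)) ≤ s a) : PT fun a => (f a)^[n a] (i a) := by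
  refine (foldl (g := fun a s (_ : ℕ) => f a s) (range hn hb) hi
    (comp (f := fun p : α × σ × ℕ => (p.1, p.2.1)) hf (by fun_prop)) s hs fun a l' hl => ?_).congr
    fun a => ?_
  · rw [List.foldl_const]
    refine h a _ ?_
    simpa using hl.length_le
  · rw [List.foldl_const, List.length_range]

@[fun_prop]
theorem drop [Inhabited β] {n : α → ℕ} {l : α → List β} (hn : PT n) (hl : PT l) :
    PT fun a => (l a).drop (n a) := by
  have e : ∀ (l : List β) k, (List.tail)^[k] l = l.drop k := by
    intro l k
    induction k with
    | zero => simp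
    | succ k ih => rw [Function.iterate_succ_apply', ih, List.tail_drop]
  have hL := length hl
  refine (iterate (n := fun a => min (n a) (l a).length) (f := fun _ l => l.tail) (by fun_prop)
    (hl.size.mono fun a => (min_le_right _ _).trans (length_lt_esize _).le) (by fun_prop) hl
    (fun a => esize (l a)) hl.size fun a k _ => ?_).congr fun a => ?_
  · rw [e]
    exact esize_le_of_sublist (List.drop_sublist _ _)
  · rw [e]
    rcases le_total (n a) (l a).length with h | h
    · rw [min_eq_left h]
    · rw [min_eq_right h, List.drop_length, List.drop_eq_nil_iff.2 h]

@[fun_prop]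
theorem take [Inhabited β] {n : α → ℕ} {l : α → List β} (hn : PT n) (hl : PT l) :
    PT fun a => (l a).take (n a) :=
  (reverse (drop (natSub (length hl) hn) (reverse hl))).congr fun a => by
    rw [List.drop_reverse, List.reverse_reverse]
    rcases le_total (n a) (l a).length with h | h
    · rw [show (l a).length - ((l a).length - n a) = n a by omega]
    · rw [show (l a).length - ((l a).length - n a) = (l a).length by omega, List.take_length,
        List.take_of_length_le h]

@[fun_prop]
theorem eraseIdx [Inhabited β] {n : α → ℕ} {l : α → List β} (hn : PT n) (hl : PT l) :
    PT fun a => (l a).eraseIdx (n a) :=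
  (append (take hn hl) (drop (natAdd hn (const 1)) hl)).congr fun a => by
    rw [List.eraseIdx_eq_take_drop_succ]

@[fun_prop]
theorem getD [Inhabited β] {n : α → ℕ} {l : α → List β} (hn : PT n) (hl : PT l) (d : β) :
    PT fun a => (l a).getD (n a) d :=
  (headD (drop hn hl) d).congr fun a => by
    rw [List.headD_eq_head?_getD, List.head?_drop, List.getD_eq_getElem?_getD]

theorem any [Inhabited β] {l : α → List β} {p : α → β → Bool} (hl : PT l)
    (hp : PT fun q : α × β => p q.1 q.2) : PT fun a => (l a).any (p a) := by
  have e : ∀ a (l : List β) b, l.foldl (fun s x => s || p a x) b = (b || l.any (p a)) := by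
    intro a l
    induction l with
    | nil => simp
    | cons a l ih => intro b; simp [ih, Bool.or_assoc]
  have : PT fun q : α × Bool × β => p q.1 q.2.2 :=
    comp (f := fun q : α × Bool × β => (q.1, q.2.2)) hp (by fun_prop)
  exact (foldl (g := fun a s x => s || p a x) (i := fun _ => false) hl (by fun_prop)
    (by fun_prop) (fun _ => 2) (by fun_prop) fun a l' h => esize_bool _).congr fun a => by
      rw [e]; simp

end PT
end lists

/-! ### Computing the cost of a tree -/

section reach

/-- One round of the search for the nodes that are reachable along `adj`: those found so far, given
by truth values, are joined by their neighbours. -/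
def reachStep (n : ℕ) (adj : ℕ → ℕ → Bool) (R : List Bool) : List Bool :=
  (List.range n).map fun v =>
    R.getD v false || decide (∃ u < n, R.getD u false = true ∧ adj u v = true)

/-- The list of truth values that tells which of the nodes `0, …, n - 1` are reachable from `r`. -/
def reachList (n : ℕ) (adj : ℕ → ℕ → Bool) (r : ℕ) : List Bool :=
  (reachStep n adj)^[n] ((List.range n).map fun v => decide (v = r))

theorem List.getD_map_range {α : Type*} (n : ℕ) (f : ℕ → α) {v : ℕ} (hv : v < n) (d : α) :
    ((List.range n).map f).getD v d = f v := by
  simp [List.getD_eq_getElem?_getD, hv]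

theorem reachList_getD {n : ℕ} (G : SimpleGraph (Fin n)) (adj : ℕ → ℕ → Bool)
    (h : ∀ u v : Fin n, adj u v = true ↔ G.Adj u v) (r v : Fin n) :
    (reachList n adj r).getD v false = true ↔ G.Reachable v r := by
  have key : ∀ k (v : Fin n),
      ((reachStep n adj)^[k] ((List.range n).map fun v => decide (v = (r : ℕ)))).getD v false
        = true ↔ ∃ p : G.Walk v r, p.length ≤ k := by
    intro k
    induction k with
    | zero =>
      intro v
      rw [Function.iterate_zero, id, List.getD_map_range _ _ v.2]
      simp only [decide_eq_true_eq, Nat.le_zero, Fin.val_inj]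
      constructor
      · rintro rfl
        exact ⟨.nil, rfl⟩
      · rintro ⟨p, hp⟩
        exact SimpleGraph.Walk.eq_of_length_eq_zero hp
    | succ k ih =>
      intro v
      rw [Function.iterate_succ_apply', reachStep, List.getD_map_range _ _ v.2, Bool.or_eq_true, ih,
        decide_eq_true_eq]
      constructor
      · rintro (⟨p, hp⟩ | ⟨u, hu, hr, ha⟩)
        · exact ⟨p, hp.trans (Nat.le_succ _)⟩
        · obtain ⟨p, hp⟩ := (ih ⟨u, hu⟩).1 hr
          exact ⟨.cons ((h ⟨u, hu⟩ v).1 ha).symm p, by simpa using hp⟩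
      · rintro ⟨p, hp⟩
        cases p with
        | nil => exact .inl ⟨.nil, Nat.zero_le _⟩
        | cons hadj p =>
          rename_i u
          refine .inr ⟨u, u.2, (ih u).2 ⟨p, by simpa using hp⟩, (h u v).2 hadj.symm⟩
  rw [reachList, key]
  constructor
  · rintro ⟨p, _⟩
    exact ⟨p⟩
  · rintro ⟨p⟩
    classical
    refine ⟨p.toPath.1, ?_⟩
    have := p.toPath.2.length_lt
    simp at this
    omega

end reach

/-- Whether the pair `(u, v)` is listed in `w`. -/
def listed (w : Val) (u v : ℕ) : Bool :=
  w.toList.any fun x => x.isPair && !x.fst.isPair && !x.snd.isPair &&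
    decide (x.fst.toInt = u) && decide (x.snd.toInt = v)

theorem listed_iff (w : Val) (u v : ℕ) :
    listed w u v = true ↔ Val.pair (.int u) (.int v) ∈ w.toList := by
  rw [listed, List.any_eq_true]
  constructor
  · rintro ⟨x, hx, h⟩
    rcases x with z | ⟨_ | _, _ | _⟩ <;> simp [Val.isPair, Val.fst, Val.snd, Val.toInt] at h
    obtain rfl := of_decide_eq_true h.1
    obtain rfl := of_decide_eq_true h.2
    exact hx
  · intro h
    exact ⟨_, h, by simp [Val.isPair, Val.fst, Val.snd, Val.toInt]⟩

/-- Adjacency in the graph described by `w`. -/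
def adjB (w : Val) (u v : ℕ) : Bool := decide (u ≠ v) && (listed w u v || listed w v u)

/-- Adjacency in the graph described by `w` with the edge between `x` and `y` removed. -/
def adjDel (w : Val) (x y u v : ℕ) : Bool :=
  adjB w u v && !decide ((u = x ∧ v = y) ∨ (u = y ∧ v = x))

namespace BaB

theorem adjB_iff (I : BaB) (w : Val) (u v : Fin I.n) :
    adjB w u v = true ↔ (I.readTree w).Adj u v := by
  simp only [adjB, readTree, SimpleGraph.fromEdgeSet_adj, Bool.and_eq_true, Bool.or_eq_true,
    listed_iff, decide_eq_true_eq, Set.mem_ofPred_eq, ne_eq, Fin.val_inj]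
  rw [and_comm]
  refine and_congr_left fun _ => ?_
  constructor
  · rintro (h | h)
    · exact ⟨u, v, rfl, h⟩
    · exact ⟨v, u, Sym2.eq_swap, h⟩
  · rintro ⟨a, b, e, h⟩
    rcases Sym2.eq_iff.1 e with ⟨rfl, rfl⟩ | ⟨rfl, rfl⟩
    · exact .inl h
    · exact .inr h

theorem adjDel_iff (I : BaB) (w : Val) (x y u v : Fin I.n) :
    adjDel w x y u v = true ↔ ((I.readTree w).deleteEdges {s(x, y)}).Adj u v := by
  simp only [adjDel, Bool.and_eq_true, adjB_iff, SimpleGraph.deleteEdges_adj, Bool.not_eq_true',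
    decide_eq_false_iff_not, Set.mem_singleton_iff, Sym2.eq_iff, Fin.val_inj]

/-- The matrix of edge lengths, as it is written in the encoding. -/
def mat (I : BaB) : List (List Val) :=
  open Classical in
  List.ofFn fun u => List.ofFn fun v =>
    if I.graph.Adj u v then .ofRat (I.len s(u, v)) else .int 0

/-- The entry of the matrix of edge lengths for the nodes `u` and `v`. -/
def entry (I : BaB) (u v : ℕ) : Val := (I.mat.getD u []).getD v (.int 0)

/-- The list of demands. -/
def demands (I : BaB) : List ℕ := List.ofFn I.demand

/-- The denominator of an edge length; it is `1` for a non-edge, so that `commonDen` is positive. -/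
def den (I : BaB) (u v : ℕ) : ℕ := max 1 (I.entry u v).snd.toInt.toNat

/-- A common denominator of all edge lengths. -/
def commonDen (I : BaB) : ℕ := ∏ u ∈ Finset.range I.n, ∏ v ∈ Finset.range I.n, I.den u v

/-- The length of an edge in multiples of `1 / I.commonDen`. -/
def lenN (I : BaB) (u v : ℕ) : ℕ := (I.entry u v).fst.toInt.toNat * (I.commonDen / I.den u v)

/-- The nodes that remain joined to the root if the edge between `x` and `y` is removed. -/
def joined (I : BaB) (w : Val) (x y : ℕ) : List Bool := reachList I.n (adjDel w x y) (I.root : ℕ)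

/-- The flow over the edge between `x` and `y`: the demand that is cut off from the root if this
edge is removed. -/
def flowN (I : BaB) (w : Val) (x y : ℕ) : ℕ :=
  ∑ z ∈ Finset.range I.n,
    if (I.joined w x y).getD z false = true then 0 else I.demands.getD z 0

/-- The rent-or-buy cost with threshold `M` of the tree `w`, in multiples of `1 / I.commonDen`. -/
def costN (I : BaB) (w : Val) (M : ℕ) : ℕ :=
  ∑ u ∈ Finset.range I.n, ∑ v ∈ Finset.range I.n,
    if v < u ∧ adjB w u v = true then I.lenN u v * min (I.flowN w u v) M else 0

theorem demands_getD (I : BaB) (z : Fin I.n) : I.demands.getD z 0 = I.demand z := by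
  simp [demands, List.getD_eq_getElem?_getD]

theorem entry_of_adj (I : BaB) {u v : Fin I.n} (h : I.graph.Adj u v) :
    I.entry u v = .ofRat (I.len s(u, v)) := by
  simp [entry, mat, List.getD_eq_getElem?_getD, h]

theorem den_pos (I : BaB) (u v : ℕ) : 0 < I.den u v := by simp [den]

theorem commonDen_pos (I : BaB) : 0 < I.commonDen :=
  Finset.prod_pos fun _ _ => Finset.prod_pos fun _ _ => I.den_pos _ _

theorem lenN_eq (I : BaB) {u v : Fin I.n} (h : I.graph.Adj u v) :
    (I.lenN u v : ℝ) = I.commonDen * I.len s(u, v) := by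
  have hd : I.den u v ∣ I.commonDen :=
    (Finset.dvd_prod_of_mem (fun v : ℕ => I.den u v) (Finset.mem_range.2 v.2)).trans
      (Finset.dvd_prod_of_mem (fun u : ℕ => ∏ v ∈ Finset.range I.n, I.den u v)
        (Finset.mem_range.2 u.2))
  have h1 : I.den u v = (I.len s(u, v)).den := by
    have := (I.len s(u, v)).den_pos
    simp [den, I.entry_of_adj h, Val.ofRat, Val.snd, Val.toInt]
    omega
  rw [lenN, Nat.cast_mul, Nat.cast_div hd (by exact_mod_cast (I.den_pos _ _).ne'), h1,
    I.entry_of_adj h]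
  simp only [Val.ofRat, Val.fst, Val.toInt, Int.toNat_natCast]
  have h2 : ((I.len s(u, v) : ℚ≥0) : ℝ) = (I.len s(u, v)).num / (I.len s(u, v)).den :=
    NNRat.cast_def _
  rw [h2]
  ring

/-- An edge of a tree lies on the path from `z` to the root if and only if its removal separates
`z` from the root. -/
theorem flowN_eq (I : BaB) {w : Val} (hw : I.IsTree (I.readTree w)) (x y : Fin I.n) :
    I.flowN w x y = I.flow (I.readTree w) s(x, y) := by
  classical
  rw [flowN, flow, Finset.sum_range, Finset.sum_filter]
  refine Finset.sum_congr rfl fun z _ => ?_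
  rw [demands_getD]
  have h1 := reachList_getD _ _ (I.adjDel_iff w x y) I.root z
  rw [← joined] at h1
  simp only [h1]
  by_cases hz : I.demand z = 0
  · simp [hz]
  obtain ⟨p⟩ := hw.spans z (Nat.pos_of_ne_zero hz)
  have hp := p.toPath.2
  set q := p.toPath.1
  by_cases hr : ((I.readTree w).deleteEdges {s(x, y)}).Reachable z I.root
  · rw [if_pos hr, if_neg]
    rintro ⟨p', hp', he⟩
    obtain ⟨s⟩ := hr
    have hle := SimpleGraph.deleteEdges_le (G := I.readTree w) {s(x, y)}
    have hs : (s.toPath.1.mapLe hle).IsPath := (SimpleGraph.Walk.isPath_mapLe hle).2 s.toPath.2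
    have := (hw.acyclic.subsingleton_path _ _).elim ⟨p', hp'⟩ ⟨_, hs⟩
    have h2 : p' = s.toPath.1.mapLe hle := congrArg Subtype.val this
    rw [h2, SimpleGraph.Walk.edges_mapLe_eq_edges] at he
    have := s.toPath.1.edges_subset_edgeSet he
    rw [SimpleGraph.edgeSet_deleteEdges] at this
    exact this.2 rfl
  · rw [if_neg hr, if_pos]
    refine ⟨q, hp, ?_⟩
    by_contra he
    exact hr ⟨q.toDeleteEdges {s(x, y)} fun e he' hmem => he (by
      rw [Set.mem_singleton_iff] at hmem; rwa [← hmem])⟩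

/-- A sum over the edges of a graph on `0, …, n - 1` as a sum over ordered pairs. -/
theorem sum_edges_eq {n : ℕ} (T : SimpleGraph (Fin n)) (F : Sym2 (Fin n) → ℝ)
    [DecidablePred (· ∈ T.edgeSet)] [DecidableRel T.Adj] :
    ∑ e with e ∈ T.edgeSet, F e =
      ∑ u : Fin n, ∑ v : Fin n, if v < u ∧ T.Adj u v then F s(u, v) else 0 := by
  rw [← Finset.sum_product', ← Finset.sum_filter]
  symm
  refine Finset.sum_bij (fun p _ => s(p.1, p.2)) ?_ ?_ ?_ ?_
  · rintro ⟨u, v⟩ h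
    simpa using (Finset.mem_filter.1 h).2.2
  · rintro ⟨u, v⟩ h ⟨u', v'⟩ h' e
    have h1 := (Finset.mem_filter.1 h).2.1
    have h2 := (Finset.mem_filter.1 h').2.1
    rcases Sym2.eq_iff.1 e with ⟨rfl, rfl⟩ | ⟨rfl, rfl⟩
    · rfl
    · exact absurd h1 h2.not_gt
  · intro e he
    induction e with | _ u v
    have hadj : T.Adj u v := by simpa using he
    rcases lt_or_gt_of_ne hadj.ne with h | h
    · exact ⟨(v, u), by simp [h, hadj.symm], Sym2.eq_swap⟩
    · exact ⟨(u, v), by simp [h, hadj], rfl⟩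
  · intros; rfl

/-- The computed cost of a tree is its true cost up to the common denominator. -/
theorem costN_eq (I : BaB) {w : Val} (hw : I.IsTree (I.readTree w)) (M : ℕ) :
    (I.costN w M : ℝ) = I.commonDen * I.cost (rentOrBuy M) (I.readTree w) := by
  classical
  rw [costN, cost, sum_edges_eq, Finset.mul_sum, Finset.sum_range, Nat.cast_sum]
  refine Finset.sum_congr rfl fun u _ => ?_
  rw [Finset.sum_range, Nat.cast_sum, Finset.mul_sum]
  refine Finset.sum_congr rfl fun v _ => ?_
  rw [I.flowN_eq hw]
  simp only [Fin.val_fin_lt, adjB_iff]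
  split_ifs with h
  · rw [Nat.cast_mul, I.lenN_eq (hw.le h.2)]
    simp [rentOrBuy, mul_assoc]
  · simp

end BaB

namespace PT
variable {α β : Type} [Code α] [Code β]

theorem size_toList_le (v : Val) : esize v.toList ≤ v.size := by
  induction v with
  | int z => simp [Val.toList, Val.size]
  | pair a b _ ih => simp [Val.toList, Val.size, esize_val] at ih ⊢; omega

@[fun_prop]
theorem toList {f : α → Val} (hf : PT f) : PT fun a => (f a).toList := by
  suffices h : PT fun v : Val => v.toList from comp h hf
  let g : Val × List Val → Val × List Val := fun p => (p.1.snd, p.1.fst :: p.2)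
  have key : ∀ (v : Val) (k : ℕ) (l : List Val), k ≤ v.toList.length →
      (g^[k] (v, l)).1.toList = v.toList.drop k ∧
      (g^[k] (v, l)).2 = (v.toList.take k).reverse ++ l ∧
      ((g^[k] (v, l)).1.isPair = true ↔ k < v.toList.length) ∧
      (g^[k] (v, l)).1.size ≤ v.size := by
    intro v
    induction v with
    | int z => intro k l hk; simp [Val.toList] at hk; simp [hk, Val.toList, Val.isPair]
    | pair a b _ ih =>
      intro k l hk
      cases k with
      | zero => simp [Val.toList, Val.isPair]
      | succ k =>
        obtain ⟨h1, h2, h3, h4⟩ := ih k (a :: l) (by simpa [Val.toList] using hk)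
        rw [Function.iterate_succ_apply]
        change (g^[k] (b, a :: l)).1.toList = _ ∧ (g^[k] (b, a :: l)).2 = _ ∧
          ((g^[k] (b, a :: l)).1.isPair = true ↔ _) ∧ (g^[k] (b, a :: l)).1.size ≤ _
        refine ⟨by simpa [Val.toList] using h1, by simpa [Val.toList] using h2,
          h3.trans (by simp [Val.toList]), h4.trans ?_⟩
        simp [Val.size]; omega
  have := loop (c := fun p : Val × List Val => p.1.isPair) (f := g) (i := fun v => (v, []))
    (by fun_prop) (by fun_prop) (by fun_prop) (fun v => v.toList.length)
    (PolyBounded.size_self.mono fun v =>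
      (length_lt_esize _).le.trans (size_toList_le v))
    (fun v k hk => ((key v k [] hk.le).2.2.1).2 hk)
    (fun v => by
      have := (key v _ [] le_rfl).2.2.1
      simpa using this) (fun v => 2 * esize v + 1) (by fun_prop) (fun v k hk => by
      obtain ⟨h1, h2, h3, h4⟩ := key v k [] hk
      rw [esize_prod, h2, List.append_nil, esize_reverse]
      have h5 := esize_le_of_sublist (List.take_sublist k v.toList)
      have h6 := size_toList_le v
      rw [esize_val, esize_val]
      omega)
  refine this.snd.reverse.congr fun v => ?_
  rw [(key v _ [] le_rfl).2.1]
  simp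

@[fun_prop]
theorem listed {w : α → Val} {u v : α → ℕ} (hw : PT w) (hu : PT u) (hv : PT v) :
    PT fun a => listed (w a) (u a) (v a) := by
  unfold _root_.listed
  refine any (p := fun a (x : Val) => x.isPair && !x.fst.isPair && !x.snd.isPair &&
    decide (x.fst.toInt = u a) && decide (x.snd.toInt = v a)) (by fun_prop) ?_
  exact (((isPair (by fun_prop)).and (not (isPair (by fun_prop)))).and
    (not (isPair (by fun_prop)))).and (intEq (by fun_prop) (by fun_prop)) |>.and
    (intEq (by fun_prop) (by fun_prop))

@[fun_prop]
theorem adjB {w : α → Val} {u v : α → ℕ} (hw : PT w) (hu : PT u) (hv : PT v) :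
    PT fun a => adjB (w a) (u a) (v a) := by
  unfold _root_.adjB
  exact (decide_not (natEq hu hv)).and ((listed hw hu hv).or (listed hw hv hu))

@[fun_prop]
theorem adjDel {w : α → Val} {x y u v : α → ℕ} (hw : PT w) (hx : PT x) (hy : PT y)
    (hu : PT u) (hv : PT v) : PT fun a => adjDel (w a) (x a) (y a) (u a) (v a) := by
  unfold _root_.adjDel
  exact (adjB hw hu hv).and (not (decide_or (decide_and (natEq hu hx) (natEq hv hy))
    (decide_and (natEq hu hy) (natEq hv hx))))

end PT

namespace BaB

theorem pt_n : PT fun I : BaB => I.n :=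
  PT.of_enc ((PT.valFst (PT.enc PT.id')).congr fun _ => rfl)

theorem pt_mat : PT fun I : BaB => I.mat :=
  PT.of_enc ((PT.valFst (PT.valSnd (PT.enc PT.id'))).congr fun I => by
    simp [mat, enc, encode, Val.fst, Val.snd, List.map_ofFn, Function.comp_def])

theorem pt_demands : PT fun I : BaB => I.demands :=
  PT.of_enc ((PT.valFst (PT.valSnd (PT.valSnd (PT.enc PT.id')))).congr fun I => by
    simp [demands, enc, encode, Val.fst, Val.snd, List.map_ofFn, Function.comp_def])

theorem pt_root : PT fun I : BaB => (I.root : ℕ) :=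
  PT.of_enc ((PT.valSnd (PT.valSnd (PT.valSnd (PT.enc PT.id')))).congr fun _ => rfl)

theorem polyBounded_n : PolyBounded fun I : BaB => I.n :=
  pt_mat.size.mono fun I => by
    have := length_lt_esize I.mat
    simp [mat] at this ⊢
    omega

end BaB

attribute [fun_prop] BaB.pt_n BaB.pt_mat BaB.pt_demands BaB.pt_root

section
variable {α : Type} [Code α]

theorem PolyBounded.n {f : α → BaB} (hf : PT f) : PolyBounded fun a => (f a).n :=
  BaB.polyBounded_n.comp hf.size

namespace PT

theorem n {f : α → BaB} (hf : PT f) : PT fun a => (f a).n := comp BaB.pt_n hf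

@[fun_prop]
theorem entry {f : α → BaB} {u v : α → ℕ} (hf : PT f) (hu : PT u) (hv : PT v) :
    PT fun a => (f a).entry (u a) (v a) := by
  have := comp BaB.pt_mat hf
  unfold BaB.entry
  fun_prop

@[fun_prop]
theorem den {f : α → BaB} {u v : α → ℕ} (hf : PT f) (hu : PT u) (hv : PT v) :
    PT fun a => (f a).den (u a) (v a) := by
  unfold BaB.den
  fun_prop

@[fun_prop]
theorem commonDen {f : α → BaB} (hf : PT f) : PT fun a => (f a).commonDen := by
  unfold BaB.commonDen
  have hn : PT fun p : α × ℕ => (f p.1).n := PT.n (by fun_prop)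
  have h1 : PT fun p : α × ℕ => ∏ v ∈ Finset.range (f p.1).n, (f p.1).den p.2 v :=
    prod_range (f := fun (p : α × ℕ) v => (f p.1).den p.2 v) hn (.n (by fun_prop))
      (den (by fun_prop) (by fun_prop) (by fun_prop))
  exact prod_range (f := fun a u => ∏ v ∈ Finset.range (f a).n, (f a).den u v) hf.n (.n hf) h1

@[fun_prop]
theorem lenN {f : α → BaB} {u v : α → ℕ} (hf : PT f) (hu : PT u) (hv : PT v) :
    PT fun a => (f a).lenN (u a) (v a) := by
  unfold BaB.lenN
  fun_prop

@[fun_prop]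
theorem joined {f : α → BaB} {w : α → Val} {x y : α → ℕ} (hf : PT f) (hw : PT w) (hx : PT x)
    (hy : PT y) : PT fun a => (f a).joined (w a) (x a) (y a) := by
  unfold BaB.joined reachList
  have hr : PT fun a => ((f a).root : ℕ) := comp BaB.pt_root hf
  have hn := hf.n
  have hn' := PolyBounded.n hf
  have hlen : ∀ (n : ℕ) (g : ℕ → Bool), esize ((List.range n).map g) ≤ n * 3 + 1 := by
    intro n g
    have := esize_list_le (l := (List.range n).map g) (b := 2) fun x _ => esize_bool x
    simpa using this
  refine iterate (f := fun a => reachStep (f a).n (_root_.adjDel (w a) (x a) (y a)))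
    hn hn' ?_ (map (g := fun a v => decide (v = ((f a).root : ℕ))) (range hn hn') ?_)
    (fun a => (f a).n * 3 + 1) (by fun_prop) ?_
  · unfold reachStep
    have hn2 : PT fun p : α × List Bool => (f p.1).n := PT.n (by fun_prop)
    have hn2' : PolyBounded fun p : α × List Bool => (f p.1).n := .n (by fun_prop)
    have hn3 : PT fun p : (α × List Bool) × ℕ => (f p.1.1).n := PT.n (by fun_prop)
    have hn3' : PolyBounded fun p : (α × List Bool) × ℕ => (f p.1.1).n := .n (by fun_prop)
    refine map (g := fun (p : α × List Bool) v => p.2.getD v false || decide (∃ u < (f p.1).n,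
      p.2.getD u false = true ∧ _root_.adjDel (w p.1) (x p.1) (y p.1) u v = true))
      (range hn2 hn2') ?_
    have := exists_lt (p := fun (p : (α × List Bool) × ℕ) u =>
      p.1.2.getD u false = true ∧ _root_.adjDel (w p.1.1) (x p.1.1) (y p.1.1) u p.2 = true)
      hn3 hn3' (decide_and (decide_bool (by fun_prop)) (decide_bool (adjDel (by fun_prop)
        (by fun_prop) (by fun_prop) (by fun_prop) (by fun_prop))))
    exact or (by fun_prop) this
  · exact natEq (by fun_prop) (comp hr (by fun_prop))
  · intro a k _
    cases k with
    | zero => exact hlen _ _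
    | succ k => rw [Function.iterate_succ_apply']; exact hlen _ _

@[fun_prop]
theorem flowN {f : α → BaB} {w : α → Val} {x y : α → ℕ} (hf : PT f) (hw : PT w) (hx : PT x)
    (hy : PT y) : PT fun a => (f a).flowN (w a) (x a) (y a) := by
  unfold BaB.flowN
  have hd : PT fun p : α × ℕ => (f p.1).demands := comp BaB.pt_demands (by fun_prop)
  exact sum_range (f := fun a z => if ((f a).joined (w a) (x a) (y a)).getD z false = true then 0
    else (f a).demands.getD z 0) hf.n (.n hf) (ite (decide_bool (getD (by fun_prop)
    (joined (by fun_prop) (by fun_prop) (by fun_prop) (by fun_prop)) _)) (by fun_prop)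
    (by fun_prop))

@[fun_prop]
theorem costN {f : α → BaB} {w : α → Val} {M : α → ℕ} (hf : PT f) (hw : PT w) (hM : PT M) :
    PT fun a => (f a).costN (w a) (M a) := by
  unfold BaB.costN
  refine sum_range (f := fun a u => ∑ v ∈ Finset.range (f a).n,
    if v < u ∧ _root_.adjB (w a) u v = true then
      (f a).lenN u v * min ((f a).flowN (w a) u v) (M a) else 0) hf.n (.n hf)
    (sum_range (f := fun (p : α × ℕ) v =>
    if v < p.2 ∧ _root_.adjB (w p.1) p.2 v = true then
      (f p.1).lenN p.2 v * min ((f p.1).flowN (w p.1) p.2 v) (M p.1) else 0) ?_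
      (.n (by fun_prop)) ?_)
  · exact PT.n (by fun_prop)
  · exact ite (decide_and (natLt (by fun_prop) (by fun_prop)) (decide_bool (adjB (by fun_prop)
      (by fun_prop) (by fun_prop)))) (natMul (lenN (by fun_prop) (by fun_prop) (by fun_prop))
      (natMin (flowN (by fun_prop) (by fun_prop) (by fun_prop) (by fun_prop)) (by fun_prop)))
      (by fun_prop)

end PT
end

/-! ### The deterministic parts of the algorithm -/

section defs

/-- The number of atomic cost functions. -/
def BaB.numAtomic (I : BaB) : ℕ := 1 + I.logD

/-- The threshold of the `i`-th atomic cost function, for `i ≤ I.logD`.  The minimum only keeps the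
threshold polynomially long for an arbitrary number `i`. -/
def BaB.threshold (I : BaB) (i : ℕ) : ℕ := 2 ^ min i I.logD

/-- The context in which trees are sampled: an instance, and a list of trees, one for each atomic
cost function, that were returned by the rent-or-buy algorithm. -/
abbrev Context : Type := BaB × List Val

namespace Context

/-- The estimate of the optimal cost under the `i`-th atomic cost function, in multiples of
`1 / c.1.commonDen`: the cost of the `i`-th tree of the context. -/
def estimate (c : Context) (i : ℕ) : ℕ := c.1.costN (c.2.getD i (.int 0)) (c.1.threshold i)

/-- The product of all estimates, in multiples of which normalized costs are written. -/
def unit (c : Context) : ℕ := ∏ i ∈ Finset.range c.1.numAtomic, c.estimate i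

/-- The `i`-th atomic cost of the tree `w` divided by the estimate, in multiples of `1 / c.unit`. -/
def vec (c : Context) (w : Val) (i : ℕ) : ℕ :=
  c.1.costN w (c.1.threshold i) * (c.unit / c.estimate i)

end Context

/-- The total of the multiplicities in a list of trees with multiplicities. -/
def mass (l : List (Val × ℕ)) : ℕ := (l.map fun e => e.2).sum

namespace Context

/-- The sum of the normalized costs of a list of trees with multiplicities. -/
def total (c : Context) (l : List (Val × ℕ)) (i : ℕ) : ℕ :=
  (l.map fun e => e.2 * c.vec e.1 i).sum

/-- The amount by which the `i`-th normalized cost exceeds the level `x / y` on a list of trees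
with multiplicities; it is `0` if there is no excess, since the subtraction is truncated. -/
def excess (c : Context) (x y : ℕ) (l : List (Val × ℕ)) (i : ℕ) : ℕ :=
  y * c.total l i - x * c.unit * mass l

/-- The weights with which trees are sampled: the excess over the level `21 k / 400`, with a uniform
share added.  The uniform share bounds the costs of accepted trees; its factor `1 / 20` relative to
the excess is the reason for the step from the threshold `20 k / 400` of `accepts` to this level. -/
def weight (c : Context) (k : ℕ) (l : List (Val × ℕ)) (i : ℕ) : ℕ :=
  20 * c.1.numAtomic * c.excess (21 * k) 400 l i +
    ∑ j ∈ Finset.range c.1.numAtomic, c.excess (21 * k) 400 l j + 1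

/-- Whether the weighted cost of the tree `w` is at most `k / 20` times the weighted estimate. -/
def accepts (c : Context) (k : ℕ) (l : List (Val × ℕ)) (w : Val) : Bool :=
  decide (20 * ∑ i ∈ Finset.range c.1.numAtomic, c.weight k l i * c.vec w i ≤
    k * c.unit * ∑ i ∈ Finset.range c.1.numAtomic, c.weight k l i)

/-- Whether the tree `w` costs at most `x / y`, weighted with the excess over the level `x / y`. -/
def good (c : Context) (x y : ℕ) (l : List (Val × ℕ)) (w : Val) : Bool :=
  decide (y * ∑ i ∈ Finset.range c.1.numAtomic, c.excess x y l i * c.vec w i ≤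
    x * c.unit * ∑ i ∈ Finset.range c.1.numAtomic, c.excess x y l i)

end Context

/-- Increase the multiplicity of the first tree with property `p`. -/
def bumpWith (p : Val → Bool) : List (Val × ℕ) → List (Val × ℕ)
  | [] => []
  | e :: l => if p e.1 then (e.1, e.2 + 1) :: l else e :: bumpWith p l

/-- Set all multiplicities to `0`. -/
def resetMult (l : List (Val × ℕ)) : List (Val × ℕ) := l.map fun e => (e.1, 0)

namespace Context

/-- Multiplicities for a given list of trees, chosen greedily in order to stay below the level
`x / y`. -/
def greedy (c : Context) (x y K : ℕ) (l : List (Val × ℕ)) : List (Val × ℕ) :=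
  (fun l => bumpWith (c.good x y l) l)^[K] (resetMult l)

/-- Whether the average normalized costs of a list of trees are at most `x / y`. -/
def below (c : Context) (x y : ℕ) (l : List (Val × ℕ)) : Bool :=
  decide (0 < mass l ∧ ∀ i < c.1.numAtomic, y * c.total l i ≤ x * c.unit * mass l)

/-- Remove one tree from the list if this is possible while the level increases from `x / y` to
`x' / y`. -/
def tryRemove (c : Context) (x x' y K : ℕ) (l : List (Val × ℕ)) : List (Val × ℕ) :=
  (List.range l.length).foldl (fun acc j =>
    if acc.length < l.length then acc
    else if c.below x' y (c.greedy x y K (l.eraseIdx j)) = true then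
      c.greedy x y K (l.eraseIdx j) else acc) l

end Context

namespace BaB

/-- The number of trees to be sampled.  The potential of `m = I.numAtomic` excesses grows by at most
`m * (421 m k) ^ 2` per tree, in multiples of the square of the unit, and after `N` trees an average
excess of `k / 400` is allowed, that is, a potential of `(N k) ^ 2`. -/
def samples (I : BaB) : ℕ := 421 ^ 2 * I.numAtomic ^ 3

/-- The number of rounds of the greedy choice of multiplicities: the number of constraints times the
square of the ratio between the largest possible normalized cost and the increase of the level. -/
def rounds (I : BaB) : ℕ := I.numAtomic * (210 * (I.samples + 1) * I.numAtomic) ^ 2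

/-- The denominator of the levels in the reduction of the support. -/
def levelDen (I : BaB) : ℕ := 400 * (I.samples + 1)

/-- The numerator of the level after the removal of `j` trees: the level increases in equal steps
from `22 k / 400`, and it remains below `24 k / 400` for `j ≤ I.samples`. -/
def levelNum (I : BaB) (k j : ℕ) : ℕ := (22 * (I.samples + 1) + 2 * j) * k

end BaB

namespace Context

/-- Remove one tree if there are more trees than atomic cost functions. -/
def reduceStep (c : Context) (k : ℕ) (l : List (Val × ℕ)) : List (Val × ℕ) :=
  if l.length ≤ c.1.numAtomic then l
  else c.tryRemove (c.1.levelNum k (c.1.samples - l.length))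
    (c.1.levelNum k (c.1.samples - l.length + 1)) c.1.levelDen c.1.rounds l

/-- An index at which the estimate vanishes, if there is one. -/
def zeroIndex (c : Context) : ℕ :=
  (List.range c.1.numAtomic).foldl (fun s i => if c.estimate i = 0 then i else s) 0

/-- The trees of the final distribution with their multiplicities. If an estimate vanishes, then the
tree that it belongs to costs nothing, and it suffices on its own. -/
def support (c : Context) (k : ℕ) (l : List (Val × ℕ)) : List (Val × ℕ) :=
  if c.unit = 0 then [(c.2.getD c.zeroIndex (.int 0), 1)]
  else (c.reduceStep k)^[c.1.samples] l

/-- The final distribution as a list of trees and fractions. -/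
def result (c : Context) (k : ℕ) (l : List (Val × ℕ)) : List (Val × ℕ × ℕ) :=
  (c.support k l).map fun e => (e.1, e.2, mass (c.support k l))

end Context

end defs

section pt
variable {α : Type} [Code α]

theorem BaB.polyBounded_logD : PolyBounded fun I : BaB => I.logD := by
  have e : ∀ l : List ℕ, l.sum.size ≤ esize l := by
    intro l
    induction l with
    | nil => simp
    | cons a l ih =>
      have := Nat.size_add_le a l.sum
      simp [esize_nat]; omega
  refine BaB.pt_demands.size.mono fun I => ?_
  refine le_trans ?_ (e I.demands)
  refine Nat.clog_le_of_le_pow ?_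
  have : I.demands.sum = ∑ v, I.demand v := by simp [demands, List.sum_ofFn]
  rw [← this]
  exact (Nat.lt_size_self _).le

theorem PolyBounded.logD {f : α → BaB} (hf : PT f) : PolyBounded fun a => (f a).logD :=
  BaB.polyBounded_logD.comp hf.size

namespace PT

theorem clog {f : α → ℕ} (hf : PT f) (hb : PolyBounded fun a => Nat.clog 2 (f a)) :
    PT fun a => Nat.clog 2 (f a) := by
  let g : ℕ × ℕ × ℕ → ℕ × ℕ × ℕ := fun p => (p.1, 2 * p.2.1, p.2.2 + 1)
  have key : ∀ n k, g^[k] (n, 1, 0) = (n, 2 ^ k, k) := by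
    intro n k
    induction k with
    | zero => rfl
    | succ k ih => rw [Function.iterate_succ_apply', ih]; simp [g, pow_succ, mul_comm]
  have := loop (c := fun p : ℕ × ℕ × ℕ => decide (p.2.1 < p.1)) (f := g)
    (i := fun a => (f a, 1, 0)) (natLt (by fun_prop) (by fun_prop)) (by fun_prop) (by fun_prop)
    (fun a => Nat.clog 2 (f a)) hb (fun a k hk => by
      rw [key]; simpa using (Nat.lt_clog_iff_pow_lt (by norm_num)).1 hk)
    (fun a => by rw [key]; simpa using Nat.le_pow_clog (by norm_num) _)
    (fun a => esize (f a) + 2 * Nat.clog 2 (f a) + 5) (by have := hf.size; fun_prop)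
    (fun a k hk => by
      rw [key]
      have := Nat.size_le_self k
      simp only [esize_prod, esize_nat, Nat.size_pow]
      omega)
  exact this.snd.snd.congr fun a => by rw [key]

theorem two_pow {n : α → ℕ} (hn : PT n) (hb : PolyBounded n) : PT fun a => 2 ^ n a := by
  have key : ∀ k, (fun x => 2 * x)^[k] 1 = 2 ^ k := by
    intro k
    induction k with
    | zero => rfl
    | succ k ih => rw [Function.iterate_succ_apply', ih, pow_succ, mul_comm]
  exact (iterate (f := fun _ x => 2 * x) (i := fun _ => 1) hn hb (by fun_prop) (by fun_prop)
    (fun a => n a + 2) (by fun_prop) fun a k hk => by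
      rw [key, esize_nat, Nat.size_pow]; omega).congr fun a => by rw [key]

theorem logD {f : α → BaB} (hf : PT f) : PT fun a => (f a).logD := by
  suffices h : PT fun I : BaB => I.logD from comp h hf
  have : PT fun I : BaB => I.demands.sum := by fun_prop
  have e : ∀ I : BaB, I.logD = Nat.clog 2 I.demands.sum := fun I => by
    simp [BaB.demands, BaB.logD, List.sum_ofFn]
  refine (clog this ?_).congr e
  simp only [← e]
  exact BaB.polyBounded_logD

theorem numAtomic {f : α → BaB} (hf : PT f) : PT fun a => (f a).numAtomic := by
  have := hf.logD
  unfold BaB.numAtomic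
  fun_prop

theorem _root_.PolyBounded.numAtomic {f : α → BaB} (hf : PT f) :
    PolyBounded fun a => (f a).numAtomic := by
  have := PolyBounded.logD hf
  unfold BaB.numAtomic
  fun_prop

theorem _root_.PolyBounded.samples {f : α → BaB} (hf : PT f) :
    PolyBounded fun a => (f a).samples := by
  have := PolyBounded.numAtomic hf
  unfold BaB.samples
  fun_prop

theorem _root_.PolyBounded.rounds {f : α → BaB} (hf : PT f) :
    PolyBounded fun a => (f a).rounds := by
  have := PolyBounded.numAtomic hf
  have := PolyBounded.samples hf
  unfold BaB.rounds
  fun_prop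

theorem samples {f : α → BaB} (hf : PT f) : PT fun a => (f a).samples := by
  have := hf.numAtomic
  unfold BaB.samples
  fun_prop

theorem rounds {f : α → BaB} (hf : PT f) : PT fun a => (f a).rounds := by
  have := hf.numAtomic
  have := hf.samples
  unfold BaB.rounds
  fun_prop

theorem levelDen {f : α → BaB} (hf : PT f) : PT fun a => (f a).levelDen := by
  have := hf.samples
  unfold BaB.levelDen
  fun_prop

theorem levelNum {f : α → BaB} {k j : α → ℕ} (hf : PT f) (hk : PT k) (hj : PT j) :
    PT fun a => (f a).levelNum (k a) (j a) := by
  have := hf.samples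
  unfold BaB.levelNum
  fun_prop

@[fun_prop]
theorem threshold {f : α → BaB} {i : α → ℕ} (hf : PT f) (hi : PT i) :
    PT fun a => (f a).threshold (i a) := by
  unfold BaB.threshold
  exact two_pow (hi.natMin hf.logD) ((PolyBounded.logD hf).mono fun a => min_le_right _ _)

/-- Sums over the atomic cost functions. -/
theorem sum_atomic {f : α → BaB} {g : α → ℕ → ℕ} (hf : PT f)
    (hg : PT fun p : α × ℕ => g p.1 p.2) :
    PT fun a => ∑ i ∈ Finset.range (f a).numAtomic, g a i :=
  sum_range hf.numAtomic (.numAtomic hf) hg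

@[fun_prop]
theorem estimate {c : α → Context} {i : α → ℕ} (hc : PT c) (hi : PT i) :
    PT fun a => (c a).estimate (i a) := by
  unfold Context.estimate
  exact costN (by fun_prop) (by fun_prop) (by fun_prop)

@[fun_prop]
theorem unit {c : α → Context} (hc : PT c) : PT fun a => (c a).unit := by
  unfold Context.unit
  exact prod_range (f := fun a i => (c a).estimate i) hc.fst.numAtomic (.numAtomic hc.fst)
    (estimate (by fun_prop) (by fun_prop))

@[fun_prop]
theorem vec {c : α → Context} {w : α → Val} {i : α → ℕ} (hc : PT c) (hw : PT w) (hi : PT i) :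
    PT fun a => (c a).vec (w a) (i a) := by
  unfold Context.vec
  exact natMul (costN (by fun_prop) (by fun_prop) (by fun_prop)) (by fun_prop)

@[fun_prop]
theorem mass {l : α → List (Val × ℕ)} (hl : PT l) : PT fun a => mass (l a) := by
  unfold _root_.mass
  exact listSum (map (g := fun _ e => e.2) hl (by fun_prop))

@[fun_prop]
theorem total {c : α → Context} {l : α → List (Val × ℕ)} {i : α → ℕ} (hc : PT c) (hl : PT l)
    (hi : PT i) : PT fun a => (c a).total (l a) (i a) := by
  unfold Context.total
  exact listSum (map (g := fun a e => e.2 * (c a).vec e.1 (i a)) hl (by fun_prop))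

@[fun_prop]
theorem excess {c : α → Context} {x y : α → ℕ} {l : α → List (Val × ℕ)} {i : α → ℕ} (hc : PT c)
    (hx : PT x) (hy : PT y) (hl : PT l) (hi : PT i) :
    PT fun a => (c a).excess (x a) (y a) (l a) (i a) := by
  unfold Context.excess
  fun_prop

@[fun_prop]
theorem weight {c : α → Context} {k : α → ℕ} {l : α → List (Val × ℕ)} {i : α → ℕ} (hc : PT c)
    (hk : PT k) (hl : PT l) (hi : PT i) :
    PT fun a => (c a).weight (k a) (l a) (i a) := by
  unfold Context.weight
  have h1 := hc.fst.numAtomic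
  have h2 := sum_atomic (g := fun a j => (c a).excess (21 * k a) 400 (l a) j) hc.fst (by fun_prop)
  exact natAdd (natAdd (natMul (by fun_prop) (by fun_prop)) h2) (by fun_prop)

theorem accepts {c : α → Context} {k : α → ℕ} {l : α → List (Val × ℕ)} {w : α → Val} (hc : PT c)
    (hk : PT k) (hl : PT l) (hw : PT w) :
    PT fun a => (c a).accepts (k a) (l a) (w a) := by
  unfold Context.accepts
  exact natLe (natMul (by fun_prop)
      (sum_atomic (g := fun a i => (c a).weight (k a) (l a) i * (c a).vec (w a) i) hc.fst
        (by fun_prop)))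
    (natMul (by fun_prop) (sum_atomic (g := fun a i => (c a).weight (k a) (l a) i) hc.fst
      (by fun_prop)))

theorem good {c : α → Context} {x y : α → ℕ} {l : α → List (Val × ℕ)} {w : α → Val} (hc : PT c)
    (hx : PT x) (hy : PT y) (hl : PT l) (hw : PT w) :
    PT fun a => (c a).good (x a) (y a) (l a) (w a) := by
  unfold Context.good
  exact natLe (natMul (by fun_prop)
      (sum_atomic (g := fun a i => (c a).excess (x a) (y a) (l a) i * (c a).vec (w a) i) hc.fst
        (by fun_prop)))
    (natMul (by fun_prop) (sum_atomic (g := fun a i => (c a).excess (x a) (y a) (l a) i) hc.fst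
      (by fun_prop)))

theorem below {c : α → Context} {x y : α → ℕ} {l : α → List (Val × ℕ)} (hc : PT c)
    (hx : PT x) (hy : PT y) (hl : PT l) :
    PT fun a => (c a).below (x a) (y a) (l a) := by
  unfold Context.below
  exact decide_and (natLt (by fun_prop) (by fun_prop))
    (forall_lt (p := fun a i => y a * (c a).total (l a) i ≤ x a * (c a).unit * _root_.mass (l a))
      hc.fst.numAtomic (.numAtomic hc.fst) (natLe (by fun_prop) (by fun_prop)))

theorem esize_bumpWith_le (p : Val → Bool) (l : List (Val × ℕ)) :
    esize (bumpWith p l) ≤ esize l + 1 := by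
  have h : ∀ n : ℕ, (n + 1).size ≤ n.size + 1 := fun n => by
    rw [Nat.size_le, pow_succ]
    have := Nat.lt_size_self n
    omega
  induction l with
  | nil => simp [bumpWith]
  | cons e l ih =>
    rw [bumpWith]
    split_ifs
    · have := h e.2
      simp only [esize_cons, esize_prod, esize_nat]
      omega
    · simp only [esize_cons]
      omega

theorem bumpWith {p : α → Val → Bool} {l : α → List (Val × ℕ)}
    (hp : PT fun q : α × Val => p q.1 q.2) (hl : PT l) : PT fun a => bumpWith (p a) (l a) := by
  let g : α → Bool × List (Val × ℕ) → Val × ℕ → Bool × List (Val × ℕ) := fun a s e =>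
    if s.1 = true then (true, e :: s.2)
    else if p a e.1 = true then (true, (e.1, e.2 + 1) :: s.2) else (false, e :: s.2)
  have key1 : ∀ a (l acc : List (Val × ℕ)), l.foldl (g a) (true, acc) = (true, l.reverse ++ acc) := by
    intro a l
    induction l with
    | nil => simp
    | cons e l ih => intro acc; simp [g] at ih ⊢; simp [ih]
  have key : ∀ a (l acc : List (Val × ℕ)),
      (l.foldl (g a) (false, acc)).2 = (_root_.bumpWith (p a) l).reverse ++ acc := by
    intro a l
    induction l with
    | nil => simp [_root_.bumpWith]
    | cons e l ih =>
      intro acc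
      rw [List.foldl_cons, _root_.bumpWith]
      by_cases h : p a e.1 = true
      · rw [show g a (false, acc) e = (true, (e.1, e.2 + 1) :: acc) by simp [g, h], key1]
        simp [h]
      · rw [show g a (false, acc) e = (false, e :: acc) by simp [g, h], ih]
        simp [h]
  have hg : PT fun q : α × (Bool × List (Val × ℕ)) × (Val × ℕ) => g q.1 q.2.1 q.2.2 := by
    have : PT fun q : α × (Bool × List (Val × ℕ)) × (Val × ℕ) => p q.1 q.2.2.1 :=
      comp (f := fun q : α × (Bool × List (Val × ℕ)) × (Val × ℕ) => (q.1, q.2.2.1)) hp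
        (by fun_prop)
    exact ite (decide_bool (by fun_prop)) (by fun_prop)
      (ite (decide_bool this) (by fun_prop) (by fun_prop))
  have := foldl (i := fun _ => (false, [])) hl (by fun_prop) hg (fun a => esize (l a) + 4)
    (by have := hl.size; fun_prop) (fun a l' h => by
      have h1 := esize_bool (l'.foldl (g a) (false, [])).1
      have h2 := esize_bumpWith_le (p a) l'
      have h3 := esize_le_of_sublist h.sublist
      rw [esize_prod, key, List.append_nil, esize_reverse]
      omega)
  exact this.snd.reverse.congr fun a => by rw [key]; simp

theorem esize_resetMult_le (l : List (Val × ℕ)) : esize (resetMult l) ≤ esize l := by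
  induction l with
  | nil => simp [resetMult]
  | cons e l ih =>
    simp [resetMult, esize_nat] at ih ⊢
    omega

theorem esize_iterate_bumpWith_le (p : List (Val × ℕ) → Val → Bool) (l : List (Val × ℕ)) (k : ℕ) :
    esize ((fun l => _root_.bumpWith (p l) l)^[k] l) ≤ esize l + k := by
  induction k with
  | zero => simp
  | succ k ih =>
    rw [Function.iterate_succ_apply']
    have := esize_bumpWith_le (p ((fun l => _root_.bumpWith (p l) l)^[k] l))
      ((fun l => _root_.bumpWith (p l) l)^[k] l)
    omega

theorem esize_greedy_le (c : Context) (x y K : ℕ) (l : List (Val × ℕ)) :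
    esize (c.greedy x y K l) ≤ esize l + K :=
  (esize_iterate_bumpWith_le _ _ _).trans (Nat.add_le_add_right (esize_resetMult_le l) _)

theorem greedy {c : α → Context} {x y K : α → ℕ} {l : α → List (Val × ℕ)} (hc : PT c)
    (hx : PT x) (hy : PT y) (hK : PT K) (hK' : PolyBounded K) (hl : PT l) :
    PT fun a => (c a).greedy (x a) (y a) (K a) (l a) := by
  unfold Context.greedy
  have h1 : PT fun a => resetMult (l a) := map (g := fun _ (e : Val × ℕ) => (e.1, 0)) hl (by fun_prop)
  refine iterate (f := fun a l => _root_.bumpWith ((c a).good (x a) (y a) l) l) hK hK' ?_ h1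
    (fun a => esize (l a) + K a) (by have := hl.size; fun_prop) fun a k hk => ?_
  · exact bumpWith (p := fun (q : α × List (Val × ℕ)) w => (c q.1).good (x q.1) (y q.1) q.2 w)
      (good (by fun_prop) (by fun_prop) (by fun_prop) (by fun_prop) (by fun_prop)) (by fun_prop)
  · have h1 := esize_iterate_bumpWith_le ((c a).good (x a) (y a)) (resetMult (l a)) k
    have h2 := esize_resetMult_le (l a)
    omega

theorem esize_tryRemove_foldl_le (c : Context) (x x' y K : ℕ) (l : List (Val × ℕ)) (r : List ℕ)
    (s : List (Val × ℕ)) (hs : esize s ≤ esize l + K) : esize (r.foldl (fun acc j =>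
      if acc.length < l.length then acc
      else if c.below x' y (c.greedy x y K (l.eraseIdx j)) = true then
        c.greedy x y K (l.eraseIdx j) else acc) s) ≤ esize l + K := by
  induction r generalizing s with
  | nil => exact hs
  | cons j r ih =>
    rw [List.foldl_cons]
    refine ih _ ?_
    have h1 := esize_greedy_le c x y K (l.eraseIdx j)
    have h2 := esize_le_of_sublist (List.eraseIdx_sublist l j)
    split_ifs <;> omega

theorem tryRemove {c : α → Context} {x x' y K : α → ℕ} {l : α → List (Val × ℕ)} (hc : PT c)
    (hx : PT x) (hx' : PT x') (hy : PT y) (hK : PT K) (hK' : PolyBounded K) (hl : PT l) :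
    PT fun a => (c a).tryRemove (x a) (x' a) (y a) (K a) (l a) := by
  unfold Context.tryRemove
  have hg : PT fun q : α × List (Val × ℕ) × ℕ =>
      (c q.1).greedy (x q.1) (y q.1) (K q.1) ((l q.1).eraseIdx q.2.2) :=
    greedy (by fun_prop) (by fun_prop) (by fun_prop) (by fun_prop)
      (hK'.comp (g := fun q : α × List (Val × ℕ) × ℕ => q.1) (PT.size (by fun_prop)))
      (eraseIdx (by fun_prop) (by fun_prop))
  refine foldl (g := fun a acc j => if acc.length < (l a).length then acc
    else if (c a).below (x' a) (y a) ((c a).greedy (x a) (y a) (K a) ((l a).eraseIdx j)) = true then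
      (c a).greedy (x a) (y a) (K a) ((l a).eraseIdx j) else acc)
    (range (length hl) (hl.size.mono fun a => (length_lt_esize _).le)) hl ?_
    (fun a => esize (l a) + K a) (by have := hl.size; fun_prop) fun a r _ =>
      esize_tryRemove_foldl_le _ _ _ _ _ _ _ _ (by omega)
  exact ite (natLt (by fun_prop) (by fun_prop)) (by fun_prop)
    (ite (decide_bool (below (by fun_prop) (by fun_prop) (by fun_prop) hg)) hg (by fun_prop))

theorem esize_reduceStep_le (c : Context) (k : ℕ) (l : List (Val × ℕ)) :
    esize (c.reduceStep k l) ≤ esize l + c.1.rounds := by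
  rw [Context.reduceStep]
  split_ifs
  · omega
  · exact esize_tryRemove_foldl_le _ _ _ _ _ _ _ _ (by omega)

theorem reduceStep {c : α → Context} {k : α → ℕ} {l : α → List (Val × ℕ)} (hc : PT c)
    (hk : PT k) (hl : PT l) : PT fun a => (c a).reduceStep (k a) (l a) := by
  unfold Context.reduceStep
  have h1 := hc.fst.numAtomic
  have h2 := hc.fst.samples
  exact ite (natLe (by fun_prop) (by fun_prop)) hl (tryRemove hc
    (levelNum (by fun_prop) hk (by fun_prop)) (levelNum (by fun_prop) hk (by fun_prop))
    (levelDen (by fun_prop)) (rounds (by fun_prop)) (.rounds (by fun_prop)) hl)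

theorem support {c : α → Context} {k : α → ℕ} {l : α → List (Val × ℕ)} (hc : PT c)
    (hk : PT k) (hl : PT l) : PT fun a => (c a).support (k a) (l a) := by
  unfold Context.support
  have hz : PT fun a => (c a).zeroIndex := by
    unfold Context.zeroIndex
    refine foldl (g := fun a s i => if (c a).estimate i = 0 then i else s) (i := fun _ => 0)
      (range hc.fst.numAtomic (.numAtomic hc.fst)) (by fun_prop)
      (ite (natEq (by fun_prop) (by fun_prop)) (by fun_prop) (by fun_prop))
      (fun a => (c a).1.numAtomic + 1) (by have := PolyBounded.numAtomic hc.fst; fun_prop)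
      fun a r hr => ?_
    suffices h : ∀ (r : List ℕ) s, s ≤ (c a).1.numAtomic → (∀ j ∈ r, j < (c a).1.numAtomic) →
        r.foldl (fun s i => if (c a).estimate i = 0 then i else s) s ≤ (c a).1.numAtomic by
      have := h r 0 (Nat.zero_le _) fun j hj => List.mem_range.1 (hr.subset hj)
      rw [esize_nat]
      have := Nat.size_le_self (r.foldl (fun s i => if (c a).estimate i = 0 then i else s) 0)
      omega
    intro r
    induction r with
    | nil => intro s hs _; exact hs
    | cons j r ih =>
      intro s hs hr
      rw [List.foldl_cons]
      refine ih _ ?_ fun i hi => hr i (by simp [hi])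
      have := hr j (by simp)
      split_ifs <;> omega
  refine ite (natEq (by fun_prop) (by fun_prop)) (by fun_prop) ?_
  refine iterate (f := fun a l => (c a).reduceStep (k a) l) hc.fst.samples (.samples hc.fst)
    (reduceStep (by fun_prop) (by fun_prop) (by fun_prop)) hl
    (fun a => esize (l a) + (c a).1.samples * (c a).1.rounds) ?_ fun a j hj => ?_
  · have := hl.size
    have := PolyBounded.samples hc.fst
    have := PolyBounded.rounds hc.fst
    fun_prop
  · refine le_trans ?_ (Nat.add_le_add_left (Nat.mul_le_mul_right _ hj) _)
    clear hj
    induction j with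
    | zero => simp
    | succ j ih =>
      rw [Function.iterate_succ_apply']
      have h1 := esize_reduceStep_le (c a) (k a) (((c a).reduceStep (k a))^[j] (l a))
      have h2 : esize (((c a).reduceStep (k a))^[j] (l a)) ≤ _ := ih
      refine h1.trans ?_
      rw [Nat.add_mul]
      omega

theorem result {c : α → Context} {k : α → ℕ} {l : α → List (Val × ℕ)} (hc : PT c)
    (hk : PT k) (hl : PT l) : PT fun a => (c a).result (k a) (l a) := by
  unfold Context.result
  refine map (g := fun a (e : Val × ℕ) => (e.1, e.2, _root_.mass ((c a).support (k a) (l a))))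
    (support hc hk hl) ?_
  exact prodMk (by fun_prop) (prodMk (by fun_prop)
    (mass (support (by fun_prop) (by fun_prop) (by fun_prop))))

end PT
end pt

/-! ### Sparse solutions of packing problems -/

section sparse

/-- A packing problem with `m` constraints that is solvable with `N > m` columns is solvable without
one of them.  Moving along a linear relation between the columns in the direction that does not
decrease the total weight keeps all constraints satisfied until a weight vanishes. -/
theorem exists_solution_apply_eq_zero {N m : ℕ} (hm : 0 < m) (hN : m < N)
    (Y : Fin N → Fin m → ℝ) (hY : ∀ t i, 0 ≤ Y t i) (θ : ℝ) (hθ : 0 ≤ θ) (a : Fin N → ℝ)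
    (ha : ∀ t, 0 ≤ a t) (hpos : 0 < ∑ t, a t) (hle : ∀ i, ∑ t, a t * Y t i ≤ θ * ∑ t, a t) :
    ∃ j, ∃ b : Fin N → ℝ, b j = 0 ∧ (∀ t, 0 ≤ b t) ∧ 0 < ∑ t, b t ∧
      ∀ i, ∑ t, b t * Y t i ≤ θ * ∑ t, b t := by
  obtain ⟨z, hz0, hz1, hzs⟩ : ∃ z : Fin N → ℝ, z ≠ 0 ∧ (∀ i, ∑ t, z t * Y t i = 0) ∧
      0 ≤ ∑ t, z t := by
    have hdep : ¬ LinearIndependent ℝ Y := by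
      intro h
      have := h.fintype_card_le_finrank
      simp at this
      omega
    obtain ⟨g, hg, t, ht⟩ := Fintype.not_linearIndependent_iff.1 hdep
    have hg' : ∀ i, ∑ t, g t * Y t i = 0 := fun i => by
      have := congrFun hg i
      simpa using this
    rcases le_total 0 (∑ t, g t) with h | h
    · exact ⟨g, fun h0 => ht (by simp [h0]), hg', h⟩
    · refine ⟨-g, fun h0 => ht (by have := congrFun h0 t; simpa using this), fun i => ?_, ?_⟩
      · simp [hg']
      · simpa using h
  by_cases hneg : ∃ t, z t < 0
  · have hne : (Finset.univ.filter fun t => z t < 0).Nonempty := by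
      obtain ⟨t, ht⟩ := hneg
      exact ⟨t, by simpa using ht⟩
    obtain ⟨j, hj, hmin⟩ := Finset.exists_min_image _ (fun t => a t / -z t) hne
    have hj' : z j < 0 := by simpa using hj
    set s := a j / -z j with hs
    have hs0 : 0 ≤ s := div_nonneg (ha j) (by linarith)
    refine ⟨j, fun t => a t + s * z t, ?_, fun t => ?_, ?_, fun i => ?_⟩
    · have : z j ≠ 0 := hj'.ne
      simp only [hs]
      field_simp
      ring
    · by_cases ht : z t < 0
      · have := hmin t (by simpa using ht)
        rw [le_div_iff₀ (by linarith)] at this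
        linarith
      · have := mul_nonneg hs0 (not_lt.1 ht)
        linarith [ha t]
    · rw [Finset.sum_add_distrib, ← Finset.mul_sum]
      have := mul_nonneg hs0 hzs
      linarith
    · have h1 : ∑ t, (a t + s * z t) * Y t i = ∑ t, a t * Y t i := by
        simp_rw [add_mul, mul_assoc]
        rw [Finset.sum_add_distrib, ← Finset.mul_sum, hz1, mul_zero, add_zero]
      rw [h1, Finset.sum_add_distrib, ← Finset.mul_sum]
      have := mul_nonneg hθ (mul_nonneg hs0 hzs)
      linarith [hle i]
  · push Not at hneg
    obtain ⟨s, hs⟩ : ∃ s, z s ≠ 0 := by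
      by_contra h
      push Not at h
      exact hz0 (funext h)
    have hs' : 0 < z s := lt_of_le_of_ne (hneg s) (Ne.symm hs)
    have : Nontrivial (Fin N) := Fin.nontrivial_iff_two_le.2 (by omega)
    obtain ⟨j, hj⟩ := exists_ne s
    refine ⟨j, Pi.single s 1, by simp [hj], fun t => ?_, by simp, fun i => ?_⟩
    · by_cases h : t = s
      · subst h; simp
      · simp [h]
    · have h1 := (Finset.sum_eq_zero_iff_of_nonneg fun t _ => mul_nonneg (hneg t) (hY t i)).1
        (hz1 i) s (Finset.mem_univ _)
      have h2 : Y s i = 0 := by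
        rcases mul_eq_zero.1 h1 with h | h
        · exact absurd h hs
        · exact h
      rw [Finset.sum_eq_single s]
      · simp [h2, hθ]
      · intro t _ ht; simp [ht]
      · simp

/-- If a fractional solution of a packing problem avoids the column `j`, then for any weights of the
constraints some column other than `j` satisfies the weighted constraint. -/
theorem exists_le_of_solution {N m : ℕ} (Y : Fin N → Fin m → ℝ) (θ : ℝ) (b : Fin N → ℝ) (j : Fin N)
    (hj : b j = 0) (hb : ∀ t, 0 ≤ b t) (hpos : 0 < ∑ t, b t)
    (hle : ∀ i, ∑ t, b t * Y t i ≤ θ * ∑ t, b t) (w : Fin m → ℝ) (hw : ∀ i, 0 ≤ w i) :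
    ∃ t ≠ j, ∑ i, w i * Y t i ≤ θ * ∑ i, w i := by
  by_contra! h
  have h1 : ∑ t, b t * (θ * ∑ i, w i) < ∑ t, b t * ∑ i, w i * Y t i := by
    obtain ⟨t, -, ht⟩ : ∃ t ∈ Finset.univ, 0 < b t := by
      by_contra! h0
      exact hpos.not_ge (Finset.sum_nonpos h0)
    refine Finset.sum_lt_sum (fun t _ => ?_) ⟨t, Finset.mem_univ _, ?_⟩
    · by_cases htj : t = j
      · simp [htj, hj]
      · exact mul_le_mul_of_nonneg_left (h t htj).le (hb t)
    · refine mul_lt_mul_of_pos_left (h t ?_) ht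
      rintro rfl
      exact ht.ne' hj
  have h2 : ∑ t, b t * ∑ i, w i * Y t i = ∑ i, w i * ∑ t, b t * Y t i := by
    simp_rw [Finset.mul_sum]
    rw [Finset.sum_comm]
    refine Finset.sum_congr rfl fun i _ => Finset.sum_congr rfl fun t _ => by ring
  have h3 : ∑ i, w i * ∑ t, b t * Y t i ≤ ∑ i, w i * (θ * ∑ t, b t) :=
    Finset.sum_le_sum fun i _ => mul_le_mul_of_nonneg_left (hle i) (hw i)
  rw [← Finset.sum_mul] at h1 h3
  linarith

end sparse

/-! ### Keeping the excess over a level small -/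

namespace Context

/-- The sum of the squares of the excesses. -/
def potential (c : Context) (x y : ℕ) (l : List (Val × ℕ)) : ℕ :=
  ∑ i ∈ Finset.range c.1.numAtomic, c.excess x y l i ^ 2

/-- If a tree is added whose cost, weighted with the excesses, is at most the level up to an error,
then the potential increases only by that error and by the square of the added vector. -/
theorem potential_le_of_add (c : Context) {x y E Z : ℕ} {l l' : List (Val × ℕ)} {w : Val}
    (ht : ∀ i, c.total l' i = c.total l i + c.vec w i) (hm : mass l' = mass l + 1)
    (hE : y * ∑ i ∈ Finset.range c.1.numAtomic, c.excess x y l i * c.vec w i ≤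
      x * c.unit * ∑ i ∈ Finset.range c.1.numAtomic, c.excess x y l i + E)
    (hZ : ∀ i < c.1.numAtomic, y * c.vec w i ≤ Z) (hZ' : x * c.unit ≤ Z) :
    c.potential x y l' ≤ c.potential x y l + (2 * E + c.1.numAtomic * Z ^ 2) := by
  have step : ∀ i ∈ Finset.range c.1.numAtomic, ((c.excess x y l' i : ℤ)) ^ 2 ≤
      (c.excess x y l i : ℤ) ^ 2 +
        (2 * (y * (c.excess x y l i * c.vec w i) - x * c.unit * c.excess x y l i) + Z ^ 2) := by
    intro i hi
    have h1 := hZ i (Finset.mem_range.1 hi)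
    simp only [excess, ht, hm]
    set u := y * c.total l i with hu
    set v := x * c.unit * mass l with hv
    have e1 : y * (c.total l i + c.vec w i) = u + y * c.vec w i := by rw [hu]; ring
    have e2 : x * c.unit * (mass l + 1) = v + x * c.unit := by rw [hv]; ring
    rw [e1, e2]
    set p := y * c.vec w i
    set q := x * c.unit
    have e3 : (y : ℤ) * (((u - v : ℕ) : ℤ) * c.vec w i) - x * c.unit * ((u - v : ℕ) : ℤ) =
        ((u - v : ℕ) : ℤ) * ((p : ℤ) - q) := by simp only [p, q]; push_cast; ring
    rw [e3]
    have hz : ((p : ℤ) - q) ^ 2 ≤ (Z : ℤ) ^ 2 := by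
      apply sq_le_sq'
      · have : (q : ℤ) ≤ Z := by exact_mod_cast hZ'
        linarith [Int.natCast_nonneg p]
      · have : (p : ℤ) ≤ Z := by exact_mod_cast h1
        linarith [Int.natCast_nonneg q]
    clear_value p q u v
    rcases le_total v u with h | h
    · obtain ⟨d, rfl⟩ := Nat.exists_eq_add_of_le h
      have e4 : v + d - v = d := by omega
      rw [e4]
      rcases le_total (v + q) (v + d + p) with h' | h'
      · rw [Nat.cast_sub h']
        push_cast
        nlinarith
      · rw [Nat.sub_eq_zero_of_le h']
        have : (d : ℤ) + (p - q) ≤ 0 := by zify at h'; linarith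
        push_cast
        nlinarith [sq_nonneg ((d : ℤ) + (p - q))]
    · rw [Nat.sub_eq_zero_of_le h]
      rcases le_total (v + q) (u + p) with h' | h'
      · rw [Nat.cast_sub h']
        zify at h h'
        push_cast
        nlinarith
      · rw [Nat.sub_eq_zero_of_le h']
        push_cast
        nlinarith
  have hsum := Finset.sum_le_sum step
  rw [Finset.sum_add_distrib, Finset.sum_add_distrib, ← Finset.mul_sum, Finset.sum_sub_distrib,
    ← Finset.mul_sum, ← Finset.mul_sum] at hsum
  simp only [Finset.sum_const, Finset.card_range, nsmul_eq_mul] at hsum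
  simp only [potential]
  zify at hE ⊢
  linarith

theorem excess_le_of_potential_le (c : Context) {x y B : ℕ} {l : List (Val × ℕ)}
    (h : c.potential x y l ≤ B ^ 2) {i : ℕ} (hi : i < c.1.numAtomic) : c.excess x y l i ≤ B := by
  have := (Finset.single_le_sum (f := fun i => c.excess x y l i ^ 2) (fun _ _ => Nat.zero_le _)
    (Finset.mem_range.2 hi)).trans h
  exact (Nat.pow_le_pow_iff_left two_ne_zero).1 this

end Context

theorem bumpWith_map_fst (p : Val → Bool) (l : List (Val × ℕ)) :
    (bumpWith p l).map Prod.fst = l.map Prod.fst := by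
  induction l with
  | nil => rfl
  | cons e l ih => rw [bumpWith]; split_ifs <;> simp [ih]

theorem bumpWith_spec (c : Context) (p : Val → Bool) (l : List (Val × ℕ))
    (h : ∃ w ∈ l.map Prod.fst, p w = true) :
    ∃ w ∈ l.map Prod.fst, p w = true ∧
      (∀ i, c.total (bumpWith p l) i = c.total l i + c.vec w i) ∧
      mass (bumpWith p l) = mass l + 1 := by
  induction l with
  | nil => simp at h
  | cons e l ih =>
    by_cases he : p e.1 = true
    · refine ⟨e.1, by simp, he, fun i => ?_, ?_⟩
      · simp [bumpWith, he, Context.total]; ring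
      · simp [bumpWith, he, mass]; ring
    · obtain ⟨w, hw, hp⟩ := h
      have : w ∈ l.map Prod.fst := by
        rw [List.map_cons, List.mem_cons] at hw
        rcases hw with rfl | hw
        · exact absurd hp he
        · exact hw
      obtain ⟨w, hw, hp, h1, h2⟩ := ih ⟨w, this, hp⟩
      refine ⟨w, by rw [List.map_cons]; exact List.mem_cons_of_mem _ hw, hp, fun i => ?_, ?_⟩
      · have := h1 i
        simp only [Context.total] at this
        simp [bumpWith, he, Context.total, this]; ring
      · simp only [mass] at h2
        simp [bumpWith, he, mass, h2]; ring

namespace Context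

theorem greedy_map_fst (c : Context) (x y K : ℕ) (l : List (Val × ℕ)) :
    (c.greedy x y K l).map Prod.fst = l.map Prod.fst := by
  rw [greedy]
  induction K with
  | zero => simp [resetMult, Function.comp_def]
  | succ K ih => rw [Function.iterate_succ_apply', bumpWith_map_fst, ih]

theorem greedy_length (c : Context) (x y K : ℕ) (l : List (Val × ℕ)) :
    (c.greedy x y K l).length = l.length := by
  have := congrArg List.length (c.greedy_map_fst x y K l)
  simpa using this

/-- If every weighting of the constraints is satisfied at the level `x / y` by some tree of the
list, then the greedy choice of multiplicities reaches any larger level in sufficiently many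
rounds. -/
theorem below_greedy (c : Context) {x x' y r Z : ℕ} {l : List (Val × ℕ)} (hr : 0 < r)
    (hx : x ≤ x') (hrZ : Z ≤ r * ((x' - x) * c.unit))
    (hfeas : ∀ v : ℕ → ℕ, ∃ w ∈ l.map Prod.fst,
      y * ∑ i ∈ Finset.range c.1.numAtomic, v i * c.vec w i ≤
        x * c.unit * ∑ i ∈ Finset.range c.1.numAtomic, v i)
    (hZ : ∀ w ∈ l.map Prod.fst, ∀ i < c.1.numAtomic, y * c.vec w i ≤ Z) (hZ' : x * c.unit ≤ Z) :
    c.below x' y (c.greedy x y (c.1.numAtomic * r ^ 2) l) = true := by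
  have hm : 0 < c.1.numAtomic := by simp [BaB.numAtomic]
  have key : ∀ K, mass (c.greedy x y K l) = K ∧
      c.potential x y (c.greedy x y K l) ≤ K * (c.1.numAtomic * Z ^ 2) := by
    intro K
    induction K with
    | zero =>
      simp [greedy, resetMult, mass, potential, excess, total, Function.comp_def]
    | succ K ih =>
      obtain ⟨w, hw, hgood, h1, h2⟩ := bumpWith_spec c (c.good x y (c.greedy x y K l))
        (c.greedy x y K l) (by
          rw [greedy_map_fst]
          obtain ⟨w, hw, h⟩ := hfeas (c.excess x y (c.greedy x y K l))
          exact ⟨w, hw, decide_eq_true h⟩)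
      have e : c.greedy x y (K + 1) l =
          bumpWith (c.good x y (c.greedy x y K l)) (c.greedy x y K l) := by
        simp only [greedy, Function.iterate_succ_apply']
      rw [← e] at h1 h2
      rw [greedy_map_fst] at hw
      refine ⟨by rw [h2, ih.1], ?_⟩
      have := c.potential_le_of_add (E := 0) h1 h2 (of_decide_eq_true hgood) (hZ w hw) hZ'
      rw [Nat.add_mul]
      omega
  obtain ⟨h1, h2⟩ := key (c.1.numAtomic * r ^ 2)
  have hK : 0 < c.1.numAtomic * r ^ 2 := by positivity
  refine decide_eq_true ⟨by omega, fun i hi => ?_⟩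
  have h3 : c.potential x y (c.greedy x y (c.1.numAtomic * r ^ 2) l) ≤
      (c.1.numAtomic * r ^ 2 * ((x' - x) * c.unit)) ^ 2 := by
    refine h2.trans ?_
    calc c.1.numAtomic * r ^ 2 * (c.1.numAtomic * Z ^ 2)
        ≤ c.1.numAtomic * r ^ 2 * (c.1.numAtomic * (r * ((x' - x) * c.unit)) ^ 2) := by gcongr
      _ = _ := by ring
  have h4 := c.excess_le_of_potential_le h3 hi
  rw [excess, h1] at h4
  rw [h1]
  obtain ⟨d, rfl⟩ := Nat.exists_eq_add_of_le hx
  rw [show x + d - x = d by omega] at h4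
  have : (x + d) * c.unit * (c.1.numAtomic * r ^ 2) =
    c.1.numAtomic * r ^ 2 * (d * c.unit) + x * c.unit * (c.1.numAtomic * r ^ 2) := by ring
  omega

/-- If there are more trees than constraints, then one of them is not needed in order to satisfy
all weightings of the constraints. -/
theorem exists_eraseIdx (c : Context) {x y : ℕ} {l : List (Val × ℕ)} (hy : 0 < y)
    (hl : c.1.numAtomic < l.length) (hb : c.below x y l = true) :
    ∃ j < l.length, ∀ v : ℕ → ℕ, ∃ w ∈ (l.eraseIdx j).map Prod.fst,
      y * ∑ i ∈ Finset.range c.1.numAtomic, v i * c.vec w i ≤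
        x * c.unit * ∑ i ∈ Finset.range c.1.numAtomic, v i := by
  have hm : 0 < c.1.numAtomic := by simp [BaB.numAtomic]
  obtain ⟨h0, h1⟩ := of_decide_eq_true hb
  have hmass : mass l = ∑ t : Fin l.length, l[t].2 := by
    rw [mass, ← Fin.sum_univ_fun_getElem]
    rfl
  have htot : ∀ i, c.total l i = ∑ t : Fin l.length, l[t].2 * c.vec l[t].1 i := fun i => by
    rw [total, ← Fin.sum_univ_fun_getElem]
    rfl
  have hy' : (0 : ℝ) < y := by exact_mod_cast hy
  obtain ⟨j, b, hj, hb0, hbpos, hble⟩ := exists_solution_apply_eq_zero hm hl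
    (fun t i => (c.vec l[t].1 i : ℝ)) (fun _ _ => Nat.cast_nonneg _) (x * c.unit / y)
    (by positivity) (fun t => (l[t].2 : ℝ)) (fun _ => Nat.cast_nonneg _)
    (by rw [hmass] at h0; exact_mod_cast h0) (fun i => by
      have := h1 i i.2
      rw [hmass, htot] at this
      rw [div_mul_eq_mul_div, le_div_iff₀ hy', mul_comm]
      exact_mod_cast this)
  refine ⟨j, j.2, fun v => ?_⟩
  obtain ⟨t, htj, ht⟩ := exists_le_of_solution _ _ b j hj hb0 hbpos hble
    (fun i : Fin c.1.numAtomic => (v i : ℝ)) (fun _ => Nat.cast_nonneg _)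
  refine ⟨l[t].1, List.mem_map_of_mem (List.mem_eraseIdx_iff_getElem.2
    ⟨t, t.2, fun h => htj (Fin.ext h), rfl⟩), ?_⟩
  rw [div_mul_eq_mul_div, le_div_iff₀ hy', mul_comm] at ht
  rw [Finset.sum_range, Finset.sum_range]
  exact_mod_cast ht

/-- If the removal of some tree is possible, then one tree is removed and the new level holds. -/
theorem tryRemove_spec (c : Context) {x x' y K : ℕ} {l : List (Val × ℕ)}
    (h : ∃ j < l.length, c.below x' y (c.greedy x y K (l.eraseIdx j)) = true) :
    (c.tryRemove x x' y K l).length + 1 = l.length ∧ c.below x' y (c.tryRemove x x' y K l) = true ∧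
      ∀ w ∈ (c.tryRemove x x' y K l).map Prod.fst, w ∈ l.map Prod.fst := by
  let P : List (Val × ℕ) → Prop := fun s => s.length + 1 = l.length ∧ c.below x' y s = true ∧
    ∀ w ∈ s.map Prod.fst, w ∈ l.map Prod.fst
  let g : List (Val × ℕ) → ℕ → List (Val × ℕ) := fun acc j => if acc.length < l.length then acc
      else if c.below x' y (c.greedy x y K (l.eraseIdx j)) = true then
        c.greedy x y K (l.eraseIdx j) else acc
  have hP : ∀ s, P s → ∀ r : List ℕ, P (r.foldl g s) := by
    intro s hs r
    induction r generalizing s with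
    | nil => exact hs
    | cons j r ih =>
      refine ih _ ?_
      have : s.length < l.length := by have := hs.1; omega
      simpa [g, this] using hs
  have hfind : ∀ r : List ℕ, (∀ j ∈ r, j < l.length) →
      (∃ j ∈ r, c.below x' y (c.greedy x y K (l.eraseIdx j)) = true) → P (r.foldl g l) := by
    intro r
    induction r with
    | nil => simp
    | cons i r ih =>
      intro hlt ⟨j, hj, hb⟩
      rw [List.foldl_cons]
      by_cases hi : c.below x' y (c.greedy x y K (l.eraseIdx i)) = true
      · have e : g l i = c.greedy x y K (l.eraseIdx i) := by simp [g, hi]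
        rw [e]
        refine hP _ ⟨?_, hi, ?_⟩ _
        · rw [greedy_length, List.length_eraseIdx_of_lt (hlt i (by simp))]
          have := hlt i (by simp)
          omega
        · intro w hw
          rw [greedy_map_fst] at hw
          exact ((List.eraseIdx_sublist l i).map _).subset hw
      · have e : g l i = l := by simp [g, hi]
        rw [e]
        refine ih (fun j hj => hlt j (by simp [hj])) ⟨j, ?_, hb⟩
        rcases List.mem_cons.1 hj with rfl | hj
        · exact absurd hb hi
        · exact hj
  obtain ⟨j, hj, hb⟩ := h
  exact hfind _ (fun j hj => List.mem_range.1 hj) ⟨j, List.mem_range.2 hj, hb⟩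

/-- All normalized costs are at most `21 m k / 20` for `m = c.1.numAtomic`, which bounds the width
of the packing problem. -/
def Narrow (c : Context) (k : ℕ) (l : List (Val × ℕ)) : Prop :=
  ∀ w ∈ l.map Prod.fst, ∀ i < c.1.numAtomic, 20 * c.vec w i ≤ 21 * c.1.numAtomic * k * c.unit

/-- As long as there are more trees than constraints, one of them can be removed, and the level
increases by one step. -/
theorem reduceStep_spec (c : Context) {k : ℕ} {l : List (Val × ℕ)} (hn : c.Narrow k l)
    (hl : c.1.numAtomic < l.length)
    (hR : l.length ≤ c.1.samples)
    (hb : c.below (c.1.levelNum k (c.1.samples - l.length)) c.1.levelDen l = true) :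
    (c.reduceStep k l).length + 1 = l.length ∧
    c.below (c.1.levelNum k (c.1.samples - (c.reduceStep k l).length)) c.1.levelDen
      (c.reduceStep k l) = true ∧
    ∀ w ∈ (c.reduceStep k l).map Prod.fst, w ∈ l.map Prod.fst := by
  have hm : 0 < c.1.numAtomic := by simp [BaB.numAtomic]
  have hy : 0 < c.1.levelDen := by simp [BaB.levelDen]
  obtain ⟨j, hj, hfeas⟩ := c.exists_eraseIdx hy hl hb
  have e : c.reduceStep k l = c.tryRemove (c.1.levelNum k (c.1.samples - l.length))
      (c.1.levelNum k (c.1.samples - l.length + 1)) c.1.levelDen c.1.rounds l := by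
    rw [reduceStep, if_neg (by omega)]
  have hspec := c.tryRemove_spec (x := c.1.levelNum k (c.1.samples - l.length))
    (x' := c.1.levelNum k (c.1.samples - l.length + 1)) (y := c.1.levelDen) (K := c.1.rounds)
    ⟨j, hj, c.below_greedy (Z := 420 * (c.1.samples + 1) * c.1.numAtomic * k * c.unit)
      (by positivity) ?_ ?_ hfeas ?_ ?_⟩
  · rw [← e] at hspec
    obtain ⟨h1, h2, h3⟩ := hspec
    refine ⟨h1, ?_, h3⟩
    rw [show c.1.samples - (c.reduceStep k l).length = c.1.samples - l.length + 1 by omega]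
    exact h2
  · rw [BaB.levelNum, BaB.levelNum]
    gcongr
    omega
  · have : c.1.levelNum k (c.1.samples - l.length + 1) - c.1.levelNum k (c.1.samples - l.length) =
        2 * k := by
      rw [BaB.levelNum, BaB.levelNum, ← Nat.sub_mul]
      congr 1
      omega
    rw [this]
    apply le_of_eq
    ring
  · intro w hw i hi
    have := hn w (((List.eraseIdx_sublist l j).map _).subset hw) i hi
    rw [BaB.levelDen]
    calc 400 * (c.1.samples + 1) * c.vec w i = 20 * (c.1.samples + 1) * (20 * c.vec w i) := by ring
      _ ≤ 20 * (c.1.samples + 1) * (21 * c.1.numAtomic * k * c.unit) := by gcongr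
      _ = _ := by ring
  · rw [BaB.levelNum]
    have h1 : 22 * (c.1.samples + 1) + 2 * (c.1.samples - l.length) ≤
        420 * (c.1.samples + 1) * c.1.numAtomic := by
      have : 420 * (c.1.samples + 1) * 1 ≤ 420 * (c.1.samples + 1) * c.1.numAtomic := by
        gcongr
        omega
      omega
    calc _ ≤ 420 * (c.1.samples + 1) * c.1.numAtomic * k * c.unit := by gcongr
      _ = _ := rfl

/-- The support is reduced to the number of constraints, while the level increases from `22 k / 400`
to at most `24 k / 400`. -/
theorem iterate_reduceStep_spec (c : Context) {k : ℕ} {l : List (Val × ℕ)} (hn : c.Narrow k l)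
    (hlen : l.length = c.1.samples) (hb : c.below (22 * k) 400 l = true) :
    let s := (c.reduceStep k)^[c.1.samples] l
    s.length ≤ c.1.numAtomic ∧ 0 < mass s ∧
    (∀ i < c.1.numAtomic, 400 * c.total s i ≤ 24 * k * c.unit * mass s) ∧
    ∀ w ∈ s.map Prod.fst, w ∈ l.map Prod.fst := by
  intro s
  have key : ∀ n, ((c.reduceStep k)^[n] l).length ≤ max c.1.numAtomic (c.1.samples - n) ∧
      ((c.reduceStep k)^[n] l).length ≤ c.1.samples ∧
      c.below (c.1.levelNum k (c.1.samples - ((c.reduceStep k)^[n] l).length)) c.1.levelDen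
        ((c.reduceStep k)^[n] l) = true ∧
      ∀ w ∈ ((c.reduceStep k)^[n] l).map Prod.fst, w ∈ l.map Prod.fst := by
    intro n
    induction n with
    | zero =>
      refine ⟨by simp [hlen], by simp [hlen], ?_, fun w hw => hw⟩
      obtain ⟨h1, h2⟩ := of_decide_eq_true hb
      refine decide_eq_true ⟨h1, fun i hi => ?_⟩
      have := h2 i hi
      simp only [Function.iterate_zero, id, hlen, Nat.sub_self, BaB.levelNum, BaB.levelDen]
      calc 400 * (c.1.samples + 1) * c.total l i = (c.1.samples + 1) * (400 * c.total l i) := by ring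
        _ ≤ (c.1.samples + 1) * (22 * k * c.unit * mass l) := by gcongr
        _ = _ := by ring
    | succ n ih =>
      obtain ⟨h1, h2, h3, h4⟩ := ih
      rw [Function.iterate_succ_apply']
      set l' := (c.reduceStep k)^[n] l
      by_cases h : l'.length ≤ c.1.numAtomic
      · rw [reduceStep, if_pos h]
        exact ⟨h.trans (le_max_left _ _), h2, h3, h4⟩
      · obtain ⟨g1, g2, g3⟩ := c.reduceStep_spec (k := k) (l := l')
          (fun w hw => hn w (h4 w hw)) (by omega) h2 h3
        refine ⟨?_, by omega, g2, fun w hw => h4 w (g3 w hw)⟩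
        omega
  obtain ⟨h1, h2, h3, h4⟩ := key c.1.samples
  obtain ⟨h5, h6⟩ := of_decide_eq_true h3
  refine ⟨by simpa using h1, h5, fun i hi => ?_, h4⟩
  have := h6 i hi
  have h7 : c.1.levelNum k (c.1.samples - s.length) ≤ (c.1.samples + 1) * (24 * k) := by
    rw [BaB.levelNum, ← mul_assoc]
    gcongr
    omega
  refine Nat.le_of_mul_le_mul_left (c := c.1.samples + 1) ?_ (Nat.succ_pos _)
  calc (c.1.samples + 1) * (400 * c.total s i) = c.1.levelDen * c.total s i := by
        rw [BaB.levelDen]; ring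
    _ ≤ c.1.levelNum k (c.1.samples - s.length) * c.unit * mass s := this
    _ ≤ (c.1.samples + 1) * (24 * k) * c.unit * mass s := by gcongr
    _ = _ := by ring

/-- The invariant of the sampling of trees: all multiplicities are `1`, the accepted trees are not
too expensive, and the potential grows at most linearly. -/
structure Sampled (c : Context) (k : ℕ) (l : List (Val × ℕ)) : Prop where
  mass_eq : mass l = l.length
  narrow : c.Narrow k l
  potential_le : c.potential (21 * k) 400 l ≤
    l.length * (c.1.numAtomic * (421 * c.1.numAtomic * k * c.unit) ^ 2)

theorem sampled_nil (c : Context) (k : ℕ) : c.Sampled k [] where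
  mass_eq := rfl
  narrow := by simp [Narrow]
  potential_le := by simp [potential, excess, total]

/-- The uniform share of the weights makes accepted trees narrow. It costs a factor `21 / 20` and an
additive error in the inequality that is needed for the excess, which the constant `421` instead of
`420` absorbs. -/
theorem Sampled.cons {c : Context} {k : ℕ} {l : List (Val × ℕ)} (h : c.Sampled k l) (hk : 0 < k)
    (hu : 0 < c.unit) {w : Val} (hw : c.accepts k l w = true) : c.Sampled k ((w, 1) :: l) := by
  have hm : 0 < c.1.numAtomic := by simp [BaB.numAtomic]
  have hw := of_decide_eq_true hw
  set m := c.1.numAtomic with hmdef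
  set S := ∑ j ∈ Finset.range m, c.excess (21 * k) 400 l j with hS
  have e1 : ∑ i ∈ Finset.range m, c.weight k l i = m * (21 * S + 1) := by
    simp only [weight, ← hmdef, ← hS]
    rw [Finset.sum_add_distrib, Finset.sum_add_distrib, ← Finset.mul_sum, ← hS]
    simp
    ring
  have e2 : ∑ i ∈ Finset.range m, c.weight k l i * c.vec w i =
      20 * m * ∑ i ∈ Finset.range m, c.excess (21 * k) 400 l i * c.vec w i +
        (S + 1) * ∑ i ∈ Finset.range m, c.vec w i := by
    simp only [weight, ← hmdef, ← hS]
    rw [Finset.mul_sum, Finset.mul_sum, ← Finset.sum_add_distrib]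
    refine Finset.sum_congr rfl fun i _ => by ring
  rw [e1, e2] at hw
  have hnar : ∀ i < m, 20 * c.vec w i ≤ 21 * m * k * c.unit := by
    intro i hi
    have h1 : c.vec w i ≤ ∑ i ∈ Finset.range m, c.vec w i :=
      Finset.single_le_sum (f := fun i => c.vec w i) (fun _ _ => Nat.zero_le _)
        (Finset.mem_range.2 hi)
    refine Nat.le_of_mul_le_mul_left (c := S + 1) ?_ (Nat.succ_pos _)
    calc (S + 1) * (20 * c.vec w i) ≤ 20 * ((S + 1) * ∑ i ∈ Finset.range m, c.vec w i) := by
          nlinarith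
      _ ≤ k * c.unit * (m * (21 * S + 1)) := by
          refine le_trans ?_ hw
          gcongr
          omega
      _ ≤ k * c.unit * (m * (21 * (S + 1))) := by gcongr; omega
      _ = _ := by ring
  have hE : 400 * ∑ i ∈ Finset.range m, c.excess (21 * k) 400 l i * c.vec w i ≤
      21 * k * c.unit * S + k * c.unit := by
    refine Nat.le_of_mul_le_mul_left (c := m) ?_ hm
    calc m * (400 * ∑ i ∈ Finset.range m, c.excess (21 * k) 400 l i * c.vec w i)
        = 20 * (20 * m * ∑ i ∈ Finset.range m, c.excess (21 * k) 400 l i * c.vec w i) := by ring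
      _ ≤ k * c.unit * (m * (21 * S + 1)) := by
          refine le_trans ?_ hw
          gcongr
          omega
      _ = _ := by ring
  refine ⟨?_, ?_, ?_⟩
  · have := h.mass_eq
    simp only [mass] at this
    simp [mass, this]
    ring
  · intro v hv
    rw [List.map_cons, List.mem_cons] at hv
    rcases hv with rfl | hv
    · exact hnar
    · exact h.narrow v hv
  · have h1 := c.potential_le_of_add (l := l) (l' := (w, 1) :: l) (w := w)
      (Z := 420 * m * k * c.unit) (fun i => by simp [total]; ring) (by simp [mass]; ring) hE
      (fun i hi => by have := hnar i hi; nlinarith) (by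
        have : 21 * (k * c.unit) ≤ 420 * m * (k * c.unit) := by gcongr; omega
        nlinarith)
    have hp : 0 < k * c.unit := by positivity
    have h2 : 2 * (k * c.unit) + m * (420 * m * k * c.unit) ^ 2 ≤
        m * (421 * m * k * c.unit) ^ 2 := by
      have e3 : m * (421 * m * k * c.unit) ^ 2 =
          841 * (m ^ 3 * ((k * c.unit) * (k * c.unit))) + m * (420 * m * k * c.unit) ^ 2 := by ring
      rw [e3]
      have h3 : 1 * (1 * (k * c.unit)) ≤ m ^ 3 * ((k * c.unit) * (k * c.unit)) := by
        gcongr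
        · exact Nat.one_le_pow _ _ hm
        · exact hp
      omega
    refine h1.trans ?_
    rw [List.length_cons, Nat.add_mul, one_mul]
    exact Nat.add_le_add h.potential_le h2

/-- After sufficiently many samples the excess over the level `21 k / 400` is on average at most
`k / 400`. -/
theorem Sampled.below {c : Context} {k : ℕ} {l : List (Val × ℕ)} (h : c.Sampled k l)
    (hl : l.length = c.1.samples) : c.below (22 * k) 400 l = true := by
  have hm : 0 < c.1.numAtomic := by simp [BaB.numAtomic]
  have hR : 0 < c.1.samples := by simp [BaB.samples, hm]
  have h1 := h.mass_eq
  refine decide_eq_true ⟨by omega, fun i hi => ?_⟩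
  have h2 : c.potential (21 * k) 400 l ≤ (c.1.samples * (k * c.unit)) ^ 2 := by
    refine h.potential_le.trans (le_of_eq ?_)
    rw [hl, BaB.samples]
    ring
  have h3 := c.excess_le_of_potential_le h2 hi
  rw [excess, h1, hl] at h3
  rw [h1, hl]
  have : 22 * k * c.unit * c.1.samples =
    c.1.samples * (k * c.unit) + 21 * k * c.unit * c.1.samples := by ring
  omega

end Context

/-! ### Loops that call a subroutine once in every round -/

section measures

theorem Outcome.measurableSet {ι : Type} (S : Set (Outcome ι)) : MeasurableSet S :=
  MeasurableSpace.measurableSet_top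

theorem bind_map_outcome {ι κ τ : Type} {μ : Measure (Outcome ι)} {f : Outcome ι → Outcome κ}
    {g : Outcome κ → Measure (Outcome τ)} : (μ.map f).bind g = μ.bind fun a => g (f a) := by
  ext S hS
  rw [Measure.bind_apply hS (Outcome.measurable _).aemeasurable,
    Measure.bind_apply hS (Outcome.measurable _).aemeasurable,
    lintegral_map (Outcome.measurable _) (Outcome.measurable _)]

theorem runWith_call {sub : Subroutine → Val → Measure (Outcome Empty)} (i : Subroutine) (v : Val) :
    (Prog.call i).runWith sub v =
      (sub i v).map fun o => ⟨o.val, o.time + v.size + o.val.size, Pi.single i 1⟩ := by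
  rw [Prog.runWith]
  congr! 3
  funext j
  by_cases h : j = i <;> simp [h]

theorem ae_bind_iff {ι κ : Type} {μ : Measure (Outcome ι)} {f : Outcome ι → Measure (Outcome κ)}
    {p : Outcome κ → Prop} : (∀ᵐ x ∂μ.bind f, p x) ↔ ∀ᵐ a ∂μ, ∀ᵐ x ∂f a, p x := by
  simp only [ae_iff]
  rw [Measure.bind_apply (Outcome.measurableSet _) (Outcome.measurable _).aemeasurable,
    lintegral_eq_zero_iff (Outcome.measurable _)]
  rfl

theorem ae_map_outcome_iff {ι κ : Type} {μ : Measure (Outcome ι)} {f : Outcome ι → Outcome κ}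
    {p : Outcome κ → Prop} : (∀ᵐ x ∂μ.map f, p x) ↔ ∀ᵐ a ∂μ, p (f a) :=
  ae_map_iff (Outcome.measurable _).aemeasurable (Outcome.measurableSet _)

theorem lintegral_bind_outcome {ι κ : Type} {μ : Measure (Outcome ι)}
    {f : Outcome ι → Measure (Outcome κ)} {g : Outcome κ → ℝ≥0∞} :
    ∫⁻ x, g x ∂μ.bind f = ∫⁻ a, ∫⁻ x, g x ∂f a ∂μ :=
  Measure.lintegral_bind (Outcome.measurable _).aemeasurable (Outcome.measurable _).aemeasurable

theorem lintegral_map_outcome {ι κ : Type} {μ : Measure (Outcome ι)}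
    {f : Outcome ι → Outcome κ} {g : Outcome κ → ℝ≥0∞} :
    ∫⁻ x, g x ∂μ.map f = ∫⁻ a, g (f a) ∂μ :=
  lintegral_map (Outcome.measurable _) (Outcome.measurable _)

theorem map_univ_outcome {ι κ : Type} {μ : Measure (Outcome ι)} {f : Outcome ι → Outcome κ} :
    μ.map f Set.univ = μ Set.univ := by
  rw [Measure.map_apply (Outcome.measurable _) MeasurableSet.univ, Set.preimage_univ]

theorem bind_univ_outcome {ι κ : Type} {μ : Measure (Outcome ι)}
    {f : Outcome ι → Measure (Outcome κ)} :
    μ.bind f Set.univ = ∫⁻ a, f a Set.univ ∂μ :=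
  Measure.bind_apply MeasurableSet.univ (Outcome.measurable _).aemeasurable

end measures

/-- A loop whose states are encoded elements `s : σ` and whose guard is deterministic; in each round
one random outcome `o` is drawn from `draw s` and the state becomes `next s o`.  The outcome of the
body is `F s o`, in which `i` records the calls.  The invariant `Inv` comes with a bound `B` for the
time of the guard and of the body. -/
structure CallLoop {ι σ : Type} (G P : Val → Measure (Outcome ι)) (e : σ → Val) (c : σ → Bool)
    (draw : σ → Measure (Outcome Empty)) (next : σ → Outcome Empty → σ)
    (F : σ → Outcome Empty → Outcome ι) (i : ι → ℕ) (B : ℕ) (Inv : σ → Prop) : Prop where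
  guard : ∀ s, Inv s → ∃ t ≤ B, G (e s) = Measure.dirac ⟨.int (if c s = true then 1 else 0), t, 0⟩
  body : ∀ s, Inv s → c s = true → P (e s) = (draw s).map (F s)
  val : ∀ s o, Inv s → (F s o).val = e (next s o)
  calls : ∀ s o, Inv s → (F s o).calls = i
  univ : ∀ s, Inv s → c s = true → draw s Set.univ = 1
  inv : ∀ s, Inv s → c s = true → ∀ᵐ o ∂draw s, Inv (next s o) ∧ (F s o).time ≤ B

namespace CallLoop
variable {ι σ : Type} {G P : Val → Measure (Outcome ι)} {e : σ → Val} {c : σ → Bool}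
    {draw : σ → Measure (Outcome Empty)} {next : σ → Outcome Empty → σ}
    {F : σ → Outcome Empty → Outcome ι} {i : ι → ℕ} {B : ℕ} {Inv : σ → Prop}

theorem run_zero (h : CallLoop G P e c draw next F i B Inv) {s : σ} (hs : Inv s) : ∃ t ≤ B,
    loopRun G P 0 (e s) = if c s = true then 0 else Measure.dirac ⟨e s, t + 1, 0⟩ := by
  obtain ⟨t, ht, hG⟩ := h.guard s hs
  refine ⟨t, ht, ?_⟩
  rw [loopRun, hG, Measure.dirac_bind (Outcome.measurable _)]
  by_cases hc : c s = true <;> simp [hc]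

theorem run_succ_of_false (h : CallLoop G P e c draw next F i B Inv) {s : σ} (hs : Inv s)
    (hc : c s = false) (n : ℕ) : loopRun G P (n + 1) (e s) = 0 := by
  obtain ⟨t, ht, hG⟩ := h.guard s hs
  rw [loopRun, hG, Measure.dirac_bind (Outcome.measurable _)]
  simp [hc]

theorem run_succ (h : CallLoop G P e c draw next F i B Inv) {s : σ} (hs : Inv s)
    (hc : c s = true) : ∃ t ≤ B, ∀ n, loopRun G P (n + 1) (e s) =
      (draw s).bind fun o => (loopRun G P n (e (next s o))).map fun x =>
        (⟨.int 1, t, 0⟩ : Outcome ι).after ((F s o).after x) := by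
  obtain ⟨t, ht, hG⟩ := h.guard s hs
  refine ⟨t, ht, fun n => ?_⟩
  rw [loopRun, hG, Measure.dirac_bind (Outcome.measurable _)]
  simp only [hc, if_true]
  rw [if_neg (by simp), h.body s hs hc, bind_map_outcome]
  simp only [h.val s _ hs]

/-- The runs with exactly `n` rounds. -/
theorem ae_run (h : CallLoop G P e c draw next F i B Inv) (n : ℕ) {s : σ} (hs : Inv s) :
    ∀ᵐ x ∂loopRun G P n (e s), (∃ s', x.val = e s' ∧ Inv s' ∧ c s' = false) ∧ x.calls = n • i ∧
      x.time ≤ (n + 1) * (2 * B + 3) := by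
  induction n generalizing s with
  | zero =>
    obtain ⟨t, ht, h0⟩ := h.run_zero hs
    rw [h0]
    split_ifs with hc
    · simp
    · rw [ae_dirac_iff (Outcome.measurableSet _)]
      exact ⟨⟨s, rfl, hs, by simpa using hc⟩, by simp, by simp; omega⟩
  | succ n ih =>
    cases hc : c s with
    | false => rw [h.run_succ_of_false hs hc]; simp
    | true =>
      obtain ⟨t, ht, h1⟩ := h.run_succ hs hc
      rw [h1, ae_bind_iff]
      filter_upwards [h.inv s hs hc] with o ho
      rw [ae_map_outcome_iff]
      filter_upwards [ih ho.1] with x hx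
      obtain ⟨hx1, hx2, hx3⟩ := hx
      refine ⟨hx1, ?_, ?_⟩
      · simp only [Outcome.after, hx2, h.calls s o hs, zero_add]
        rw [succ_nsmul']
      · have := ho.2
        simp only [Outcome.after]
        nlinarith

/-- A quantity that does not increase in expectation bounds the expectation at the end. -/
theorem lintegral_le (h : CallLoop G P e c draw next F i B Inv) {ψ : σ → ℝ≥0∞} {g : Val → ℝ≥0∞}
    (hψ : ∀ s, Inv s → c s = true → ∫⁻ o, ψ (next s o) ∂draw s ≤ ψ s)
    (hg : ∀ s, Inv s → c s = false → g (e s) ≤ ψ s) {s : σ} (hs : Inv s) :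
    ∫⁻ x, g x.val ∂Measure.sum (fun n => loopRun G P n (e s)) ≤ ψ s := by
  have key : ∀ N, ∀ s, Inv s →
      ∑ n ∈ Finset.range N, ∫⁻ x, g x.val ∂loopRun G P n (e s) ≤ ψ s := by
    intro N
    induction N with
    | zero => simp
    | succ N ih =>
      intro s hs
      rw [Finset.sum_range_succ']
      obtain ⟨t, ht, h0⟩ := h.run_zero hs
      cases hc : c s with
      | false =>
        simp only [h.run_succ_of_false hs hc, h0, hc, lintegral_zero_measure, Finset.sum_const_zero,
          zero_add, Bool.false_eq_true, if_false]
        rw [lintegral_dirac' _ (Outcome.measurable _)]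
        exact hg s hs hc
      | true =>
        obtain ⟨t, ht, h1⟩ := h.run_succ hs hc
        simp only [h1, h0, hc, if_true, lintegral_zero_measure, add_zero, lintegral_bind_outcome,
          lintegral_map_outcome, Outcome.after]
        rw [← lintegral_finsetSum _ fun n _ => Outcome.measurable _]
        refine le_trans (lintegral_mono_ae ?_) (hψ s hs hc)
        filter_upwards [h.inv s hs hc] with o ho
        exact ih _ ho.1
  rw [lintegral_sum_measure]
  exact ENNReal.tsum_le_of_sum_range_le fun N => key N s hs

/-- If a potential that is at least `1` decreases by the factor `r` in expectation, then all but
`r ^ N` times its initial value of the probability is on runs of fewer than `N` rounds. -/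
theorem one_le_sum_add (h : CallLoop G P e c draw next F i B Inv) {Φ : σ → ℝ≥0∞} {r : ℝ≥0∞}
    (h1 : ∀ s, 1 ≤ Φ s)
    (hΦ : ∀ s, Inv s → c s = true → ∫⁻ o, Φ (next s o) ∂draw s ≤ r * Φ s) (N : ℕ) {s : σ}
    (hs : Inv s) :
    1 ≤ ∑ n ∈ Finset.range N, loopRun G P n (e s) Set.univ + r ^ N * Φ s := by
  induction N generalizing s with
  | zero => simpa using h1 s
  | succ N ih =>
    rw [Finset.sum_range_succ']
    obtain ⟨t, ht, h0⟩ := h.run_zero hs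
    cases hc : c s with
    | false =>
      rw [h0, hc, if_neg (by simp), measure_univ]
      exact le_add_right le_add_self
    | true =>
      obtain ⟨t, ht, h2⟩ := h.run_succ hs hc
      simp only [h2, h0, hc, if_true, bind_univ_outcome, map_univ_outcome]
      calc (1 : ℝ≥0∞) = ∫⁻ o, 1 ∂draw s := by rw [lintegral_one, h.univ s hs hc]
        _ ≤ ∫⁻ o, (∑ n ∈ Finset.range N, loopRun G P n (e (next s o)) Set.univ +
              r ^ N * Φ (next s o)) ∂draw s := by
            refine lintegral_mono_ae ?_
            filter_upwards [h.inv s hs hc] with o ho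
            exact ih ho.1
        _ = ∑ n ∈ Finset.range N, ∫⁻ o, loopRun G P n (e (next s o)) Set.univ ∂draw s +
              r ^ N * ∫⁻ o, Φ (next s o) ∂draw s := by
            rw [lintegral_add_left (Outcome.measurable _),
              lintegral_finsetSum _ fun n _ => Outcome.measurable _,
              lintegral_const_mul _ (Outcome.measurable _)]
        _ ≤ _ := by
            rw [pow_succ, mul_assoc]
            simp only [Measure.coe_zero, Pi.zero_apply, add_zero]
            gcongr
            exact hΦ s hs hc

theorem univ_eq_one (h : CallLoop G P e c draw next F i B Inv) {Φ : σ → ℝ≥0∞} {r : ℝ≥0∞}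
    (h1 : ∀ s, 1 ≤ Φ s) (hr : r < 1) (hfin : ∀ s, Φ s ≠ ∞)
    (hΦ : ∀ s, Inv s → c s = true → ∫⁻ o, Φ (next s o) ∂draw s ≤ r * Φ s) {s : σ} (hs : Inv s) :
    Measure.sum (fun n => loopRun G P n (e s)) Set.univ = 1 := by
  apply le_antisymm
  · have := h.lintegral_le (ψ := fun _ => 1) (g := fun _ => 1)
      (fun s hs hc => by rw [lintegral_one, h.univ s hs hc]) (fun _ _ _ => le_rfl) hs
    rwa [lintegral_one] at this
  · rw [Measure.sum_apply _ MeasurableSet.univ]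
    have hlim : Filter.Tendsto (fun N : ℕ => (∑' n, loopRun G P n (e s) Set.univ) + r ^ N * Φ s)
        Filter.atTop (nhds ((∑' n, loopRun G P n (e s) Set.univ) + 0 * Φ s)) :=
      (ENNReal.Tendsto.mul_const (ENNReal.tendsto_pow_atTop_nhds_zero_of_lt_one hr)
        (.inr (hfin s))).const_add _
    rw [zero_mul, add_zero] at hlim
    refine ge_of_tendsto' hlim fun N => (h.one_le_sum_add h1 hΦ N hs).trans ?_
    gcongr
    exact ENNReal.sum_le_tsum _

theorem tail_le (h : CallLoop G P e c draw next F i B Inv) {Φ : σ → ℝ≥0∞} {r : ℝ≥0∞}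
    (h1 : ∀ s, 1 ≤ Φ s) (hr : r < 1) (hfin : ∀ s, Φ s ≠ ∞)
    (hΦ : ∀ s, Inv s → c s = true → ∫⁻ o, Φ (next s o) ∂draw s ≤ r * Φ s) {s : σ} (hs : Inv s)
    {j : ι} (hj : i j = 1) (n : ℕ) :
    Measure.sum (fun n => loopRun G P n (e s)) {x | n < x.calls j} ≤ r ^ n * Φ s := by
  set W := Measure.sum (fun n => loopRun G P n (e s)) with hW
  have hu := h.univ_eq_one h1 hr hfin hΦ hs
  have hle : ∑ k ∈ Finset.range n, loopRun G P k (e s) Set.univ ≤ W {x | n < x.calls j}ᶜ := by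
    rw [hW, Measure.sum_apply _ (Outcome.measurableSet _)]
    refine le_trans (Finset.sum_le_sum fun k hk => ?_) (ENNReal.sum_le_tsum (Finset.range n))
    refine measure_mono_ae ?_
    filter_upwards [h.ae_run k hs] with x hx _
    rw [Finset.mem_range] at hk
    change ¬ (n < x.calls j)
    rw [hx.2.1]
    simp [hj]
    omega
  have h2 := h.one_le_sum_add h1 hΦ n hs
  have h3 : W {x | n < x.calls j} + W {x | n < x.calls j}ᶜ = 1 := by
    rw [measure_add_measure_compl (Outcome.measurableSet _)]; exact hu
  have hfin' : W {x | n < x.calls j}ᶜ ≠ ∞ := by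
    refine ne_top_of_le_ne_top ENNReal.one_ne_top ?_
    rw [← h3]
    exact le_add_self
  refine (ENNReal.add_le_add_iff_right hfin').1 ?_
  rw [h3]
  calc (1 : ℝ≥0∞) ≤ _ := h2
    _ ≤ W {x | n < x.calls j}ᶜ + r ^ n * Φ s := by gcongr
    _ = _ := add_comm _ _

/-- The number of rounds is determined by the recorded calls, and the time is bounded in terms of
it. -/
theorem ae_sum (h : CallLoop G P e c draw next F i B Inv) {s : σ} (hs : Inv s) :
    ∀ᵐ x ∂Measure.sum (fun n => loopRun G P n (e s)),
      (∃ s', x.val = e s' ∧ Inv s' ∧ c s' = false) ∧ ∃ n : ℕ, x.calls = n • i ∧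
      x.time ≤ (n + 1) * (2 * B + 3) := by
  rw [Measure.ae_sum_iff]
  intro n
  filter_upwards [h.ae_run n hs] with x hx
  exact ⟨hx.1, n, hx.2⟩

end CallLoop

section callProg
variable {σ β : Type} [Code σ] [Code β]

/-- A program that computes an argument from the current state, calls a subroutine and updates the
state with the result. -/
theorem exists_call_body (i : Subroutine) {query : σ → β} {upd : σ × Val → σ} (hq : PT query)
    (hu : PT upd) : ∃ (body : Prog Subroutine) (T : Polynomial ℕ),
      ∀ (sub : Subroutine → Val → Measure (Outcome Empty)) (s : σ),
        ∃ F : Outcome Empty → Outcome Subroutine,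
          body.runWith sub (enc s) = (sub i (enc (query s))).map F ∧
          ∀ o, (F o).val = enc (upd (s, o.val)) ∧ (F o).calls = Pi.single i 1 ∧
            (F o).time ≤ T.eval (esize s + o.time + o.val.size) := by
  obtain ⟨p, T, hp⟩ := hq
  obtain ⟨q, U, hq⟩ := hu
  refine ⟨.seq (.fork (.op .ident) (.seq p (.call i))) q,
    (.X ^ 2 + .X) + (T + .X + T) + U.comp (.X + 1) + .X + 5, fun sub s => ?_⟩
  obtain ⟨t, ht, h1⟩ := (hp s).2 sub
  choose u hu h2 using fun o : Outcome Empty => (hq (s, o.val)).2 sub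
  let a : Outcome Subroutine := ⟨enc s, esize s ^ 2 + esize s, 0⟩
  let b : Outcome Empty → Outcome Subroutine := fun o =>
    (⟨enc (query s), t, 0⟩ : Outcome Subroutine).after
      ⟨o.val, o.time + esize (query s) + o.val.size, Pi.single i 1⟩
  let d : Outcome Empty → Outcome Subroutine := fun o =>
    a.after ⟨.pair a.val (b o).val, (b o).time, (b o).calls⟩
  refine ⟨fun o => (d o).after ⟨enc (upd (s, o.val)), u o, 0⟩, ?_, fun o => ⟨rfl, ?_, ?_⟩⟩
  · have e1 : (Prog.seq p (.call i)).runWith sub (enc s) = (sub i (enc (query s))).map b := by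
      rw [Prog.runWith, h1, Measure.dirac_bind (Outcome.measurable _), runWith_call,
        Measure.map_map (Outcome.measurable _) (Outcome.measurable _)]
      rfl
    have e2 : (Prog.fork (.op .ident) (.seq p (.call i))).runWith sub (enc s) =
        (sub i (enc (query s))).map d := by
      rw [Prog.runWith, e1, Prog.runWith, Measure.dirac_bind (Outcome.measurable _),
        Measure.map_map (Outcome.measurable _) (Outcome.measurable _)]
      rfl
    rw [Prog.runWith, e2, bind_map_outcome, ← Measure.bind_dirac_eq_map _ (Outcome.measurable _)]
    congr 1
    funext o
    have e3 : (d o).val = enc (s, o.val) := rfl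
    rw [e3, h2, Measure.map_dirac' (Outcome.measurable _)]
  · simp [d, a, b, Outcome.after]
  · have hsz := (hp s).1
    have e1 := hu o
    rw [esize_prod, esize_val] at e1
    simp only [d, a, b, Outcome.after]
    set N := esize s + o.time + o.val.size with hN
    have e2 : U.eval (esize s + o.val.size + 1) ≤ U.eval (N + 1) :=
      polynomial_eval_mono U (by omega)
    have e3 : T.eval (esize s) ≤ T.eval N := polynomial_eval_mono T (by omega)
    have e4 : esize s ^ 2 ≤ N ^ 2 := Nat.pow_le_pow_left (by omega) 2
    simp only [Polynomial.eval_add, Polynomial.eval_pow, Polynomial.eval_X, Polynomial.eval_comp,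
      Polynomial.eval_one, Polynomial.eval_ofNat]
    have e5 : esize (s, o.val).1 + esize (s, o.val).2 + 1 = esize s + o.val.size + 1 := rfl
    dsimp only at e1
    omega

end callProg

/-! ### The output of a program with bounded running time is not too long -/

/-- Structural induction on programs, with the case of the `while` loop named `loop`. -/
theorem Prog.induction {ι : Type} {motive : Prog ι → Prop} (op : ∀ o, motive (.op o))
    (coin : motive .coin) (seq : ∀ p q, motive p → motive q → motive (.seq p q))
    (fork : ∀ p q, motive p → motive q → motive (.fork p q))
    (ite : ∀ g p q, motive g → motive p → motive q → motive (.ite g p q))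
    (loop : ∀ g p, motive g → motive p → motive (.while g p)) (call : ∀ i, motive (.call i))
    (p : Prog ι) : motive p :=
  Prog.rec op coin seq fork ite loop call p

theorem Val.finite_size_le (n : ℕ) : {v : Val | v.size ≤ n}.Finite := by
  induction n with
  | zero =>
    refine Set.Finite.subset Set.finite_empty fun v hv => ?_
    have := v.size_pos
    have : v.size ≤ 0 := hv
    omega
  | succ n ih =>
    have h1 : (Set.range fun z : Set.Icc (-(2 ^ n : ℤ)) (2 ^ n) => Val.int z).Finite :=
      Set.finite_range _
    refine (h1.union (ih.image2 Val.pair ih)).subset fun v hv => ?_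
    rcases v with z | ⟨a, b⟩
    · left
      have hv : z.natAbs.size + 1 ≤ n + 1 := hv
      have h2 : z.natAbs < 2 ^ n := Nat.size_le.1 (by omega)
      refine ⟨⟨z, ?_, ?_⟩, rfl⟩
      · zify at h2
        have := neg_abs_le z
        omega
      · zify at h2
        have := le_abs_self z
        omega
    · right
      have hv : a.size + b.size + 1 ≤ n + 1 := hv
      exact ⟨a, show a.size ≤ n by omega, b, show b.size ≤ n by omega, rfl⟩

instance : Countable Val := by
  have : (⋃ n, {v : Val | v.size ≤ n}) = Set.univ := by
    ext v
    simpa using ⟨v.size, le_rfl⟩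
  exact Set.countable_univ_iff.1
    (this ▸ Set.countable_iUnion fun n => (Val.finite_size_le n).countable)

instance : Countable (Outcome Empty) := by
  have : Function.Injective fun o : Outcome Empty => (o.val, o.time) := by
    rintro ⟨v, t, c⟩ ⟨v', t', c'⟩ h
    obtain ⟨rfl, rfl⟩ := Prod.ext_iff.1 h
    congr 1
    exact Subsingleton.elim _ _
  exact this.countable

section poss

/-- The outcome `o` has positive probability.  As there are only countably many outcomes,
statements that hold almost surely are statements about all possible outcomes. -/
def Poss (μ : Measure (Outcome Empty)) (o : Outcome Empty) : Prop := μ {o} ≠ 0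

theorem ae_iff_poss {μ : Measure (Outcome Empty)} {p : Outcome Empty → Prop} :
    (∀ᵐ o ∂μ, p o) ↔ ∀ o, Poss μ o → p o := ae_iff_of_countable

theorem poss_dirac {o o' : Outcome Empty} : Poss (Measure.dirac o) o' ↔ o' = o := by
  rw [Poss, Measure.dirac_apply' _ (Outcome.measurableSet _)]
  by_cases h : o = o' <;> simp [h, eq_comm]

theorem not_poss_zero {o : Outcome Empty} : ¬ Poss 0 o := by simp [Poss]

theorem poss_bind {μ : Measure (Outcome Empty)} {f : Outcome Empty → Measure (Outcome Empty)}
    {o : Outcome Empty} : Poss (μ.bind f) o ↔ ∃ a, Poss μ a ∧ Poss (f a) o := by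
  have h : (∀ᵐ x ∂μ.bind f, x ≠ o) ↔ ∀ a, Poss μ a → ∀ x, Poss (f a) x → x ≠ o := by
    rw [ae_bind_iff, ae_iff_poss]
    simp only [ae_iff_poss]
  rw [ae_iff_poss] at h
  constructor
  · intro ho
    by_contra! hn
    exact h.2 (fun a ha x hx hxo => hn a ha (hxo ▸ hx)) o ho rfl
  · rintro ⟨a, ha, hb⟩
    by_contra hn
    exact h.1 (fun x hx hxo => hn (hxo ▸ hx)) a ha o hb rfl

theorem poss_map {μ : Measure (Outcome Empty)} {f : Outcome Empty → Outcome Empty}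
    {o : Outcome Empty} : Poss (μ.map f) o ↔ ∃ a, Poss μ a ∧ o = f a := by
  rw [← Measure.bind_dirac_eq_map _ (Outcome.measurable _), poss_bind]
  simp only [poss_dirac]

theorem poss_sum {μ : ℕ → Measure (Outcome Empty)} {o : Outcome Empty} :
    Poss (Measure.sum μ) o ↔ ∃ n, Poss (μ n) o := by
  rw [Poss, Measure.sum_apply _ (Outcome.measurableSet _), ne_eq, ENNReal.tsum_eq_zero]
  push Not
  rfl

theorem exists_poss {μ : Measure (Outcome Empty)} (h : μ Set.univ ≠ 0) : ∃ o, Poss μ o := by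
  by_contra! hn
  have : ∀ᵐ o ∂μ, False := ae_iff_poss.2 hn
  rw [ae_iff] at this
  exact h (by simpa using this)

theorem poss_loopRun_zero {G P : Val → Measure (Outcome Empty)} {v : Val} {o : Outcome Empty} :
    Poss (loopRun G P 0 v) o ↔
      ∃ a, Poss (G v) a ∧ a.val = .int 0 ∧ o = ⟨v, a.time + 1, a.calls⟩ := by
  rw [loopRun, poss_bind]
  refine exists_congr fun a => and_congr_right fun _ => ?_
  split_ifs with h
  · simp [poss_dirac, h]
  · simp [not_poss_zero, h]

theorem poss_loopRun_succ {G P : Val → Measure (Outcome Empty)} {n : ℕ} {v : Val}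
    {o : Outcome Empty} : Poss (loopRun G P (n + 1) v) o ↔ ∃ a b o', Poss (G v) a ∧ a.val ≠ .int 0 ∧
      Poss (P v) b ∧ Poss (loopRun G P n b.val) o' ∧ o = a.after (b.after o') := by
  rw [loopRun, poss_bind]
  refine exists_congr fun a => ?_
  split_ifs with h
  · simp [not_poss_zero, h]
  · simp only [poss_bind, poss_map, h, ne_eq, not_false_eq_true, true_and]
    constructor
    · rintro ⟨h1, b, h2, o', h3, h4⟩
      exact ⟨b, o', h1, h2, h3, h4⟩
    · rintro ⟨b, o', h1, h2, h3, h4⟩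
      exact ⟨h1, b, h2, o', h3, h4⟩

end poss

section mass

theorem sum_loopRun_univ_le_one {G P : Val → Measure (Outcome Empty)}
    (hG : ∀ v, G v Set.univ ≤ 1) (hP : ∀ v, P v Set.univ ≤ 1) (v : Val) :
    Measure.sum (fun n => loopRun G P n v) Set.univ ≤ 1 := by
  rw [Measure.sum_apply _ MeasurableSet.univ]
  refine ENNReal.tsum_le_of_sum_range_le fun N => ?_
  induction N generalizing v with
  | zero => simp
  | succ N ih =>
    rw [Finset.sum_range_succ']
    simp only [loopRun, bind_univ_outcome]
    rw [← lintegral_finsetSum _ fun n _ => Outcome.measurable _,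
      ← lintegral_add_left (Outcome.measurable _)]
    calc _ ≤ ∫⁻ _, 1 ∂G v := by
          refine lintegral_mono fun a => ?_
          by_cases h : a.val = .int 0
          · simp [h]
          · simp only [h, if_false, Measure.coe_zero, Pi.zero_apply, add_zero, bind_univ_outcome,
              map_univ_outcome]
            rw [← lintegral_finsetSum _ fun n _ => Outcome.measurable _]
            calc _ ≤ ∫⁻ _, 1 ∂P v := lintegral_mono fun b => ih b.val
              _ ≤ 1 := by rw [lintegral_one]; exact hP v
      _ ≤ 1 := by rw [lintegral_one]; exact hG v

theorem sum_loopRun_univ {G P : Val → Measure (Outcome Empty)} (v : Val) :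
    Measure.sum (fun n => loopRun G P n v) Set.univ =
      ∫⁻ a, (if a.val = .int 0 then 1 else
        ∫⁻ b, Measure.sum (fun n => loopRun G P n b.val) Set.univ ∂P v) ∂G v := by
  have hs : ∀ v, Measure.sum (fun n => loopRun G P n v) Set.univ =
      ∑' n, loopRun G P n v Set.univ := fun v => Measure.sum_apply _ MeasurableSet.univ
  simp only [hs]
  rw [tsum_eq_zero_add' ENNReal.summable]
  simp only [loopRun, bind_univ_outcome]
  rw [← lintegral_tsum fun n => (Outcome.measurable _).aemeasurable,
    ← lintegral_add_left (Outcome.measurable _)]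
  refine lintegral_congr fun a => ?_
  by_cases h : a.val = .int 0
  · simp [h]
  · simp only [h, if_false, Measure.coe_zero, Pi.zero_apply, zero_add, bind_univ_outcome,
      map_univ_outcome]
    rw [lintegral_tsum fun n => (Outcome.measurable _).aemeasurable]

/-- An integral of a function bounded by `1` over a subprobability can be `1` only if the function
is `1` wherever possible. -/
theorem eq_one_of_lintegral_eq_one {μ : Measure (Outcome Empty)} {f : Outcome Empty → ℝ≥0∞}
    (hμ : μ Set.univ ≤ 1) (hf : ∀ a, f a ≤ 1) (h : ∫⁻ a, f a ∂μ = 1) :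
    μ Set.univ = 1 ∧ ∀ a, Poss μ a → f a = 1 := by
  have h1 : μ Set.univ = 1 := by
    refine le_antisymm hμ ?_
    rw [← h, ← lintegral_one]
    exact lintegral_mono hf
  refine ⟨h1, ae_iff_poss.1 ?_⟩
  have h2 : ∫⁻ a, (1 - f a) ∂μ = 0 := by
    rw [lintegral_sub (Outcome.measurable _) (by simp [h]) (ae_of_all _ hf), h, lintegral_one, h1,
      tsub_self]
  rw [lintegral_eq_zero_iff (Outcome.measurable _)] at h2
  filter_upwards [h2] with a ha
  exact le_antisymm (hf a) (tsub_eq_zero_iff_le.1 ha)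

theorem run_univ_le_one (p : Prog Empty) (v : Val) : p.run v Set.univ ≤ 1 := by
  have hb : ∀ {μ : Measure (Outcome Empty)} {f : Outcome Empty → Measure (Outcome Empty)},
      μ Set.univ ≤ 1 → (∀ a, f a Set.univ ≤ 1) → μ.bind f Set.univ ≤ 1 := by
    intro μ f hμ hf
    rw [bind_univ_outcome]
    calc _ ≤ ∫⁻ _, 1 ∂μ := lintegral_mono hf
      _ ≤ 1 := by rwa [lintegral_one]
  unfold Prog.run
  induction p using Prog.induction generalizing v with
  | op o => simp [Prog.runWith]
  | coin =>
    simp only [Prog.runWith, Measure.coe_add, Measure.coe_smul, Pi.add_apply, Pi.smul_apply,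
      measure_univ, smul_eq_mul, mul_one]
    rw [ENNReal.inv_two_add_inv_two]
  | seq p q hp hq =>
    rw [Prog.runWith]
    exact hb (hp v) fun a => by rw [map_univ_outcome]; exact hq _
  | fork p q hp hq =>
    rw [Prog.runWith]
    exact hb (hp v) fun a => by rw [map_univ_outcome]; exact hq _
  | ite g p q hg hp hq =>
    rw [Prog.runWith]
    exact hb (hg v) fun a => by
      rw [map_univ_outcome]
      split_ifs
      · exact hq v
      · exact hp v
  | loop g p hg hp =>
    rw [Prog.runWith]
    exact sum_loopRun_univ_le_one hg hp v
  | call i => exact i.elim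

end mass

section oblivious

/-- A transformation that copies its argument a fixed number of times into a fixed frame: it is
constant or does not shrink its argument, and whether its value is `0` depends only on whether the
argument is `0`. -/
structure IsFrame (F : Val → Val) : Prop where
  const_or_le : (∀ v v', F v = F v') ∨ ∀ v, v.size ≤ (F v).size
  zero_iff : ∀ v v', (v = .int 0 ↔ v' = .int 0) → (F v = .int 0 ↔ F v' = .int 0)

theorem IsFrame.const (w : Val) : IsFrame fun _ => w := ⟨.inl fun _ _ => rfl, fun _ _ _ => Iff.rfl⟩

theorem IsFrame.id : IsFrame fun v => v := ⟨.inr fun _ => le_rfl, fun _ _ h => h⟩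

theorem IsFrame.pair {F H : Val → Val} (hF : IsFrame F) (hH : IsFrame H) :
    IsFrame fun v => .pair (F v) (H v) where
  const_or_le := by
    rcases hF.const_or_le with h | h
    · rcases hH.const_or_le with h' | h'
      · exact .inl fun v v' => by rw [h v v', h' v v']
      · refine .inr fun v => ?_
        have := h' v
        simp only [Val.size]; omega
    · refine .inr fun v => ?_
      have := h v
      simp only [Val.size]; omega
  zero_iff := by simp

theorem IsFrame.comp {F H : Val → Val} (hF : IsFrame F) (hH : IsFrame H) :
    IsFrame fun v => H (F v) where
  const_or_le := by
    rcases hH.const_or_le with h' | h'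
    · exact .inl fun v v' => h' _ _
    · rcases hF.const_or_le with h | h
      · exact .inl fun v v' => by rw [h v v']
      · exact .inr fun v => (h v).trans (h' _)
  zero_iff := fun v v' h => hH.zero_iff _ _ (hF.zero_iff _ _ h)

/-- The passage from `v` to `w` along the relation `S` does not depend on the details of `v`: it is
the insertion of `v` into a frame, and any other datum may be inserted as well, if only it agrees
with `v` in being `0` or not. -/
def Oblivious (S : Val → Val → Prop) (v w : Val) : Prop :=
  ∃ F, IsFrame F ∧ w = F v ∧ ∀ v', (v = .int 0 ↔ v' = .int 0) → S v' (F v')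

/-- If the first of two steps is oblivious, and the second one takes at least as long as the size of
its input or is oblivious, then the same dichotomy holds for the composition: if the frame of the
first step is constant, then the second step does not see `v` at all, and otherwise it reads at
least the size of `v`. -/
theorem Oblivious.comp {S T U : Val → Val → Prop} {v w x : Val} {t : ℕ} (h : Oblivious S v w)
    (hx : T w x) (h' : w.size ≤ t ∨ Oblivious T w x)
    (hU : ∀ v w x, S v w → T w x → U v x) : v.size ≤ t ∨ Oblivious U v x := by
  obtain ⟨F, hF, rfl, h1⟩ := h
  rcases hF.const_or_le with hc | hle
  · refine .inr ⟨fun _ => x, .const x, rfl, fun v' hv' => hU _ _ _ (h1 v' hv') ?_⟩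
    rwa [hc v' v]
  · rcases h' with h' | ⟨H, hH, rfl, h2⟩
    · exact .inl ((hle v).trans h')
    · exact .inr ⟨fun v => H (F v), hF.comp hH, rfl, fun v' hv' =>
        hU _ _ _ (h1 v' hv') (h2 _ (hF.zero_iff _ _ hv'))⟩

/-- The relation between the inputs and the possible outputs of a program. -/
def Out (p : Prog Empty) (v w : Val) : Prop := ∃ o, Poss (p.run v) o ∧ o.val = w

theorem poss_seq {p q : Prog Empty} {v : Val} {o : Outcome Empty} : Poss ((Prog.seq p q).run v) o ↔
    ∃ a, Poss (p.run v) a ∧ ∃ b, Poss (q.run a.val) b ∧ o = a.after b := by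
  rw [Prog.run, Prog.runWith, poss_bind]
  simp only [poss_map]
  rfl

theorem poss_fork {p q : Prog Empty} {v : Val} {o : Outcome Empty} :
    Poss ((Prog.fork p q).run v) o ↔ ∃ a, Poss (p.run v) a ∧ ∃ b, Poss (q.run v) b ∧
      o = a.after ⟨.pair a.val b.val, b.time, b.calls⟩ := by
  rw [Prog.run, Prog.runWith, poss_bind]
  simp only [poss_map]
  rfl

theorem poss_ite {g p q : Prog Empty} {v : Val} {o : Outcome Empty} :
    Poss ((Prog.ite g p q).run v) o ↔ ∃ a, Poss (g.run v) a ∧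
      ∃ b, Poss ((if a.val = .int 0 then q else p).run v) b ∧ o = a.after b := by
  rw [Prog.run, Prog.runWith, poss_bind]
  refine exists_congr fun a => and_congr_right fun _ => ?_
  split_ifs <;> rw [poss_map] <;> rfl

theorem poss_while {g p : Prog Empty} {v : Val} {o : Outcome Empty} :
    Poss ((Prog.while g p).run v) o ↔ ∃ n, Poss (loopRun g.run p.run n v) o := by
  rw [Prog.run, Prog.runWith, poss_sum]
  rfl

/-- In any possible run, either the time is at least the size of the input, or the run does not
depend on the details of the input. -/
theorem size_le_or_oblivious (p : Prog Empty) (v : Val) (o : Outcome Empty)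
    (h : Poss (p.run v) o) : v.size ≤ o.time ∨ Oblivious (Out p) v o.val := by
  induction p using Prog.induction generalizing v o with
  | op f =>
    left
    rw [Prog.run, Prog.runWith, poss_dirac] at h
    rw [h]
    have := Nat.le_self_pow two_ne_zero v.size
    simp only
    omega
  | coin =>
    right
    exact ⟨fun _ => o.val, .const _, rfl, fun v' _ => ⟨o, h, rfl⟩⟩
  | seq p q hp hq =>
    obtain ⟨a, ha, b, hb, rfl⟩ := poss_seq.1 h
    simp only [Outcome.after]
    rcases hp v a ha with h1 | h1
    · left; omega
    · rcases h1.comp (T := Out q) (U := Out (.seq p q)) ⟨b, hb, rfl⟩ (hq a.val b hb) (by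
        rintro v w x ⟨a, ha, rfl⟩ ⟨b, hb, rfl⟩
        exact ⟨_, poss_seq.2 ⟨a, ha, b, hb, rfl⟩, rfl⟩) with h2 | h2
      · left; omega
      · exact .inr h2
  | fork p q hp hq =>
    obtain ⟨a, ha, b, hb, rfl⟩ := poss_fork.1 h
    simp only [Outcome.after]
    rcases hp v a ha with h1 | ⟨F, hF, e1, h1⟩
    · left; omega
    rcases hq v b hb with h2 | ⟨H, hH, e2, h2⟩
    · left; omega
    refine .inr ⟨_, hF.pair hH, by rw [e1, e2], fun v' hv' => ?_⟩
    obtain ⟨a', ha', e1'⟩ := h1 v' hv'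
    obtain ⟨b', hb', e2'⟩ := h2 v' hv'
    exact ⟨_, poss_fork.2 ⟨a', ha', b', hb', rfl⟩, by rw [← e1', ← e2']; rfl⟩
  | ite g p q hg hp hq =>
    obtain ⟨a, ha, b, hb, rfl⟩ := poss_ite.1 h
    simp only [Outcome.after]
    rcases hg v a ha with h1 | ⟨F, hF, e1, h1⟩
    · left; omega
    have h2 : v.size ≤ b.time ∨ Oblivious (Out (if a.val = .int 0 then q else p)) v b.val := by
      split_ifs at hb ⊢
      · exact hq v b hb
      · exact hp v b hb
    rcases h2 with h2 | ⟨H, hH, e2, h2⟩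
    · left; omega
    refine .inr ⟨_, hH, e2, fun v' hv' => ?_⟩
    obtain ⟨a', ha', e1'⟩ := h1 v' hv'
    obtain ⟨b', hb', e2'⟩ := h2 v' hv'
    refine ⟨a'.after b', poss_ite.2 ⟨a', ha', b', ?_, rfl⟩, e2'⟩
    have : a.val = .int 0 ↔ a'.val = .int 0 := by rw [e1, e1']; exact hF.zero_iff _ _ hv'
    simpa only [this] using hb'
  | loop g p hg hp =>
    obtain ⟨n, hn⟩ := poss_while.1 h
    let S : ℕ → Val → Val → Prop := fun n v w => ∃ o, Poss (loopRun g.run p.run n v) o ∧ o.val = w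
    suffices key : v.size ≤ o.time ∨ Oblivious (S n) v o.val by
      rcases key with h1 | ⟨F, hF, e1, h1⟩
      · exact .inl h1
      · refine .inr ⟨F, hF, e1, fun v' hv' => ?_⟩
        obtain ⟨o', ho', e⟩ := h1 v' hv'
        exact ⟨o', poss_while.2 ⟨n, ho'⟩, e⟩
    clear h
    induction n generalizing v o with
    | zero =>
      obtain ⟨a, ha, h0, rfl⟩ := poss_loopRun_zero.1 hn
      rcases hg v a ha with h1 | ⟨F, hF, e1, h1⟩
      · exact .inl (by simp only; omega)
      refine .inr ⟨_, .id, rfl, fun v' hv' => ?_⟩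
      obtain ⟨a', ha', e1'⟩ := h1 v' hv'
      refine ⟨_, poss_loopRun_zero.2 ⟨a', ha', ?_, rfl⟩, rfl⟩
      rw [e1', ← hF.zero_iff v v' hv', ← e1, h0]
    | succ n ih =>
      obtain ⟨a, b, o', ha, h0, hb, ho', rfl⟩ := poss_loopRun_succ.1 hn
      simp only [Outcome.after]
      rcases hg v a ha with h1 | ⟨F, hF, e1, h1⟩
      · left; omega
      rcases hp v b hb with h2 | ⟨H, hH, e2, h2⟩
      · left; omega
      let T : Val → Val → Prop := fun v w => ∃ a, Poss (g.run v) a ∧ a.val ≠ .int 0 ∧ Out p v w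
      have hT : Oblivious T v b.val := by
        refine ⟨H, hH, e2, fun v' hv' => ?_⟩
        obtain ⟨a', ha', e1'⟩ := h1 v' hv'
        refine ⟨a', ha', ?_, h2 v' hv'⟩
        rw [e1', ne_eq, ← hF.zero_iff v v' hv', ← e1]
        exact h0
      rcases hT.comp (T := S n) (U := S (n + 1)) ⟨o', ho', rfl⟩ (ih _ _ ho') (by
        rintro v w x ⟨a, ha, h0, b, hb, rfl⟩ ⟨o, ho, rfl⟩
        exact ⟨_, poss_loopRun_succ.2 ⟨a, b, o, ha, h0, hb, ho, rfl⟩, rfl⟩) with h3 | h3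
      · left; omega
      · exact .inr h3
  | call i => exact i.elim

end oblivious

section size

/-- The program halts with probability `1` and within time `T`. -/
def HaltsWithin (p : Prog Empty) (v : Val) (T : ℕ) : Prop :=
  p.run v Set.univ = 1 ∧ ∀ o, Poss (p.run v) o → o.time ≤ T

theorem HaltsWithin.bind {p : Prog Empty} {v : Val} {T : ℕ}
    {f : Outcome Empty → Measure (Outcome Empty)} {r : Prog Empty} (h : HaltsWithin r v T)
    (e : r.run v = (p.run v).bind f)
    (hf : ∀ a, f a Set.univ ≤ 1) :
    p.run v Set.univ = 1 ∧ ∀ a, Poss (p.run v) a → f a Set.univ = 1 := by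
  refine eq_one_of_lintegral_eq_one (run_univ_le_one p v) hf ?_
  rw [← bind_univ_outcome, ← e]
  exact h.1

theorem HaltsWithin.seq {p q : Prog Empty} {v : Val} {T : ℕ} (h : HaltsWithin (.seq p q) v T) :
    HaltsWithin p v T ∧ ∀ a, Poss (p.run v) a → HaltsWithin q a.val T := by
  obtain ⟨h1, h2⟩ := h.bind (p := p) (by rw [Prog.run, Prog.runWith]; rfl)
    (fun a => by rw [map_univ_outcome]; exact run_univ_le_one q _)
  simp only [map_univ_outcome] at h2
  have h3 : ∀ a, Poss (p.run v) a → HaltsWithin q a.val T := fun a ha =>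
    ⟨h2 a ha, fun b hb => by
      have := h.2 _ (poss_seq.2 ⟨a, ha, b, hb, rfl⟩)
      simp only [Outcome.after] at this
      omega⟩
  refine ⟨⟨h1, fun a ha => ?_⟩, h3⟩
  obtain ⟨b, hb⟩ := exists_poss (μ := q.run a.val) (by rw [(h3 a ha).1]; exact one_ne_zero)
  have := h.2 _ (poss_seq.2 ⟨a, ha, b, hb, rfl⟩)
  simp only [Outcome.after] at this
  omega

theorem HaltsWithin.fork {p q : Prog Empty} {v : Val} {T : ℕ} (h : HaltsWithin (.fork p q) v T) :
    HaltsWithin p v T ∧ HaltsWithin q v T := by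
  obtain ⟨h1, h2⟩ := h.bind (p := p) (by rw [Prog.run, Prog.runWith]; rfl)
    (fun a => by rw [map_univ_outcome]; exact run_univ_le_one q _)
  simp only [map_univ_outcome] at h2
  obtain ⟨a, ha⟩ := exists_poss (μ := p.run v) (by rw [h1]; exact one_ne_zero)
  have hq : q.run v Set.univ = 1 := h2 a ha
  obtain ⟨b, hb⟩ := exists_poss (μ := q.run v) (by rw [hq]; exact one_ne_zero)
  refine ⟨⟨h1, fun a ha => ?_⟩, ⟨hq, fun b hb => ?_⟩⟩
  · have := h.2 _ (poss_fork.2 ⟨a, ha, b, hb, rfl⟩)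
    simp only [Outcome.after] at this
    omega
  · have := h.2 _ (poss_fork.2 ⟨a, ha, b, hb, rfl⟩)
    simp only [Outcome.after] at this
    omega

theorem HaltsWithin.ite {g p q : Prog Empty} {v : Val} {T : ℕ} (h : HaltsWithin (.ite g p q) v T) :
    ∀ a, Poss (g.run v) a → HaltsWithin (if a.val = .int 0 then q else p) v T := by
  obtain ⟨h1, h2⟩ := h.bind (p := g) (by rw [Prog.run, Prog.runWith]; rfl)
    (fun a => by rw [map_univ_outcome]; split_ifs <;> exact run_univ_le_one _ _)
  simp only [map_univ_outcome] at h2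
  intro a ha
  refine ⟨?_, fun b hb => ?_⟩
  · have := h2 a ha
    split_ifs at this ⊢ <;> exact this
  · have := h.2 _ (poss_ite.2 ⟨a, ha, b, hb, rfl⟩)
    simp only [Outcome.after] at this
    omega

/-- After each further round a loop that halts within bounded time halts within a smaller bound. -/
theorem HaltsWithin.while {g p : Prog Empty} {v : Val} {T : ℕ} (h : HaltsWithin (.while g p) v T)
    {a : Outcome Empty} (ha : Poss (g.run v) a) (ha0 : a.val ≠ .int 0) :
    HaltsWithin p v T ∧ ∀ b, Poss (p.run v) b → ∃ T' < T, HaltsWithin (.while g p) b.val T' := by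
  have hW : ∀ v, (Prog.while g p).run v = Measure.sum fun n => loopRun g.run p.run n v := fun v => by
    rw [Prog.run, Prog.runWith]; rfl
  have hle : ∀ v, Measure.sum (fun n => loopRun g.run p.run n v) Set.univ ≤ 1 :=
    sum_loopRun_univ_le_one (run_univ_le_one g) (run_univ_le_one p)
  have h1 := h.1
  rw [hW, sum_loopRun_univ] at h1
  have h2 := (eq_one_of_lintegral_eq_one (run_univ_le_one g v) (fun a => by
    split_ifs
    · exact le_rfl
    · calc _ ≤ ∫⁻ _, 1 ∂p.run v := lintegral_mono fun b => hle _
        _ ≤ 1 := by rw [lintegral_one]; exact run_univ_le_one p v) h1).2 a ha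
  rw [if_neg ha0] at h2
  obtain ⟨h3, h4⟩ := eq_one_of_lintegral_eq_one (run_univ_le_one p v) (fun b => hle _) h2
  have h5 : ∀ b, Poss (p.run v) b → ∀ o, Poss ((Prog.while g p).run b.val) o →
      a.time + b.time + o.time + 2 ≤ T := by
    intro b hb o ho
    obtain ⟨n, hn⟩ := poss_while.1 ho
    have := h.2 _ (poss_while.2 ⟨n + 1, poss_loopRun_succ.2 ⟨a, b, o, ha, ha0, hb, hn, rfl⟩⟩)
    simp only [Outcome.after] at this
    omega
  have h6 : ∀ b, Poss (p.run v) b → ∃ o, Poss ((Prog.while g p).run b.val) o := fun b hb =>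
    exists_poss (by rw [hW, h4 b hb]; exact one_ne_zero)
  refine ⟨⟨h3, fun b hb => ?_⟩, fun b hb => ?_⟩
  · obtain ⟨o, ho⟩ := h6 b hb
    have := h5 b hb o ho
    omega
  · obtain ⟨o, ho⟩ := h6 b hb
    have := h5 b hb o ho
    refine ⟨T - 2, by omega, by rw [hW]; exact h4 b hb, fun o ho => ?_⟩
    have := h5 b hb o ho
    omega

/-- A loop that can be continued from every state with property `C` to another such state does not
halt within bounded time. -/
theorem not_haltsWithin_while {g p : Prog Empty} {C : Val → Prop}
    (hC : ∀ v, C v → ∃ a b, Poss (g.run v) a ∧ a.val ≠ .int 0 ∧ Poss (p.run v) b ∧ C b.val)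
    (T : ℕ) (v : Val) (hv : C v) : ¬ HaltsWithin (.while g p) v T := by
  induction T using Nat.strong_induction_on generalizing v with
  | _ T ih =>
    intro h
    obtain ⟨a, b, ha, ha0, hb, hCb⟩ := hC v hv
    obtain ⟨T', hT', h'⟩ := (h.while ha ha0).2 b hb
    exact ih T' hT' _ hCb h'

/-- The size of the output is at most linear in the size of the input and the running time, if the
running time is bounded.  (An input that is not read can be duplicated in constant time; the point
is that a loop of bounded length cannot do this in more than one round.) -/
theorem exists_size_le (p : Prog Empty) : ∃ K, ∀ v T, HaltsWithin p v T → ∀ o, Poss (p.run v) o →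
    o.val.size ≤ K * (v.size + o.time) := by
  induction p using Prog.induction with
  | op f =>
    refine ⟨1, fun v T _ o ho => ?_⟩
    rw [Prog.run, Prog.runWith, poss_dirac] at ho
    rw [ho]
    simp only
    omega
  | coin =>
    refine ⟨1, fun v T _ o ho => ?_⟩
    have hv := v.size_pos
    have : ∀ᵐ o ∂(Prog.coin.run v), o.val.size ≤ 2 ∧ o.time = 1 := by
      rw [Prog.run, Prog.runWith, ae_iff]
      simp only [Measure.coe_add, Measure.coe_smul, Pi.add_apply, Pi.smul_apply,
        Measure.dirac_apply' _ (Outcome.measurableSet _)]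
      simp [Val.size]
    have := ae_iff_poss.1 this o ho
    omega
  | seq p q hp hq =>
    obtain ⟨K, hp⟩ := hp
    obtain ⟨M, hq⟩ := hq
    refine ⟨M * (K + 1), fun v T h o ho => ?_⟩
    obtain ⟨h1, h2⟩ := h.seq
    obtain ⟨a, ha, b, hb, rfl⟩ := poss_seq.1 ho
    have e1 := hp v T h1 a ha
    have e2 := hq a.val T (h2 a ha) b hb
    simp only [Outcome.after]
    calc b.val.size ≤ M * (a.val.size + b.time) := e2
      _ ≤ M * (K * (v.size + a.time) + b.time) := by gcongr
      _ ≤ M * ((K + 1) * (v.size + (a.time + b.time + 1))) := by gcongr; nlinarith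
      _ = _ := by ring
  | fork p q hp hq =>
    obtain ⟨K, hp⟩ := hp
    obtain ⟨M, hq⟩ := hq
    refine ⟨K + M + 1, fun v T h o ho => ?_⟩
    obtain ⟨h1, h2⟩ := h.fork
    obtain ⟨a, ha, b, hb, rfl⟩ := poss_fork.1 ho
    have e1 := hp v T h1 a ha
    have e2 := hq v T h2 b hb
    simp only [Outcome.after, Val.size]
    nlinarith
  | ite g p q hg hp hq =>
    obtain ⟨K, hp⟩ := hp
    obtain ⟨M, hq⟩ := hq
    refine ⟨K + M, fun v T h o ho => ?_⟩
    obtain ⟨a, ha, b, hb, rfl⟩ := poss_ite.1 ho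
    have h1 := h.ite a ha
    simp only [Outcome.after]
    split_ifs at h1 hb
    · have := hq v T h1 b hb
      nlinarith
    · have := hp v T h1 b hb
      nlinarith
  | loop g p hg hp =>
    obtain ⟨K, hp⟩ := hp
    refine ⟨2 * K + 1, fun v T h o ho => ?_⟩
    obtain ⟨n, hn⟩ := poss_while.1 ho
    suffices key : o.val.size ≤ max v.size ((2 * K + 1) * (1 + o.time)) by
      have := v.size_pos
      rcases le_max_iff.1 key with h | h <;> nlinarith
    clear ho
    induction n generalizing v T o with
    | zero =>
      obtain ⟨a, ha, h0, rfl⟩ := poss_loopRun_zero.1 hn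
      exact le_max_left _ _
    | succ n ih =>
      obtain ⟨a, b, o', ha, h0, hb, ho', rfl⟩ := poss_loopRun_succ.1 hn
      obtain ⟨h1, h2⟩ := h.while ha h0
      obtain ⟨T', -, h3⟩ := h2 b hb
      have h4 := ih _ _ h3 _ ho'
      have h5 := hp v T h1 b hb
      -- the state after the round is short, or else its size has been paid for
      have h6 : v.size ≤ 1 + a.time + b.time ∨ b.val.size = 1 := by
        by_contra! hcon
        obtain ⟨c1, c2⟩ := hcon
        have hv0 : v ≠ .int 0 := by
          rintro rfl
          simp [Val.size] at c1
        have hb0 : b.val ≠ .int 0 := by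
          intro e
          simp [e, Val.size] at c2
        rcases size_le_or_oblivious g v a ha with d | ⟨F, hF, e1, d1⟩
        · omega
        rcases size_le_or_oblivious p v b hb with d | ⟨H, hH, e2, d2⟩
        · omega
        refine not_haltsWithin_while (C := fun v => v ≠ .int 0) (fun v' hv' => ?_) T v hv0 h
        have hvv : v = .int 0 ↔ v' = .int 0 := by simp [hv0, hv']
        obtain ⟨a', ha', f1⟩ := d1 v' hvv
        obtain ⟨b', hb', f2⟩ := d2 v' hvv
        refine ⟨a', b', ha', ?_, hb', ?_⟩
        · rw [f1, ne_eq, ← hF.zero_iff v v' hvv, ← e1]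
          exact h0
        · rw [f2, ne_eq, ← hH.zero_iff v v' hvv, ← e2]
          exact hb0
      simp only [Outcome.after]
      refine le_max_of_le_right ?_
      have h7 : b.val.size ≤ (2 * K + 1) * (1 + (a.time + (b.time + o'.time + 1) + 1)) := by
        rcases h6 with h6 | h6
        · calc b.val.size ≤ K * (v.size + b.time) := h5
            _ ≤ K * (2 * (1 + (a.time + (b.time + o'.time + 1) + 1))) := by gcongr; omega
            _ ≤ _ := by nlinarith
        · rw [h6]; nlinarith
      rcases le_max_iff.1 h4 with h8 | h8
      · exact h8.trans h7
      · refine h8.trans ?_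
        gcongr
        omega
  | call i => exact i.elim

/-- The length of the output of a program is at most linear in the length of the input and the bound
for the running time. -/
theorem exists_ae_size_le (p : Prog Empty) : ∃ K, ∀ v T, p.run v Set.univ = 1 →
    (∀ᵐ o ∂p.run v, o.time ≤ T) → ∀ᵐ o ∂p.run v, o.val.size ≤ K * (v.size + T) := by
  obtain ⟨K, hK⟩ := exists_size_le p
  refine ⟨K, fun v T h1 h2 => ae_iff_poss.2 fun o ho => ?_⟩
  have h3 := ae_iff_poss.1 h2
  refine (hK v T ⟨h1, h3⟩ o ho).trans ?_
  gcongr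
  exact h3 o ho

end size

/-! ### Aggregation functions as combinations of atomic cost functions -/

section decomposition

/-- The slope of `f` between two consecutive powers of two, and between `0` and `1` in the case
`f 0 = 0`. -/
def dyadicSlope (f : ℝ → ℝ) : ℕ → ℝ
  | 0 => f 1
  | i + 1 => (f (2 ^ (i + 1)) - f (2 ^ i)) / 2 ^ i

/-- The coefficients of the combination of `A₀, …, A_L` that agrees with `f` in `2 ^ i`, `i ≤ L`. -/
def atomicCoeff (f : ℝ → ℝ) (L i : ℕ) : ℝ :=
  dyadicSlope f i - if i < L then dyadicSlope f (i + 1) else 0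

/-- The piecewise linear interpolation of `f` at the powers of two up to `2 ^ L`. -/
def interpolation (f : ℝ → ℝ) (L : ℕ) (x : ℝ) : ℝ :=
  ∑ i ∈ Finset.range (1 + L), atomicCoeff f L i * atomic i x

theorem atomic_apply (i : ℕ) (x : ℝ) : atomic i x = min x (2 ^ i) := by
  simp [atomic, rentOrBuy]

theorem interpolation_succ (f : ℝ → ℝ) (L : ℕ) (x : ℝ) :
    interpolation f (L + 1) x =
      interpolation f L x + dyadicSlope f (L + 1) * (min x (2 ^ (L + 1)) - min x (2 ^ L)) := by
  have h : ∑ i ∈ Finset.range L, atomicCoeff f (L + 1) i * atomic i x =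
      ∑ i ∈ Finset.range L, atomicCoeff f L i * atomic i x := by
    refine Finset.sum_congr rfl fun i hi => ?_
    have := Finset.mem_range.1 hi
    simp [atomicCoeff, this, this.trans (Nat.lt_succ_self L)]
  rw [interpolation, interpolation, add_comm 1, add_comm 1, Finset.sum_range_succ,
    Finset.sum_range_succ, Finset.sum_range_succ, h]
  simp only [atomicCoeff, lt_add_iff_pos_right, zero_lt_one, if_true, lt_irrefl, if_false,
    atomic_apply]
  ring

theorem interpolation_of_le (f : ℝ → ℝ) (L : ℕ) {x : ℝ} (hx : 2 ^ L ≤ x) :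
    interpolation f L x = f (2 ^ L) := by
  induction L with
  | zero =>
    have : min x 1 = 1 := min_eq_right (by simpa using hx)
    simp [interpolation, atomicCoeff, dyadicSlope, atomic_apply, this]
  | succ L ih =>
    have h : (2 : ℝ) ^ L ≤ x := (pow_le_pow_right₀ one_le_two (Nat.le_succ L)).trans hx
    rw [interpolation_succ, ih h, min_eq_right hx, min_eq_right h, dyadicSlope]
    have : (2 : ℝ) ^ L ≠ 0 := by positivity
    field_simp
    ring

namespace IsAggregation
variable {f : ℝ → ℝ}

theorem nonneg (hf : IsAggregation f) {x : ℝ} (hx : 0 ≤ x) : 0 ≤ f x := by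
  have := hf.mono (Set.mem_Ici.2 le_rfl) (Set.mem_Ici.2 hx) hx
  rwa [hf.zero] at this

theorem dyadicSlope_nonneg (hf : IsAggregation f) (i : ℕ) : 0 ≤ dyadicSlope f i := by
  cases i with
  | zero => exact hf.nonneg zero_le_one
  | succ i =>
    refine div_nonneg (sub_nonneg.2 (hf.mono ?_ ?_ ?_)) (by positivity)
    · exact Set.mem_Ici.2 (by positivity)
    · exact Set.mem_Ici.2 (by positivity)
    · exact pow_le_pow_right₀ one_le_two (Nat.le_succ i)

theorem dyadicSlope_succ_le (hf : IsAggregation f) (i : ℕ) :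
    dyadicSlope f (i + 1) ≤ dyadicSlope f i := by
  cases i with
  | zero =>
    have := hf.concave.slope_anti_adjacent (x := 0) (y := 1) (z := 2) (by simp) (by simp)
      (by norm_num) (by norm_num)
    norm_num [dyadicSlope, hf.zero] at this ⊢
    linarith
  | succ i =>
    have h : (0 : ℝ) < 2 ^ i := by positivity
    have := hf.concave.slope_anti_adjacent (x := 2 ^ i) (y := 2 ^ (i + 1)) (z := 2 ^ (i + 2))
      (Set.mem_Ici.2 (by positivity)) (Set.mem_Ici.2 (by positivity))
      (pow_lt_pow_right₀ one_lt_two (Nat.lt_succ_self _))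
      (pow_lt_pow_right₀ one_lt_two (Nat.lt_succ_self _))
    simp only [dyadicSlope]
    rwa [show (2 : ℝ) ^ (i + 2) - 2 ^ (i + 1) = 2 ^ (i + 1) by ring,
      show (2 : ℝ) ^ (i + 1) - 2 ^ i = 2 ^ i by ring] at this

theorem atomicCoeff_nonneg (hf : IsAggregation f) (L i : ℕ) : 0 ≤ atomicCoeff f L i := by
  rw [atomicCoeff]
  split_ifs
  · exact sub_nonneg.2 (hf.dyadicSlope_succ_le i)
  · simpa using hf.dyadicSlope_nonneg i

/-- On `[a, 2 a]` the function `f` lies between the chord and `5 / 4` of it, since it is at most the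
minimum of `f (2 a)` and of the line from the origin through `(a, f a)`. -/
theorem chord_le_and_le (hf : IsAggregation f) {a x : ℝ} (ha : 0 < a) (h1 : a ≤ x)
    (h2 : x ≤ 2 * a) :
    f a + (f (2 * a) - f a) / a * (x - a) ≤ f x ∧
      4 * f x ≤ 5 * (f a + (f (2 * a) - f a) / a * (x - a)) := by
  obtain ⟨u, rfl⟩ : ∃ u, x = u * a := ⟨x / a, by field_simp⟩
  have hu1 : 1 ≤ u := by by_contra! h; nlinarith
  have hu2 : u ≤ 2 := by by_contra! h; nlinarith
  have e : (f (2 * a) - f a) / a * (u * a - a) = (f (2 * a) - f a) * (u - 1) := by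
    field_simp
  rw [e]
  have hconc := hf.concave.2
  have c1 : (2 - u) * f a + (u - 1) * f (2 * a) ≤ f (u * a) := by
    have := hconc (Set.mem_Ici.2 ha.le) (Set.mem_Ici.2 (by linarith : 0 ≤ 2 * a))
      (sub_nonneg.2 hu2) (sub_nonneg.2 hu1) (by ring)
    simp only [smul_eq_mul] at this
    rwa [show (2 - u) * a + (u - 1) * (2 * a) = u * a by ring] at this
  have c2 : ∀ v, 1 ≤ v → f (v * a) ≤ v * f a := by
    intro v hv
    have hv0 : 0 < v := by linarith
    have := hconc (Set.mem_Ici.2 (by positivity : 0 ≤ v * a)) (Set.mem_Ici.2 le_rfl)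
      (inv_nonneg.2 hv0.le) (sub_nonneg.2 (inv_le_one_of_one_le₀ hv)) (by ring)
    simp only [smul_eq_mul, hf.zero, mul_zero, add_zero] at this
    rw [inv_mul_cancel_left₀ hv0.ne', inv_mul_le_iff₀ hv0] at this
    exact this
  have c3 : f (u * a) ≤ f (2 * a) := hf.mono (Set.mem_Ici.2 (by positivity))
    (Set.mem_Ici.2 (by positivity)) h2
  have c4 : f a ≤ f (2 * a) := hf.mono (Set.mem_Ici.2 ha.le) (Set.mem_Ici.2 (by positivity))
    (by linarith)
  have c5 := hf.nonneg ha.le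
  have c6 := c2 u hu1
  refine ⟨by linarith, ?_⟩
  -- with `b = f (2 a) / f a`, the bound follows from `4 * t ≤ 5 * (1 + (t - 1) ^ 2)` for the
  -- smaller number `t` of `u` and `b`
  rcases le_total (u * f a) (f (2 * a)) with h | h
  · have : (u - 1) * f a * (u - 1) ≤ (f (2 * a) - f a) * (u - 1) :=
      mul_le_mul_of_nonneg_right (by linarith) (by linarith)
    nlinarith [mul_nonneg c5 (sq_nonneg (5 * u - 7))]
  · rcases c5.eq_or_lt with h0 | h0
    · rw [← h0, mul_zero] at h c6
      rw [← h0]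
      nlinarith
    · obtain ⟨b, hb⟩ : ∃ b, f (2 * a) = b * f a := ⟨f (2 * a) / f a, by field_simp⟩
      rw [hb] at h c3 c4 ⊢
      have hb1 : 1 ≤ b := by by_contra! h; nlinarith
      have hb2 : b ≤ u := by by_contra! h; nlinarith
      have : (b - 1) * (b - 1) * f a ≤ (b - 1) * (u - 1) * f a := by gcongr
      nlinarith [mul_nonneg c5 (sq_nonneg (5 * b - 7))]

/-- On the integers up to `2 ^ L`, the interpolation approximates `f` up to the factor `5 / 4`. -/
theorem interpolation_le_and_le (hf : IsAggregation f) (L : ℕ) {x : ℕ} (hx : x ≤ 2 ^ L) :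
    interpolation f L x ≤ f x ∧ 4 * f x ≤ 5 * interpolation f L x := by
  induction L with
  | zero =>
    have h1 := hf.nonneg zero_le_one
    rcases (by simpa using hx : x ≤ 1).eq_or_lt with rfl | h
    · simp [interpolation, atomicCoeff, dyadicSlope, atomic_apply]
      linarith
    · obtain rfl : x = 0 := by omega
      simp [interpolation, atomic_apply, hf.zero]
  | succ L ih =>
    rcases le_total x (2 ^ L) with h | h
    · have h' : (x : ℝ) ≤ 2 ^ L := by exact_mod_cast h
      have h'' : (x : ℝ) ≤ 2 ^ (L + 1) := by exact_mod_cast hx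
      rw [interpolation_succ, min_eq_left h', min_eq_left h'', sub_self, mul_zero, add_zero]
      exact ih h
    · have h' : (2 : ℝ) ^ L ≤ x := by exact_mod_cast h
      have h'' : (x : ℝ) ≤ 2 ^ (L + 1) := by exact_mod_cast hx
      rw [interpolation_succ, min_eq_right h', min_eq_left h'', interpolation_of_le f L h',
        dyadicSlope]
      rw [pow_succ'] at h'' ⊢
      exact hf.chord_le_and_le (by positivity) h' h''

end IsAggregation

namespace BaB

theorem flow_le (I : BaB) (T : SimpleGraph (Fin I.n)) (e : Sym2 (Fin I.n)) :
    I.flow T e ≤ 2 ^ I.logD := by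
  classical
  exact (Finset.sum_le_sum_of_subset (Finset.filter_subset _ _)).trans
    (Nat.le_pow_clog (by norm_num) _)

theorem sum_atomicCoeff_cost (I : BaB) (f : ℝ → ℝ) (T : SimpleGraph (Fin I.n)) :
    ∑ i ∈ Finset.range I.numAtomic, atomicCoeff f I.logD i * I.cost (atomic i) T =
      I.cost (interpolation f I.logD) T := by
  simp only [cost, Finset.mul_sum, interpolation]
  rw [Finset.sum_comm]
  refine Finset.sum_congr rfl fun e _ => Finset.sum_congr rfl fun i _ => by ring

theorem cost_le_sum (I : BaB) {f : ℝ → ℝ} (hf : IsAggregation f) (T : SimpleGraph (Fin I.n)) :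
    4 * I.cost f T ≤
      5 * ∑ i ∈ Finset.range I.numAtomic, atomicCoeff f I.logD i * I.cost (atomic i) T := by
  rw [sum_atomicCoeff_cost, cost, cost, Finset.mul_sum, Finset.mul_sum]
  refine Finset.sum_le_sum fun e _ => ?_
  have h1 := (hf.interpolation_le_and_le I.logD (I.flow_le T e)).2
  have h2 : (0 : ℝ) ≤ I.len e := by positivity
  nlinarith

theorem opt_le_cost (I : BaB) (f : ℝ → ℝ) {T : SimpleGraph (Fin I.n)} (hT : I.IsTree T) :
    I.opt f ≤ I.cost f T :=
  csInf_le ((Set.toFinite _).image _).bddBelow ⟨T, hT, rfl⟩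

/-- An optimal tree for `f` is a tree for all atomic cost functions at the same time. -/
theorem sum_opt_le (I : BaB) {f : ℝ → ℝ} (hf : IsAggregation f) :
    ∑ i ∈ Finset.range I.numAtomic, atomicCoeff f I.logD i * I.opt (atomic i) ≤ I.opt f := by
  obtain ⟨T, hT, h⟩ := I.exists_cost_eq_opt f
  rw [← h]
  calc _ ≤ ∑ i ∈ Finset.range I.numAtomic, atomicCoeff f I.logD i * I.cost (atomic i) T :=
        Finset.sum_le_sum fun i _ =>
          mul_le_mul_of_nonneg_left (I.opt_le_cost _ hT) (hf.atomicCoeff_nonneg _ _)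
    _ ≤ _ := by
        rw [sum_atomicCoeff_cost]
        exact Finset.sum_le_sum fun e _ => mul_le_mul_of_nonneg_left
          (hf.interpolation_le_and_le I.logD (I.flow_le T e)).1 (by positivity)

theorem cost_nonneg (I : BaB) {f : ℝ → ℝ} (hf : ∀ x, 0 ≤ x → 0 ≤ f x)
    (T : SimpleGraph (Fin I.n)) : 0 ≤ I.cost f T :=
  Finset.sum_nonneg fun e _ => mul_nonneg (by positivity) (hf _ (by positivity))

theorem opt_nonneg (I : BaB) {f : ℝ → ℝ} (hf : ∀ x, 0 ≤ x → 0 ≤ f x) : 0 ≤ I.opt f := by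
  obtain ⟨T, -, h⟩ := I.exists_cost_eq_opt f
  rw [← h]
  exact I.cost_nonneg hf T

theorem atomic_nonneg (i : ℕ) (x : ℝ) (hx : 0 ≤ x) : 0 ≤ atomic i x := by
  rw [atomic_apply]
  positivity

/-- A bound for distributions follows from bounds for the atomic cost functions. -/
theorem distCost_le_sum (I : BaB) {f : ℝ → ℝ} (hf : IsAggregation f)
    {L : List (SimpleGraph (Fin I.n) × ℚ)} (hL : ∀ x ∈ L, 0 ≤ x.2) :
    4 * I.distCost f L ≤
      5 * ∑ i ∈ Finset.range I.numAtomic, atomicCoeff f I.logD i * I.distCost (atomic i) L := by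
  induction L with
  | nil => simp [distCost]
  | cons x L ih =>
    have h := ih fun y hy => hL y (by simp [hy])
    have h1 := I.cost_le_sum hf x.1
    have h2 : (0 : ℝ) ≤ x.2 := by exact_mod_cast hL x (by simp)
    have h3 := mul_le_mul_of_nonneg_left h1 h2
    simp only [distCost, List.map_cons, List.sum_cons, mul_add, Finset.sum_add_distrib] at h ⊢
    have h4 : ∑ i ∈ Finset.range I.numAtomic,
        atomicCoeff f I.logD i * ((x.2 : ℝ) * I.cost (atomic i) x.1) =
        (x.2 : ℝ) * ∑ i ∈ Finset.range I.numAtomic, atomicCoeff f I.logD i * I.cost (atomic i) x.1 := by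
      rw [Finset.mul_sum]
      exact Finset.sum_congr rfl fun i _ => by ring
    rw [h4]
    linarith

/-- The instance with a single edge of length `1`, over which one unit has to be sent. -/
def singleEdge : BaB where
  n := 2
  graph := ⊤
  len := fun _ => 1
  demand := fun v => if v = 0 then 1 else 0
  root := 1
  exists_demand := ⟨0, by simp⟩
  reachable := fun v _ => SimpleGraph.Connected.preconnected SimpleGraph.connected_top _ _

theorem singleEdge_logD : singleEdge.logD = 0 := by
  rw [logD, show ∑ v, singleEdge.demand v = 1 from rfl, Nat.clog_one_right]

theorem opt_singleEdge_pos : 0 < singleEdge.opt (atomic 0) := by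
  classical
  obtain ⟨T, hT, h⟩ := singleEdge.exists_cost_eq_opt (atomic 0)
  rw [← h]
  let z : Fin singleEdge.n := (0 : Fin 2)
  obtain ⟨p⟩ := hT.spans z (by simp [singleEdge, z])
  have hp := p.toPath.2
  generalize p.toPath.1 = q at hp
  have hz : z ≠ singleEdge.root := by change (0 : Fin 2) ≠ 1; simp
  obtain ⟨v, hadj, q', hq⟩ := SimpleGraph.Walk.exists_eq_cons_of_ne hz q
  have hf : 1 ≤ singleEdge.flow T s(z, v) := by
    rw [flow]
    have hd : singleEdge.demand z = 1 := by simp [singleEdge, z]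
    rw [← hd]
    exact Finset.single_le_sum (f := fun v => singleEdge.demand v) (fun _ _ => Nat.zero_le _)
      (Finset.mem_filter.2 ⟨Finset.mem_univ z, q, hp, by simp [hq]⟩)
  have hf' : (1 : ℝ) ≤ singleEdge.flow T s(z, v) := by exact_mod_cast hf
  refine lt_of_lt_of_le ?_ (Finset.single_le_sum (f := fun e => (singleEdge.len e : ℝ) *
    atomic 0 (singleEdge.flow T e)) (fun e _ => mul_nonneg (by positivity)
      (atomic_nonneg _ _ (by positivity))) (Finset.mem_filter.2 ⟨Finset.mem_univ s(z, v), hadj⟩))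
  have hl : singleEdge.len s(z, v) = 1 := rfl
  rw [hl, atomic_apply]
  simp; linarith

/-- No algorithm has an approximation ratio below `1`. -/
theorem one_le_of_ratio {μ : Measure (Outcome Empty)} {ρ : ℝ} (hu : μ Set.univ = 1)
    (hT : ∀ᵐ o ∂μ, singleEdge.IsTree (singleEdge.readTree o.val))
    (h : ∫⁻ o, ENNReal.ofReal (singleEdge.cost (atomic 0) (singleEdge.readTree o.val)) ∂μ ≤
      ENNReal.ofReal (ρ * singleEdge.opt (atomic 0))) : 1 ≤ ρ := by
  have h1 : ENNReal.ofReal (singleEdge.opt (atomic 0)) ≤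
      ENNReal.ofReal (ρ * singleEdge.opt (atomic 0)) := by
    refine le_trans ?_ h
    calc ENNReal.ofReal (singleEdge.opt (atomic 0))
        = ∫⁻ _, ENNReal.ofReal (singleEdge.opt (atomic 0)) ∂μ := by rw [lintegral_const, hu, mul_one]
      _ ≤ _ := by
        refine lintegral_mono_ae ?_
        filter_upwards [hT] with o ho
        exact ENNReal.ofReal_le_ofReal (opt_le_cost _ _ ho)
  have h0 := opt_singleEdge_pos
  by_contra! hc
  exact h1.not_gt ((ENNReal.ofReal_lt_ofReal_iff h0).2 (by nlinarith))

end BaB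

theorem IsRentOrBuyApprox.one_le {R : Prog Empty} {ρ : ℝ} (h : IsRentOrBuyApprox R ρ) : 1 ≤ ρ := by
  obtain ⟨p, h⟩ := h
  obtain ⟨h1, h2, h3⟩ := h BaB.singleEdge 1
  refine BaB.one_le_of_ratio h1 (h2.mono fun o ho => ho.2) ?_
  simpa [atomic] using h3

theorem IsMultiApprox.one_le {A : Prog Empty} {c : ℝ} (h : IsMultiApprox A c) : 1 ≤ c := by
  obtain ⟨p, h⟩ := h
  obtain ⟨h1, h2, h3⟩ := h BaB.singleEdge fun _ => 1
  refine BaB.one_le_of_ratio h1 (h2.mono fun o ho => ho.2) ?_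
  have e : ∀ F : ℕ → ℝ, ∑ i : Fin (1 + BaB.singleEdge.logD), F i = F 0 := by
    intro F
    rw [← Finset.sum_range (n := 1 + BaB.singleEdge.logD), BaB.singleEdge_logD]
    simp
  simp only [NNRat.cast_one, one_mul] at h3
  rw [e fun i => BaB.singleEdge.opt (atomic i)] at h3
  refine le_of_eq_of_le (lintegral_congr fun o => ?_) h3
  rw [e fun i => BaB.singleEdge.cost (atomic i) _]

end decomposition

/-! ### The quality of the final distribution -/

theorem toList_enc {α : Type} [Code α] (l : List α) : (enc l).toList = l.map enc := by
  simp [enc, Val.toList_ofList]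

namespace BaB

theorem threshold_of_lt (I : BaB) {i : ℕ} (hi : i < I.numAtomic) : I.threshold i = 2 ^ i := by
  rw [threshold, min_eq_left]
  rw [numAtomic] at hi
  omega

theorem commonDen_cost (I : BaB) {w : Val} (hw : I.IsTree (I.readTree w)) {i : ℕ}
    (hi : i < I.numAtomic) :
    (I.costN w (I.threshold i) : ℝ) = I.commonDen * I.cost (atomic i) (I.readTree w) := by
  rw [I.threshold_of_lt hi, I.costN_eq hw, atomic]

/-- If one of the atomic costs of a tree vanishes, then all costs do: every edge of the tree has
length `0` or carries no flow. -/
theorem cost_eq_zero (I : BaB) {T : SimpleGraph (Fin I.n)} {i : ℕ} (h : I.cost (atomic i) T = 0)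
    {f : ℝ → ℝ} (hf : f 0 = 0) : I.cost f T = 0 := by
  classical
  rw [cost, Finset.sum_eq_zero_iff_of_nonneg fun e _ =>
    mul_nonneg (by positivity) (atomic_nonneg _ _ (by positivity))] at h
  refine Finset.sum_eq_zero fun e he => ?_
  rcases mul_eq_zero.1 (h e he) with h1 | h1
  · rw [h1, zero_mul]
  · rw [atomic_apply, min_eq_iff] at h1
    rcases h1 with h1 | h1
    · rw [h1.1, hf, mul_zero]
    · exact absurd h1.1 (by positivity)

end BaB

namespace Context

theorem zeroIndex_spec (c : Context) (h : c.unit = 0) :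
    c.zeroIndex < c.1.numAtomic ∧ c.estimate c.zeroIndex = 0 := by
  obtain ⟨i, hi, h0⟩ := Finset.prod_eq_zero_iff.1 h
  rw [Finset.mem_range] at hi
  have key : ∀ (r : List ℕ) (s : ℕ), (∀ j ∈ r, j < c.1.numAtomic) →
      ((s < c.1.numAtomic ∧ c.estimate s = 0) ∨ ∃ j ∈ r, c.estimate j = 0) →
      r.foldl (fun s i => if c.estimate i = 0 then i else s) s < c.1.numAtomic ∧
        c.estimate (r.foldl (fun s i => if c.estimate i = 0 then i else s) s) = 0 := by
    intro r
    induction r with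
    | nil => rintro s - (h | ⟨j, hj, -⟩); exacts [h, absurd hj (by simp)]
    | cons j r ih =>
      intro s hr h
      rw [List.foldl_cons]
      refine ih _ (fun i hi => hr i (by simp [hi])) ?_
      by_cases hj : c.estimate j = 0
      · simp only [hj, if_true]
        exact .inl ⟨hr j (by simp), trivial⟩
      · simp only [hj, if_false]
        rcases h with h | ⟨i, hi, h0⟩
        · exact .inl h
        · rcases List.mem_cons.1 hi with rfl | hi
          · exact absurd h0 hj
          · exact .inr ⟨i, hi, h0⟩
  exact key _ _ (fun j hj => List.mem_range.1 hj) (.inr ⟨i, List.mem_range.2 hi, h0⟩)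

/-- The data in the context describe trees of the instance. -/
def Valid (c : Context) : Prop :=
  ∀ i < c.1.numAtomic, c.1.IsTree (c.1.readTree (c.2.getD i (.int 0)))

theorem Valid.estimate_eq {c : Context} (h : c.Valid) {i : ℕ} (hi : i < c.1.numAtomic) :
    (c.estimate i : ℝ) =
      c.1.commonDen * c.1.cost (atomic i) (c.1.readTree (c.2.getD i (.int 0))) :=
  c.1.commonDen_cost (h i hi) hi

theorem estimate_dvd_unit (c : Context) {i : ℕ} (hi : i < c.1.numAtomic) : c.estimate i ∣ c.unit :=
  Finset.dvd_prod_of_mem _ (Finset.mem_range.2 hi)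

/-- The trees of a list with the fractions that are proportional to the multiplicities. -/
theorem readDist_result (c : Context) (k : ℕ) (l : List (Val × ℕ)) :
    c.1.readDist (enc (c.result k l)) = (c.support k l).map fun e =>
      (c.1.readTree e.1, (e.2 : ℚ) / (mass (c.support k l) : ℚ)) := by
  simp only [BaB.readDist, toList_enc, result, List.map_map]
  refine List.map_congr_left fun e _ => ?_
  simp [enc, Val.fst, Val.snd, Val.toRat, Val.toInt]

/-- Sampling is finished, or it is not needed. -/
def Finished (c : Context) (k : ℕ) (l : List (Val × ℕ)) : Prop :=
  c.unit = 0 ∨ (c.Sampled k l ∧ l.length = c.1.samples ∧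
    ∀ e ∈ l, c.1.IsTree (c.1.readTree e.1))

/-- The normalized costs of the final distribution are at most `24 k / 400 = 3 k / 50`. -/
theorem support_spec {c : Context} {k : ℕ} {l : List (Val × ℕ)} (hc : c.Valid)
    (h : c.Finished k l) :
    (c.support k l).length ≤ c.1.numAtomic ∧ 0 < mass (c.support k l) ∧
    (∀ e ∈ c.support k l, c.1.IsTree (c.1.readTree e.1)) ∧
    ∀ i < c.1.numAtomic, 50 * ((c.support k l).map fun e => (e.2 : ℝ) *
        c.1.cost (atomic i) (c.1.readTree e.1)).sum ≤
      3 * k * (mass (c.support k l) *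
        c.1.cost (atomic i) (c.1.readTree (c.2.getD i (.int 0)))) := by
  by_cases hu : c.unit = 0
  · obtain ⟨h1, h2⟩ := c.zeroIndex_spec hu
    have h3 := hc.estimate_eq h1
    rw [h2, Nat.cast_zero, eq_comm, mul_eq_zero] at h3
    have h4 := h3.resolve_left (by exact_mod_cast c.1.commonDen_pos.ne')
    rw [support, if_pos hu]
    refine ⟨by simp [BaB.numAtomic], by simp [mass], by simpa using hc _ h1, fun i hi => ?_⟩
    have h5 : atomic i 0 = 0 := by simp [atomic_apply]
    simp only [List.map_cons, List.map_nil, List.sum_cons, List.sum_nil, Nat.cast_one,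
      c.1.cost_eq_zero h4 h5, add_zero, mul_zero]
    have := c.1.cost_nonneg (BaB.atomic_nonneg i) (c.1.readTree (c.2.getD i (.int 0)))
    positivity
  · obtain ⟨h1, h2, h3⟩ := h.resolve_left hu
    obtain ⟨s1, s2, s3, s4⟩ := c.iterate_reduceStep_spec h1.narrow h2 (h1.below h2)
    rw [support, if_neg hu]
    set s := (c.reduceStep k)^[c.1.samples] l
    have s4' : ∀ e ∈ s, c.1.IsTree (c.1.readTree e.1) := by
      intro e he
      obtain ⟨e', he', h⟩ := List.mem_map.1 (s4 e.1 (List.mem_map_of_mem he))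
      rw [← h]
      exact h3 e' he'
    refine ⟨s1, s2, s4', fun i hi => ?_⟩
    obtain ⟨d, hd⟩ := c.estimate_dvd_unit hi
    have hE : 0 < c.estimate i := by
      rw [Nat.pos_iff_ne_zero]
      rintro h0
      rw [h0, zero_mul] at hd
      exact hu hd
    have hd0 : 0 < d := by
      rw [Nat.pos_iff_ne_zero]
      rintro rfl
      exact hu hd
    have hdiv : c.unit / c.estimate i = d := by rw [hd, Nat.mul_div_cancel_left _ hE]
    have hC : (0 : ℝ) < c.1.commonDen := by exact_mod_cast c.1.commonDen_pos
    have e1 : (c.total s i : ℝ) = c.1.commonDen * d *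
        (s.map fun e => (e.2 : ℝ) * c.1.cost (atomic i) (c.1.readTree e.1)).sum := by
      rw [total, Nat.cast_list_sum, List.map_map, ← List.sum_map_mul_left]
      congr 1
      refine List.map_congr_left fun e he => ?_
      simp only [Function.comp, vec, hdiv, Nat.cast_mul, c.1.commonDen_cost (s4' e he) hi]
      ring
    have e2 : (c.unit : ℝ) = c.1.commonDen *
        c.1.cost (atomic i) (c.1.readTree (c.2.getD i (.int 0))) * d := by
      rw [hd, Nat.cast_mul, hc.estimate_eq hi]
    have e3 : (400 : ℝ) * c.total s i ≤ 24 * k * c.unit * mass s := by exact_mod_cast s3 i hi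
    rw [e1, e2] at e3
    have hd' : (0 : ℝ) < d := by exact_mod_cast hd0
    refine le_of_mul_le_mul_left ?_ (mul_pos (mul_pos hC hd') (by norm_num : (0 : ℝ) < 8))
    linarith

theorem isDist_result {c : Context} {k : ℕ} {l : List (Val × ℕ)} (hc : c.Valid)
    (h : c.Finished k l) : c.1.IsDist (c.1.readDist (enc (c.result k l))) ∧
      (c.1.readDist (enc (c.result k l))).length ≤ 1 + c.1.logD := by
  obtain ⟨h1, h2, h3, -⟩ := support_spec hc h
  rw [readDist_result]
  refine ⟨⟨?_, ?_⟩, by simpa [BaB.numAtomic] using h1⟩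
  · intro x hx
    obtain ⟨e, he, rfl⟩ := List.mem_map.1 hx
    exact ⟨h3 e he, by positivity⟩
  · have h2' : (mass (c.support k l) : ℚ) ≠ 0 := by exact_mod_cast h2.ne'
    rw [List.map_map]
    simp only [Function.comp_def, div_eq_mul_inv]
    rw [List.sum_map_mul_right]
    have e : ((c.support k l).map fun e => (e.2 : ℚ)).sum = mass (c.support k l) := by
      rw [mass, Nat.cast_list_sum, List.map_map]
      rfl
    rw [e, mul_inv_cancel₀ h2']

/-- The cost of the distribution is at most `3 k / 40` times the combination, with the coefficients
of `f`, of the costs of the trees for the atomic functions. -/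
theorem distCost_result_le {c : Context} {k : ℕ} {l : List (Val × ℕ)} (hc : c.Valid)
    (h : c.Finished k l) {f : ℝ → ℝ} (hf : IsAggregation f) :
    40 * c.1.distCost f (c.1.readDist (enc (c.result k l))) ≤
      3 * k * ∑ i ∈ Finset.range c.1.numAtomic, atomicCoeff f c.1.logD i *
        c.1.cost (atomic i) (c.1.readTree (c.2.getD i (.int 0))) := by
  obtain ⟨h1, h2, h3, h4⟩ := support_spec hc h
  have h0 := (isDist_result hc h).1.1
  have key : ∀ i < c.1.numAtomic, 50 * c.1.distCost (atomic i) (c.1.readDist (enc (c.result k l))) ≤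
      3 * k * c.1.cost (atomic i) (c.1.readTree (c.2.getD i (.int 0))) := by
    intro i hi
    have hM : (0 : ℝ) < mass (c.support k l) := by exact_mod_cast h2
    have e : c.1.distCost (atomic i) (c.1.readDist (enc (c.result k l))) =
        (mass (c.support k l) : ℝ)⁻¹ * ((c.support k l).map fun e => (e.2 : ℝ) *
        c.1.cost (atomic i) (c.1.readTree e.1)).sum := by
      rw [BaB.distCost, readDist_result, List.map_map, ← List.sum_map_mul_left]
      congr 1
      refine List.map_congr_left fun e he => ?_
      simp only [Function.comp_def, Rat.cast_div, Rat.cast_natCast]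
      ring
    rw [e]
    refine le_of_mul_le_mul_left ?_ hM
    rw [mul_left_comm, mul_inv_cancel_left₀ hM.ne']
    linarith [h4 i hi]
  have h5 := c.1.distCost_le_sum hf fun x hx => (h0 x hx).2
  have h6 : ∑ i ∈ Finset.range c.1.numAtomic, atomicCoeff f c.1.logD i *
        (50 * c.1.distCost (atomic i) (c.1.readDist (enc (c.result k l)))) ≤
      ∑ i ∈ Finset.range c.1.numAtomic, atomicCoeff f c.1.logD i *
        (3 * k * c.1.cost (atomic i) (c.1.readTree (c.2.getD i (.int 0)))) :=
    Finset.sum_le_sum fun i hi => mul_le_mul_of_nonneg_left (key i (Finset.mem_range.1 hi))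
      (hf.atomicCoeff_nonneg _ _)
  simp only [mul_left_comm (atomicCoeff f c.1.logD _), ← Finset.mul_sum] at h6
  linarith

end Context

/-! ### Trees for the atomic cost functions -/

/-- If a rank decreases in every round, then it bounds the number of calls. -/
theorem CallLoop.ae_calls_le {ι σ : Type} {G P : Val → Measure (Outcome ι)} {e : σ → Val}
    {c : σ → Bool} {draw : σ → Measure (Outcome Empty)} {next : σ → Outcome Empty → σ}
    {F : σ → Outcome Empty → Outcome ι} {i : ι → ℕ} {B : ℕ} {Inv : σ → Prop}
    (h : CallLoop G P e c draw next F i B Inv) {rank : σ → ℕ}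
    (hr : ∀ s o, Inv s → c s = true → rank (next s o) < rank s) {s : σ} (hs : Inv s) {j : ι}
    (hj : i j = 1) :
    ∀ᵐ x ∂Measure.sum (fun n => loopRun G P n (e s)), x.calls j ≤ rank s := by
  have key : ∀ n s, Inv s → ∀ᵐ x ∂loopRun G P n (e s), n ≤ rank s := by
    intro n
    induction n with
    | zero => intro s _; exact ae_of_all _ fun _ => Nat.zero_le _
    | succ n ih =>
      intro s hs
      cases hc : c s with
      | false => rw [h.run_succ_of_false hs hc]; simp
      | true =>
        obtain ⟨t, -, h1⟩ := h.run_succ hs hc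
        rw [h1, ae_bind_iff]
        filter_upwards [h.inv s hs hc] with o ho
        rw [ae_map_outcome_iff]
        filter_upwards [ih _ ho.1] with x hx
        exact lt_of_le_of_lt hx (hr s o hs hc)
  rw [Measure.ae_sum_iff]
  intro n
  filter_upwards [h.ae_run n hs, key n s hs] with x hx hn
  rw [hx.2.1]
  simpa [hj] using hn

theorem runWith_seq_of_dirac {ι : Type} {sub : ι → Val → Measure (Outcome Empty)} {p q : Prog ι}
    {v : Val} {a : Outcome ι} (hp : p.runWith sub v = Measure.dirac a) :
    (Prog.seq p q).runWith sub v = (q.runWith sub a.val).map fun b => a.after b := by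
  rw [Prog.runWith, hp, Measure.dirac_bind (Outcome.measurable _)]

section
variable {σ β : Type} [Code σ] [Code β]

/-- A loop with one call in every round, whose guard, queries and updates are computable in
polynomial time. Its running time is controlled by a bound `Z` for the states and the results of the
calls. -/
theorem exists_call_loop (i : Subroutine) {c : σ → Bool} {query : σ → β} {upd : σ × Val → σ}
    (hc : PT c) (hq : PT query) (hu : PT upd) :
    ∃ (Q : Prog Subroutine) (B : Polynomial ℕ),
      ∀ sub : Subroutine → Val → Measure (Outcome Empty),
        ∃ (G P : Val → Measure (Outcome Subroutine))
          (F : σ → Outcome Empty → Outcome Subroutine),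
          (∀ v, Q.runWith sub v = Measure.sum fun n => loopRun G P n v) ∧
          ∀ (Z : ℕ) (Inv : σ → Prop), (∀ s, Inv s → esize s ≤ Z) →
            (∀ s, Inv s → c s = true → sub i (enc (query s)) Set.univ = 1 ∧
              ∀ᵐ o ∂sub i (enc (query s)), Inv (upd (s, o.val)) ∧ o.time + o.val.size ≤ Z) →
            CallLoop G P enc c (fun s => sub i (enc (query s))) (fun s o => upd (s, o.val)) F
              (Pi.single i 1) (B.eval Z) Inv := by
  obtain ⟨body, T, hbody⟩ := exists_call_body i hq hu
  obtain ⟨guard, U, hguard⟩ := hc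
  refine ⟨.while guard body, U + T.comp (2 * .X), fun sub => ?_⟩
  choose F hF1 hF2 using hbody sub
  refine ⟨guard.runWith sub, body.runWith sub, F, fun v => by rw [Prog.runWith], fun Z Inv hZ hI =>
    ⟨fun s hs => ?_, fun s _ _ => hF1 s, fun s o _ => (hF2 s o).1, fun s o _ => (hF2 s o).2.1,
      fun s hs hc => (hI s hs hc).1, fun s hs hc => ?_⟩⟩
  · obtain ⟨t, ht, h⟩ := (hguard s).2 sub
    refine ⟨t, ht.trans ?_, h⟩
    rw [Polynomial.eval_add]
    exact (polynomial_eval_mono U (hZ s hs)).trans (Nat.le_add_right _ _)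
  · filter_upwards [(hI s hs hc).2] with o ho
    refine ⟨ho.1, ((hF2 s o).2.2.trans (polynomial_eval_mono T (b := 2 * Z) ?_)).trans ?_⟩
    · have := hZ s hs
      omega
    · simp [Polynomial.eval_comp]

end

/-- A bound for the time and the length of the output of a program of polynomial running time. -/
theorem exists_time_add_size_le (S : Prog Empty) (p : Polynomial ℕ) :
    ∃ q : Polynomial ℕ, ∀ w, S.run w Set.univ = 1 → (∀ᵐ o ∂S.run w, o.time ≤ p.eval w.size) →
      ∀ᵐ o ∂S.run w, o.time + o.val.size ≤ q.eval w.size := by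
  obtain ⟨K, hK⟩ := exists_ae_size_le S
  refine ⟨p + .C K * (.X + p), fun w h1 h2 => ?_⟩
  filter_upwards [h2, hK w _ h1 h2] with o ho ho'
  simp only [Polynomial.eval_add, Polynomial.eval_mul, Polynomial.eval_C, Polynomial.eval_X]
  omega

/-- The rent-or-buy algorithm is called once for every atomic cost function, and the trees that it
returns are collected. The last bound is on all costs at once, since the estimates for different
atomic cost functions enter the final bound together. -/
theorem exists_collect : ∃ P : Prog Subroutine, ∀ (A R : Prog Empty) (ρ : ℝ),
    IsRentOrBuyApprox R ρ → ∃ B : BaB → ℕ, PolyBounded B ∧ ∀ I : BaB,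
      let μ := P.runSub (Subroutine.prog A R) I.encode
      μ Set.univ = 1 ∧
      (∀ᵐ x ∂μ, (∃ c : Context, x.val = enc c ∧ c.1 = I ∧ c.Valid ∧ esize c ≤ B I ∧
        (IsSureRentOrBuyApprox R ρ → ∀ i < I.numAtomic,
          I.cost (atomic i) (I.readTree (c.2.getD i (.int 0))) ≤ ρ * I.opt (atomic i))) ∧
        x.calls .multi = 0 ∧ x.time ≤ B I) ∧
      ∀ α : ℕ → ℝ≥0∞, ∫⁻ x, ∑ i ∈ Finset.range I.numAtomic, α i * ENNReal.ofReal
          (I.cost (atomic i) (I.readTree (x.val.snd.toList.getD i (.int 0)))) ∂μ ≤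
        ∑ i ∈ Finset.range I.numAtomic, α i * ENNReal.ofReal (ρ * I.opt (atomic i)) := by
  have hc : PT fun s : BaB × List Val => decide (s.2.length < s.1.numAtomic) :=
    .natLt (.length (by fun_prop)) (.numAtomic (by fun_prop))
  have hL : PT fun s : BaB × List Val => s.1.logD := .logD (by fun_prop)
  have hq : PT fun s : BaB × List Val => (s.1, 2 ^ (s.1.logD - s.2.length)) :=
    .prodMk (by fun_prop) (.two_pow (.natSub hL (.length (by fun_prop)))
      ((PolyBounded.logD (by fun_prop)).mono fun a => Nat.sub_le _ _))
  have hu : PT fun p : (BaB × List Val) × Val => (p.1.1, p.2 :: p.1.2) := by fun_prop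
  have hi : PT fun I : BaB => (I, ([] : List Val)) := by fun_prop
  obtain ⟨Q, B, hQ⟩ := exists_call_loop .rob hc hq hu
  obtain ⟨init, T, hinit⟩ := hi
  refine ⟨.seq init Q, fun A R ρ hR => ?_⟩
  obtain ⟨p, hp⟩ := hR
  obtain ⟨q, hq⟩ := exists_time_add_size_le R p
  -- bounds for the queries, for the results, and for the states
  let W : BaB → ℕ := fun I => esize I + I.logD + 3
  let Z : BaB → ℕ := fun I => esize I + I.numAtomic * (q.eval (W I) + 1) + 2 + q.eval (W I)
  have hWb : PolyBounded W := by
    have := PolyBounded.logD (PT.id' (α := BaB))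
    fun_prop
  have hZb : PolyBounded Z := by
    have := PolyBounded.numAtomic (PT.id' (α := BaB))
    have := PolyBounded.eval hWb q
    fun_prop
  refine ⟨fun I => Z I + T.eval (esize I) + (I.numAtomic + 1) * (2 * B.eval (Z I) + 3) + 1, ?_,
    fun I => ?_⟩
  · have := PolyBounded.numAtomic (PT.id' (α := BaB))
    have := PolyBounded.eval hZb B
    have := PolyBounded.eval (PolyBounded.size_self (α := BaB)) T
    fun_prop
  intro μ
  set m := I.numAtomic with hm
  -- the trees are found in the order of decreasing index, so that those for the indices
  -- `m - s.2.length, …, m - 1` are known, in this order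
  let Inv : BaB × List Val → Prop := fun s => s.1 = I ∧ s.2.length ≤ m ∧
    (∀ w ∈ s.2, w.size ≤ q.eval (W I)) ∧ ∀ j < s.2.length,
      I.IsTree (I.readTree (s.2.getD j (.int 0))) ∧ (IsSureRentOrBuyApprox R ρ →
        I.cost (atomic (m - s.2.length + j)) (I.readTree (s.2.getD j (.int 0))) ≤
          ρ * I.opt (atomic (m - s.2.length + j)))
  have hInvZ : ∀ s, Inv s → esize s ≤ Z I := by
    rintro ⟨J, l⟩ ⟨hJ, h1, h2, -⟩
    change J = I at hJ
    subst J
    have h3 := esize_list_le (l := l) h2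
    change l.length ≤ m at h1
    have h4 := Nat.mul_le_mul_right (q.eval (W I) + 1) h1
    rw [hm] at h4
    simp only [esize_prod, Z]
    omega
  have hdraw : ∀ s, Inv s → decide (s.2.length < s.1.numAtomic) = true →
      R.run (enc (s.1, 2 ^ (s.1.logD - s.2.length))) Set.univ = 1 ∧
      (∀ᵐ o ∂(R.run (enc (s.1, 2 ^ (s.1.logD - s.2.length)))),
        Inv (s.1, o.val :: s.2) ∧ o.time + o.val.size ≤ Z I) ∧
      ∫⁻ o, ENNReal.ofReal (I.cost (atomic (m - (s.2.length + 1))) (I.readTree o.val))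
          ∂(R.run (enc (s.1, 2 ^ (s.1.logD - s.2.length)))) ≤
        ENNReal.ofReal (ρ * I.opt (atomic (m - (s.2.length + 1)))) := by
    rintro ⟨J, l⟩ ⟨hJ, h1, h2, h3⟩ hcond
    change J = I at hJ
    subst J
    have hlt := of_decide_eq_true hcond
    dsimp only at hlt h1 h2 h3 ⊢
    have e : m - (l.length + 1) = I.logD - l.length := by
      rw [hm, BaB.numAtomic]; omega
    obtain ⟨r1, r2, r3⟩ := hp I (2 ^ (I.logD - l.length))
    rw [e]
    refine ⟨r1, ?_, r3⟩
    have hsz : (enc (I, 2 ^ (I.logD - l.length)) : Val).size ≤ W I := by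
      change esize (I, 2 ^ (I.logD - l.length)) ≤ _
      rw [esize_prod, esize_nat, Nat.size_pow]
      simp only [W]
      omega
    have hsure : IsSureRentOrBuyApprox R ρ →
        ∀ᵐ o ∂(R.run (enc (I, 2 ^ (I.logD - l.length)))),
        I.cost (atomic (I.logD - l.length)) (I.readTree o.val) ≤
          ρ * I.opt (atomic (I.logD - l.length)) := fun h => h I _
    have hsure' : ∀ᵐ o ∂(R.run (enc (I, 2 ^ (I.logD - l.length)))),
        IsSureRentOrBuyApprox R ρ → I.cost (atomic (I.logD - l.length)) (I.readTree o.val) ≤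
          ρ * I.opt (atomic (I.logD - l.length)) := by
      by_cases hs : IsSureRentOrBuyApprox R ρ
      · exact (hsure hs).mono fun o ho _ => ho
      · exact ae_of_all _ fun o h => absurd h hs
    have r2' : ∀ᵐ o ∂(R.run (enc (I, 2 ^ (I.logD - l.length)))), I.IsTree (I.readTree o.val) :=
      r2.mono fun o ho => ho.2
    filter_upwards [r2', hsure', hq _ r1 (r2.mono fun o ho => ho.1)] with o o1 o2 o3
    have o4 := o3.trans (polynomial_eval_mono q hsz)
    refine ⟨⟨rfl, hlt, ?_, ?_⟩, ?_⟩
    · intro w hw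
      rcases List.mem_cons.1 hw with rfl | hw
      · omega
      · exact h2 w hw
    · intro j hj
      cases j with
      | zero =>
        simp only [List.getD_cons_zero, List.length_cons, add_zero, e]
        exact ⟨o1, o2⟩
      | succ j =>
        have hj' : j < l.length := by simpa using hj
        have e' : m - (o.val :: l).length + (j + 1) = m - l.length + j := by
          rw [List.length_cons]; omega
        rw [e', List.getD_cons_succ]
        exact h3 j hj'
    · simp only [Z]
      omega
  obtain ⟨G, P, F, hQ1, hQ2⟩ := hQ fun i => (Subroutine.prog A R i).run
  have hloop := hQ2 (Z I) Inv hInvZ fun s hs hc => ⟨(hdraw s hs hc).1, (hdraw s hs hc).2.1⟩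
  have hstart : Inv (I, []) := ⟨rfl, Nat.zero_le _, by simp, by simp⟩
  obtain ⟨t, ht, h0⟩ := (hinit I).2 fun i => (Subroutine.prog A R i).run
  have hμ : μ = (Measure.sum fun n => loopRun G P n (enc (I, ([] : List Val)))).map fun b =>
      (⟨enc (I, ([] : List Val)), t, 0⟩ : Outcome Subroutine).after b := by
    have : μ = _ := runWith_seq_of_dirac h0
    rw [this, hQ1]
  have hprog : Subroutine.prog A R .rob = R := rfl
  have hx : ∀ᵐ x ∂(Measure.sum fun n => loopRun G P n (enc (I, ([] : List Val)))),
      x.calls .rob ≤ m := by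
    refine hloop.ae_calls_le (rank := fun s => m - s.2.length) (fun s o hs hc => ?_) hstart (by simp)
    have hlt := of_decide_eq_true hc
    rw [hs.1] at hlt
    simp only [List.length_cons]
    omega
  refine ⟨?_, ?_, fun α => ?_⟩
  · rw [hμ, map_univ_outcome]
    refine hloop.univ_eq_one (Φ := fun s => 2 ^ (m - s.2.length)) (r := 2⁻¹)
      (fun s => one_le_pow₀ one_le_two) (by simp) (fun s => by simp) (fun s hs hc => ?_) hstart
    have hlt := of_decide_eq_true hc
    rw [hs.1] at hlt
    obtain ⟨d, hd⟩ : ∃ d, m - s.2.length = d + 1 := ⟨m - s.2.length - 1, by omega⟩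
    have hd' : m - (s.2.length + 1) = d := by omega
    simp only [List.length_cons, hd, hd', lintegral_const]
    rw [hprog, (hdraw s hs hc).1, mul_one, pow_succ', ← mul_assoc,
      ENNReal.inv_mul_cancel (by simp) (by simp), one_mul]
  · rw [hμ, ae_map_outcome_iff]
    filter_upwards [hloop.ae_sum hstart, hx] with x hx1 hx2
    obtain ⟨⟨⟨J, l⟩, hv, hI, hcond⟩, n, hn, htime⟩ := hx1
    have hZ := hInvZ _ hI
    obtain ⟨hJ, h1, h2, h3⟩ := hI
    change J = I at hJ
    subst J
    have hlen : m = l.length := by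
      have h4 : ¬ l.length < I.numAtomic := of_decide_eq_false hcond
      have h5 : l.length ≤ m := h1
      omega
    simp only [← hlen, Nat.sub_self, zero_add] at h3
    refine ⟨⟨(I, l), hv, rfl, fun i hi => (h3 i hi).1, by omega, fun hs i hi => (h3 i hi).2 hs⟩,
      ?_, ?_⟩
    · simp [Outcome.after, hn]
    · have hnm : n ≤ m := by simpa [hn] using hx2
      have h4 := Nat.mul_le_mul_right (2 * B.eval (Z I) + 3) (Nat.add_le_add_right hnm 1)
      change t + x.time + 1 ≤ Z I + T.eval (esize I) + (m + 1) * (2 * B.eval (Z I) + 3) + 1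
      omega
  · rw [hμ, lintegral_map_outcome]
    simp only [Outcome.after]
    let V : ℕ → Val → ℝ≥0∞ := fun i w =>
      α i * ENNReal.ofReal (I.cost (atomic i) (I.readTree w))
    let U : ℕ → ℝ≥0∞ := fun i => α i * ENNReal.ofReal (ρ * I.opt (atomic i))
    -- the costs of the trees still missing are replaced by the bounds for their expectations
    refine (hloop.lintegral_le (ψ := fun s => ∑ i ∈ Finset.range (m - s.2.length), U i +
      ∑ j ∈ Finset.range s.2.length, V (m - s.2.length + j) (s.2.getD j (.int 0)))
      (g := fun v => ∑ i ∈ Finset.range m, V i (v.snd.toList.getD i (.int 0)))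
      (fun s hs hc => ?_) (fun s hs hc => ?_) hstart).trans (by simp [U])
    · have hlt := of_decide_eq_true hc
      rw [hs.1] at hlt
      obtain ⟨d1, -, d3⟩ := hdraw s hs hc
      obtain ⟨d, hd⟩ : ∃ d, m - s.2.length = d + 1 := ⟨m - s.2.length - 1, by omega⟩
      have hd' : m - (s.2.length + 1) = d := by omega
      simp only [List.length_cons]
      simp only [Finset.sum_range_succ' _ s.2.length, List.getD_cons_succ, List.getD_cons_zero,
        add_zero, ← add_assoc]
      simp only [hd, hd']
      rw [hd'] at d3
      rw [hprog, lintegral_add_left measurable_const, lintegral_const, d1, mul_one,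
        lintegral_const_mul _ (Outcome.measurable _), Finset.sum_range_succ U]
      have e : ∑ j ∈ Finset.range s.2.length, V (d + j + 1) (s.2.getD j (.int 0)) =
          ∑ j ∈ Finset.range s.2.length, V (d + 1 + j) (s.2.getD j (.int 0)) :=
        Finset.sum_congr rfl fun j _ => by rw [add_right_comm]
      rw [e, add_right_comm (∑ i ∈ Finset.range d, U i)]
      gcongr
      exact mul_le_mul_right d3 _
    · obtain ⟨h1, h2, -⟩ := hs
      have hlen : s.2.length = m := by
        have := of_decide_eq_false hc
        rw [h1] at this
        omega
      have e : (enc s : Val).snd.toList = s.2 := by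
        change (enc s.2).toList = s.2
        rw [toList_enc]
        exact List.map_id _
      simp [hlen, e]

/-! ### Sampling trees -/

namespace Context

/-- The coefficients of the atomic cost functions in the queries: the weights refer to costs that
are normalized by the estimates. -/
def coeff (c : Context) (k : ℕ) (l : List (Val × ℕ)) (i : ℕ) : ℕ :=
  c.weight k l i * (c.unit / c.estimate i)

/-- The argument with which the multi-objective algorithm is called; a coefficient is written as a
fraction with denominator `1`. -/
def query (c : Context) (k : ℕ) (l : List (Val × ℕ)) : BaB × List (ℕ × ℕ) :=
  (c.1, (List.range c.1.numAtomic).map fun i => (c.coeff k l i, 1))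

theorem enc_query (c : Context) (k : ℕ) (l : List (Val × ℕ)) : enc (c.query k l) =
    .pair c.1.encode (.ofList (List.ofFn fun i : Fin (1 + c.1.logD) =>
      .ofRat (c.coeff k l i : ℚ≥0))) := by
  change Val.pair c.1.encode (Val.ofList (((List.range c.1.numAtomic).map _).map enc)) = _
  congr 2
  rw [List.map_map]
  refine List.ext_getElem (by simp [BaB.numAtomic]) fun i h1 h2 => ?_
  simp [enc, Val.ofRat]

theorem weight_pos (c : Context) (k : ℕ) (l : List (Val × ℕ)) (i : ℕ) : 0 < c.weight k l i :=
  Nat.succ_pos _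

/-- A tree is rejected with probability at most `4 / 5`: its expected weighted cost is at most
`k / 25` times the weighted estimate, since the estimates are at least the optimal costs, and it is
accepted up to `k / 20` times the weighted estimate, so that Markov's inequality applies. -/
theorem measure_not_accepts_le {A : Prog Empty} {r : ℝ} (hA : IsMultiApprox A r) {c : Context}
    {k : ℕ} (hr : 25 * r ≤ k) (hk : 0 < k) (hc : c.Valid) (hu : c.unit ≠ 0) (l : List (Val × ℕ)) :
    A.run (enc (c.query k l)) {o | c.accepts k l o.val = false} ≤ ENNReal.ofReal (4 / 5) := by
  obtain ⟨p, hA⟩ := hA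
  have h := hA c.1 fun i => (c.coeff k l i : ℚ≥0)
  rw [enc_query]
  dsimp only at h
  obtain ⟨-, h2, h3⟩ := h
  set μ := A.run _
  simp only [NNRat.cast_natCast] at h3
  set W := ∑ i ∈ Finset.range c.1.numAtomic, c.weight k l i with hW
  have hWpos : 0 < W := Finset.sum_pos (fun i _ => c.weight_pos k l i) ⟨0, by simp [BaB.numAtomic]⟩
  have hW' : (0 : ℝ) < W := by exact_mod_cast hWpos
  have hu' : (0 : ℝ) < c.unit := by exact_mod_cast Nat.pos_of_ne_zero hu
  have hD : (0 : ℝ) < c.1.commonDen := by exact_mod_cast c.1.commonDen_pos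
  have hk' : (0 : ℝ) < k := by exact_mod_cast hk
  have hopt : c.1.commonDen * ∑ i : Fin (1 + c.1.logD), (c.coeff k l i : ℝ) * c.1.opt (atomic i) ≤
      c.unit * W := by
    rw [hW, Nat.cast_sum, BaB.numAtomic, Finset.sum_range, Finset.mul_sum, Finset.mul_sum]
    refine Finset.sum_le_sum fun i _ => ?_
    have e1 : c.estimate i * (c.unit / c.estimate i) = c.unit :=
      Nat.mul_div_cancel' (c.estimate_dvd_unit i.2)
    have e2 := hc.estimate_eq i.2
    have e3 := c.1.opt_le_cost (atomic i) (hc i i.2)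
    have e4 : (c.unit : ℝ) = c.estimate i * (c.unit / c.estimate i : ℕ) := by exact_mod_cast e1.symm
    rw [coeff, e4, e2]
    push_cast
    have : (0 : ℝ) ≤ c.1.commonDen * (c.weight k l i * (c.unit / c.estimate i : ℕ)) := by positivity
    nlinarith
  have hcost : ∀ w, c.1.IsTree (c.1.readTree w) →
      c.1.commonDen * ∑ i : Fin (1 + c.1.logD), (c.coeff k l i : ℝ) *
        c.1.cost (atomic i) (c.1.readTree w) =
      (∑ i ∈ Finset.range c.1.numAtomic, c.weight k l i * c.vec w i : ℕ) := by
    intro w hw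
    rw [Nat.cast_sum, BaB.numAtomic, Finset.sum_range, Finset.mul_sum]
    refine Finset.sum_congr rfl fun i _ => ?_
    simp only [vec, coeff]
    push_cast
    rw [c.1.commonDen_cost hw i.2]
    ring
  set f : Outcome Empty → ℝ := fun o => ∑ i : Fin (1 + c.1.logD), (c.coeff k l i : ℝ) *
    c.1.cost (atomic i) (c.1.readTree o.val)
  set ε : ℝ := k * c.unit * W / (20 * c.1.commonDen) with hε
  have hεpos : 0 < ε := by positivity
  calc μ {o | c.accepts k l o.val = false} ≤ μ {o | ENNReal.ofReal ε ≤ ENNReal.ofReal (f o)} := by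
        refine measure_mono_ae ?_
        filter_upwards [h2] with o ho hrej
        have h4 := of_decide_eq_false (show decide _ = false from hrej)
        have h5 := hcost _ ho.2
        have h6 : (k * c.unit * W : ℝ) <
            20 * (∑ i ∈ Finset.range c.1.numAtomic, c.weight k l i * c.vec o.val i : ℕ) := by
          exact_mod_cast not_le.1 h4
        rw [← h5] at h6
        refine ENNReal.ofReal_le_ofReal ?_
        rw [hε, div_le_iff₀ (by positivity)]
        change _ ≤ f o * _
        change _ < 20 * (_ * f o) at h6
        linarith
    _ ≤ (∫⁻ o, ENNReal.ofReal (f o) ∂μ) / ENNReal.ofReal ε :=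
        meas_ge_le_lintegral_div (Outcome.measurable _).aemeasurable (by simpa using hεpos) (by simp)
    _ ≤ _ := by
        refine ENNReal.div_le_of_le_mul (h3.trans ?_)
        rw [← ENNReal.ofReal_mul (by norm_num)]
        refine ENNReal.ofReal_le_ofReal ?_
        rw [hε]
        set s := ∑ i : Fin (1 + c.1.logD), (c.coeff k l i : ℝ) * c.1.opt (atomic i)
        have hs : 0 ≤ s := Finset.sum_nonneg fun i _ =>
          mul_nonneg (by positivity) (c.1.opt_nonneg (BaB.atomic_nonneg i))
        rw [← mul_div_assoc, le_div_iff₀ (by positivity)]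
        clear_value s
        have h7 : r * s ≤ k / 25 * s := mul_le_mul_of_nonneg_right (by linarith) hs
        have h9 := mul_le_mul_of_nonneg_right h7 (mul_nonneg (by norm_num : (0 : ℝ) ≤ 20) hD.le)
        have h8 := mul_le_mul_of_nonneg_left hopt hk'.le
        linarith

theorem total_le (c : Context) {l : List (Val × ℕ)} {i b : ℕ}
    (h : ∀ w ∈ l.map Prod.fst, c.vec w i ≤ b) : c.total l i ≤ mass l * b := by
  induction l with
  | nil => simp [total]
  | cons e l ih =>
    have h1 := ih fun w hw => h w (by simp at hw ⊢; exact .inr hw)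
    have h2 := Nat.mul_le_mul_left e.2 (h e.1 (by simp))
    simp only [total, mass, List.map_cons, List.sum_cons] at h1 ⊢
    rw [Nat.add_mul]
    omega

/-- A bound for the coefficients in all queries. -/
def coeffBound (c : Context) (k : ℕ) : ℕ :=
  (21 * c.1.numAtomic * (400 * (c.1.samples * (21 * c.1.numAtomic * k * c.unit))) + 1) * c.unit

theorem Sampled.coeff_le {c : Context} {k : ℕ} {l : List (Val × ℕ)} (h : c.Sampled k l)
    (hl : l.length ≤ c.1.samples) {i : ℕ} (hi : i < c.1.numAtomic) :
    c.coeff k l i ≤ c.coeffBound k := by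
  have h1 : ∀ j < c.1.numAtomic, c.excess (21 * k) 400 l j ≤
      400 * (c.1.samples * (21 * c.1.numAtomic * k * c.unit)) := by
    intro j hj
    refine (Nat.sub_le _ _).trans (Nat.mul_le_mul_left _ ((c.total_le fun w hw => ?_).trans
      (Nat.mul_le_mul_right _ (h.mass_eq.trans_le hl))))
    have := h.narrow w hw j hj
    omega
  have h2 := Finset.sum_le_card_nsmul (Finset.range c.1.numAtomic)
    (fun j => c.excess (21 * k) 400 l j) _ fun j hj => h1 j (Finset.mem_range.1 hj)
  rw [Finset.card_range, smul_eq_mul] at h2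
  refine Nat.mul_le_mul ?_ (Nat.div_le_self _ _)
  have h3 := Nat.mul_le_mul_left (20 * c.1.numAtomic) (h1 i hi)
  rw [weight]
  set E := 400 * (c.1.samples * (21 * c.1.numAtomic * k * c.unit))
  have h4 : 21 * c.1.numAtomic * E = 20 * c.1.numAtomic * E + c.1.numAtomic * E := by ring
  omega

theorem polyBits_coeffBound (k : ℕ) : PolyBits fun c : Context => c.coeffBound k := by
  have h1 : PolyBits fun c : Context => c.1.numAtomic := .of_polyBounded (.numAtomic (by fun_prop))
  have h2 : PolyBits fun c : Context => c.1.samples := .of_polyBounded (.samples (by fun_prop))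
  have h3 : PolyBits fun c : Context => c.unit := PT.polyBits (by fun_prop)
  unfold coeffBound
  fun_prop

end Context

theorem pow_mul_two_pow_le {t : ℕ} (ht : t ≠ 0) (R : ℕ) :
    ENNReal.ofReal (9 / 10) ^ (t * (7 * (R + 1))) * 2 ^ R ≤ 2⁻¹ ^ t := by
  have h : ENNReal.ofReal (9 / 10) ^ 7 ≤ 2⁻¹ := by
    rw [← ENNReal.ofReal_pow (by norm_num), show (2⁻¹ : ℝ≥0∞) = ENNReal.ofReal (1 / 2) by
      rw [one_div, ENNReal.ofReal_inv_of_pos (by norm_num)]; simp]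
    exact ENNReal.ofReal_le_ofReal (by norm_num)
  have hle : R + t ≤ t * (R + 1) := by
    obtain ⟨s, rfl⟩ := Nat.exists_eq_succ_of_ne_zero ht
    nlinarith [Nat.zero_le (s * R)]
  calc _ = (ENNReal.ofReal (9 / 10) ^ 7) ^ (t * (R + 1)) * 2 ^ R := by rw [← pow_mul]; ring
    _ ≤ (2⁻¹ : ℝ≥0∞) ^ (t * (R + 1)) * 2 ^ R := by gcongr
    _ ≤ 2⁻¹ ^ (R + t) * 2 ^ R := by
      gcongr ?_ * _
      exact pow_le_pow_right_of_le_one' (by simp) hle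
    _ = (2⁻¹ * 2) ^ R * 2⁻¹ ^ t := by rw [pow_add, mul_pow]; ring
    _ = _ := by rw [ENNReal.inv_mul_cancel (by simp) (by simp), one_pow, one_mul]

/-- The multi-objective algorithm is called until sufficiently many trees have been accepted.  The
number of calls has an exponential tail, and the time is bounded in terms of this number. -/
theorem exists_sample (k : ℕ) (hk : 0 < k) : ∃ (P : Prog Subroutine) (q : Polynomial ℕ),
    ∀ (A R : Prog Empty) (r : ℝ), 25 * r ≤ k → IsMultiApprox A r →
    ∃ B : Context → ℕ, PolyBounded B ∧ ∀ c : Context, c.Valid →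
      let μ := P.runSub (Subroutine.prog A R) (enc c)
      μ Set.univ = 1 ∧
      (∀ᵐ x ∂μ, (∃ l, x.val = enc (c, l) ∧ c.Finished k l ∧ esize (c, l) ≤ B c) ∧
        x.time ≤ B c * (x.calls .multi + 1)) ∧
      ∀ t : ℕ, μ {x | t * q.eval c.1.logD < x.calls .multi} ≤ 2⁻¹ ^ t := by
  have hc : PT fun s : Context × List (Val × ℕ) =>
      decide (¬ s.1.unit = 0 ∧ s.2.length < s.1.1.samples) :=
    .decide_and (.decide_not (.natEq (by fun_prop) (by fun_prop)))
      (.natLt (.length (by fun_prop)) (.samples (by fun_prop)))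
  have hq : PT fun s : Context × List (Val × ℕ) => s.1.query k s.2 := by
    refine .prodMk (by fun_prop) (.map (g := fun (s : Context × List (Val × ℕ)) i =>
      (s.1.coeff k s.2 i, 1)) (.range (.numAtomic (by fun_prop)) (.numAtomic (by fun_prop))) ?_)
    unfold Context.coeff
    fun_prop
  have hu : PT fun p : (Context × List (Val × ℕ)) × Val =>
      if p.1.1.accepts k p.1.2 p.2 = true then (p.1.1, (p.2, 1) :: p.1.2) else p.1 :=
    .ite (.decide_bool (.accepts (by fun_prop) (by fun_prop) (by fun_prop) (by fun_prop)))
      (by fun_prop) (by fun_prop)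
  have hi : PT fun c : Context => (c, ([] : List (Val × ℕ))) := by fun_prop
  obtain ⟨Q, B, hQ⟩ := exists_call_loop .multi hc hq hu
  obtain ⟨init, T, hinit⟩ := hi
  refine ⟨.seq init Q, 7 * (421 ^ 2 * (1 + .X) ^ 3 + 1), fun A R r hr hA => ?_⟩
  have hrej := fun c => Context.measure_not_accepts_le (c := c) hA hr hk
  obtain ⟨p, hp⟩ := hA
  obtain ⟨q, hq⟩ := exists_time_add_size_le A p
  -- bounds for the queries, for the results, and for the states
  let W : Context → ℕ := fun c => esize c + c.1.numAtomic * ((c.coeffBound k).size + 5) + 2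
  let Z : Context → ℕ := fun c => esize c + c.1.samples * (q.eval (W c) + 4) + 2 + q.eval (W c)
  have hWb : PolyBounded W := by
    have h1 : PolyBounded fun c : Context => c.1.numAtomic := .numAtomic (by fun_prop)
    have h2 : PolyBounded fun c : Context => (c.coeffBound k).size := Context.polyBits_coeffBound k
    fun_prop
  have hZb : PolyBounded Z := by
    have h1 : PolyBounded fun c : Context => c.1.samples := .samples (by fun_prop)
    have := PolyBounded.eval hWb q
    fun_prop
  refine ⟨fun c => Z c + T.eval (esize c) + (2 * B.eval (Z c) + 3) + 1, ?_, fun c hv => ?_⟩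
  · have := PolyBounded.eval hZb B
    have := PolyBounded.eval (PolyBounded.size_self (α := Context)) T
    fun_prop
  intro μ
  let Inv : Context × List (Val × ℕ) → Prop := fun s => s.1 = c ∧ c.Sampled k s.2 ∧
    s.2.length ≤ c.1.samples ∧ ∀ e ∈ s.2, c.1.IsTree (c.1.readTree e.1) ∧
      e.1.size ≤ q.eval (W c) ∧ e.2 = 1
  have hInvZ : ∀ s, Inv s → esize s ≤ Z c := by
    rintro ⟨c', l⟩ ⟨hc', -, h1, h2⟩
    change c' = c at hc'
    subst c'
    have h3 := esize_list_le (l := l) (b := q.eval (W c) + 3) fun e he => by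
      obtain ⟨-, h4, h5⟩ := h2 e he
      have : esize (1 : ℕ) = 2 := rfl
      rw [esize_prod, h5, esize_val, this]
      omega
    change l.length ≤ c.1.samples at h1
    have h4 : l.length * (q.eval (W c) + 3 + 1) ≤ c.1.samples * (q.eval (W c) + 4) :=
      Nat.mul_le_mul_right _ h1
    rw [esize_prod]
    simp only [Z]
    omega
  have hdraw : ∀ s, Inv s → decide (¬ s.1.unit = 0 ∧ s.2.length < s.1.1.samples) = true →
      A.run (enc (s.1.query k s.2)) Set.univ = 1 ∧
      ∀ᵐ o ∂(A.run (enc (s.1.query k s.2))),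
        Inv (if s.1.accepts k s.2 o.val = true then (s.1, (o.val, 1) :: s.2) else s) ∧
          o.time + o.val.size ≤ Z c := by
    rintro ⟨c', l⟩ ⟨hc', h1, h2, h3⟩ hcond
    change c' = c at hc'
    subst c'
    obtain ⟨hu, hlt⟩ := of_decide_eq_true hcond
    dsimp only at hu hlt h1 h2 h3 ⊢
    obtain ⟨r1, r2, -⟩ := hp c.1 fun i => (c.coeff k l i : ℚ≥0)
    rw [← Context.enc_query] at r1 r2
    have hsz : (enc (c.query k l) : Val).size ≤ W c := by
      change esize (c.query k l) ≤ _
      have h4 := esize_list_le (l := (c.query k l).2) (b := (c.coeffBound k).size + 4) fun e he => by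
        obtain ⟨i, hi, rfl⟩ := List.mem_map.1 he
        have h5 := Nat.size_le_size (h1.coeff_le h2 (List.mem_range.1 hi))
        have : esize (1 : ℕ) = 2 := rfl
        rw [esize_prod, this, esize_nat]
        dsimp only
        omega
      have h6 : (c.query k l).2.length = c.1.numAtomic := by simp [Context.query]
      have h7 : esize c = esize c.1 + esize c.2 + 1 := rfl
      have h8 : esize (c.query k l).2 ≤ c.1.numAtomic * ((c.coeffBound k).size + 5) + 1 := by
        rw [← h6]; exact h4
      rw [esize_prod]
      change esize c.1 + _ + 1 ≤ _
      simp only [W]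
      omega
    refine ⟨r1, ?_⟩
    filter_upwards [r2, hq _ r1 (r2.mono fun o ho => ho.1)] with o o1 o2
    have o3 := o2.trans (polynomial_eval_mono q hsz)
    refine ⟨?_, by simp only [Z]; omega⟩
    split_ifs with hacc
    · refine ⟨rfl, h1.cons hk (Nat.pos_of_ne_zero hu) hacc, hlt, fun e he => ?_⟩
      rcases List.mem_cons.1 he with rfl | he
      · exact ⟨o1.2, by dsimp only; omega, rfl⟩
      · exact h3 e he
    · exact ⟨rfl, h1, h2, h3⟩
  obtain ⟨G, P, F, hQ1, hQ2⟩ := hQ fun i => (Subroutine.prog A R i).run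
  have hloop := hQ2 (Z c) Inv hInvZ hdraw
  have hstart : Inv (c, []) := ⟨rfl, c.sampled_nil k, Nat.zero_le _, by simp⟩
  obtain ⟨t, ht, h0⟩ := (hinit c).2 fun i => (Subroutine.prog A R i).run
  have hμ : μ = (Measure.sum fun n => loopRun G P n (enc (c, ([] : List (Val × ℕ))))).map fun b =>
      (⟨enc (c, ([] : List (Val × ℕ))), t, 0⟩ : Outcome Subroutine).after b := by
    have : μ = _ := runWith_seq_of_dirac h0
    rw [this, hQ1]
  -- a tree is accepted with probability at least `1 / 5`, so that this potential decreases by the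
  -- factor `1 / 5 * 1 / 2 + 4 / 5 = 9 / 10` in expectation
  let Φ : Context × List (Val × ℕ) → ℝ≥0∞ := fun s => 2 ^ (c.1.samples - s.2.length)
  have hΦ1 : ∀ s, 1 ≤ Φ s := fun s => one_le_pow₀ one_le_two
  have hΦ2 : ∀ s, Φ s ≠ ∞ := fun s => by simp [Φ]
  have hr1 : ENNReal.ofReal (9 / 10) < 1 := by
    rw [← ENNReal.ofReal_one]
    exact (ENNReal.ofReal_lt_ofReal_iff one_pos).2 (by norm_num)
  have hΦ : ∀ s, Inv s → decide (¬ s.1.unit = 0 ∧ s.2.length < s.1.1.samples) = true →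
      ∫⁻ o, Φ (if s.1.accepts k s.2 o.val = true then (s.1, (o.val, 1) :: s.2) else s)
        ∂(A.run (enc (s.1.query k s.2))) ≤ ENNReal.ofReal (9 / 10) * Φ s := by
    intro s hs hcond
    have hd := (hdraw s hs hcond).1
    obtain ⟨c', l⟩ := s
    have hc' : c' = c := hs.1
    subst c'
    obtain ⟨hu, hlt⟩ := of_decide_eq_true hcond
    dsimp only at hu hlt hd ⊢
    obtain ⟨d, hd1⟩ : ∃ d, c.1.samples - l.length = d + 1 :=
      ⟨c.1.samples - l.length - 1, by omega⟩
    have hd2 : c.1.samples - (l.length + 1) = d := by omega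
    have e : ∀ o : Outcome Empty,
        Φ (if c.accepts k l o.val = true then (c, (o.val, 1) :: l) else (c, l)) =
        2 ^ d * (1 + Set.indicator {o : Outcome Empty | c.accepts k l o.val = false} 1 o) := by
      intro o
      cases h : c.accepts k l o.val
      · simp [Φ, hd1, h, pow_succ, one_add_one_eq_two]
      · simp [Φ, hd2, h]
    simp only [e]
    rw [lintegral_const_mul _ (Outcome.measurable _), lintegral_add_left measurable_const,
      lintegral_const, hd, lintegral_indicator_one (Outcome.measurableSet _), mul_one]
    calc _ ≤ 2 ^ d * (1 + ENNReal.ofReal (4 / 5)) := by gcongr; exact hrej c hv hu l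
      _ = 2 ^ d * (ENNReal.ofReal (9 / 10) * 2) := by
        congr 1
        rw [← ENNReal.ofReal_one, ← ENNReal.ofReal_add (by norm_num) (by norm_num),
          ← ENNReal.ofReal_ofNat 2, ← ENNReal.ofReal_mul (by norm_num)]
        norm_num
      _ = _ := by
        simp only [Φ, hd1, pow_succ]
        ring
  have huniv := hloop.univ_eq_one hΦ1 hr1 hΦ2 hΦ hstart
  refine ⟨by rw [hμ, map_univ_outcome, huniv], ?_, fun n => ?_⟩
  · rw [hμ, ae_map_outcome_iff]
    filter_upwards [hloop.ae_sum hstart] with x hx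
    obtain ⟨⟨⟨c', l⟩, hval, hI, hcond⟩, n, hn, htime⟩ := hx
    have hZ := hInvZ _ hI
    obtain ⟨hc', h1, h2, h3⟩ := hI
    change c' = c at hc'
    subst c'
    have hcond : ¬ (¬ c.unit = 0 ∧ l.length < c.1.samples) := of_decide_eq_false hcond
    have h2 : l.length ≤ c.1.samples := h2
    refine ⟨⟨l, hval, ?_, by omega⟩, ?_⟩
    · by_cases hu : c.unit = 0
      · exact .inl hu
      · exact .inr ⟨h1, by by_contra; exact hcond ⟨hu, by omega⟩, fun e he => (h3 e he).1⟩
    · have hcalls : (0 + x.calls) .multi = n := by simp [hn]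
      change t + x.time + 1 ≤ _ * ((0 + x.calls) .multi + 1)
      rw [hcalls]
      have := Nat.zero_le (n * (Z c + t + 1))
      nlinarith
  · rcases Nat.eq_zero_or_pos n with rfl | hn
    · rw [pow_zero]
      refine (measure_mono (Set.subset_univ _)).trans ?_
      rw [hμ, map_univ_outcome, huniv]
    · rw [hμ, Measure.map_apply (Outcome.measurable _) (Outcome.measurableSet _)]
      have e : ((7 * (421 ^ 2 * (1 + .X) ^ 3 + 1) : Polynomial ℕ)).eval c.1.logD =
          7 * (c.1.samples + 1) := by simp [BaB.samples, BaB.numAtomic]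
      have e' : (fun b => (⟨enc (c, ([] : List (Val × ℕ))), t, 0⟩ : Outcome Subroutine).after b) ⁻¹'
          {x | n * (7 * (c.1.samples + 1)) < x.calls .multi} =
          {x | n * (7 * (c.1.samples + 1)) < x.calls .multi} := by
        ext x
        simp [Outcome.after]
      rw [e, e']
      refine (hloop.tail_le hΦ1 hr1 hΦ2 hΦ hstart (by simp) _).trans ?_
      simpa [Φ] using pow_mul_two_pow_le hn.ne' c.1.samples

/-! ### The whole algorithm -/

section seq
variable {ι : Type} {sub : ι → Val → Measure (Outcome Empty)} {p q : Prog ι} {v : Val}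

theorem ae_seq {φ : Outcome ι → Prop}
    (h : ∀ᵐ a ∂p.runWith sub v, ∀ᵐ b ∂q.runWith sub a.val, φ (a.after b)) :
    ∀ᵐ x ∂(Prog.seq p q).runWith sub v, φ x := by
  rw [Prog.runWith, ae_bind_iff]
  exact h.mono fun a ha => ae_map_outcome_iff.2 ha

theorem lintegral_seq (g : Outcome ι → ℝ≥0∞) :
    ∫⁻ x, g x ∂(Prog.seq p q).runWith sub v =
      ∫⁻ a, ∫⁻ b, g (a.after b) ∂q.runWith sub a.val ∂p.runWith sub v := by
  rw [Prog.runWith, lintegral_bind_outcome]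
  simp only [lintegral_map_outcome]

theorem univ_seq (hp : p.runWith sub v Set.univ = 1)
    (h : ∀ᵐ a ∂p.runWith sub v, q.runWith sub a.val Set.univ = 1) :
    (Prog.seq p q).runWith sub v Set.univ = 1 := by
  rw [← lintegral_one, lintegral_seq]
  simp only [lintegral_one]
  rw [lintegral_congr_ae h, lintegral_one, hp]

theorem measure_seq_le (hp : p.runWith sub v Set.univ = 1) {S : Set (Outcome ι)} {ε : ℝ≥0∞}
    (h : ∀ᵐ a ∂p.runWith sub v, q.runWith sub a.val {b | a.after b ∈ S} ≤ ε) :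
    (Prog.seq p q).runWith sub v S ≤ ε := by
  rw [← lintegral_indicator_one (Outcome.measurableSet S), lintegral_seq]
  calc _ ≤ ∫⁻ _, ε ∂p.runWith sub v := by
        refine lintegral_mono_ae (h.mono fun a ha => le_trans (le_of_eq ?_) ha)
        rw [← lintegral_indicator_one (Outcome.measurableSet _)]
        rfl
    _ = ε := by rw [lintegral_const, hp, mul_one]

end seq

/-- The sampling of trees, followed by the reduction of the support. -/
theorem exists_sample_reduce (k : ℕ) (hk : 0 < k) : ∃ (P : Prog Subroutine) (q : Polynomial ℕ),
    ∀ (A R : Prog Empty) (r : ℝ), 25 * r ≤ k → IsMultiApprox A r →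
    ∃ B : Polynomial ℕ, ∀ c : Context, c.Valid →
      let μ := P.runSub (Subroutine.prog A R) (enc c)
      μ Set.univ = 1 ∧
      (∀ᵐ x ∂μ, (∃ l, x.val = enc (c.result k l) ∧ c.Finished k l) ∧
        x.time ≤ B.eval (esize c) * (x.calls .multi + 1)) ∧
      ∀ t : ℕ, μ {x | t * q.eval c.1.logD < x.calls .multi} ≤ 2⁻¹ ^ t := by
  obtain ⟨P, q, hP⟩ := exists_sample k hk
  obtain ⟨post, T, hpost⟩ : PT fun s : Context × List (Val × ℕ) => s.1.result k s.2 :=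
    .result (by fun_prop) (by fun_prop) (by fun_prop)
  refine ⟨.seq P post, q, fun A R r hr hA => ?_⟩
  obtain ⟨B, ⟨B', hB'⟩, hB⟩ := hP A R r hr hA
  refine ⟨B' + T.comp B' + 1, fun c hc => ?_⟩
  obtain ⟨h1, h2, h3⟩ := hB c hc
  intro μ
  have hd : ∀ᵐ a ∂P.runSub (Subroutine.prog A R) (enc c), ∃ t ≤ T.eval (B c), ∃ l, c.Finished k l ∧
      a.time ≤ B c * (a.calls .multi + 1) ∧
      post.runWith (fun i => (Subroutine.prog A R i).run) a.val =
        Measure.dirac ⟨enc (c.result k l), t, 0⟩ := by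
    filter_upwards [h2] with a ha
    obtain ⟨⟨l, hl, hf, hs⟩, htime⟩ := ha
    obtain ⟨t, ht, h⟩ := (hpost (c, l)).2 fun i => (Subroutine.prog A R i).run
    exact ⟨t, ht.trans (polynomial_eval_mono T hs), l, hf, htime, by rw [hl, h]⟩
  refine ⟨univ_seq h1 (hd.mono fun a ⟨t, ht, l, hl, ha, h⟩ => by rw [h, measure_univ]),
    ae_seq (hd.mono fun a ⟨t, ht, l, hl, ha, h⟩ => ?_), fun n => ?_⟩
  · rw [h, ae_dirac_iff (Outcome.measurableSet _)]
    refine ⟨⟨l, rfl, hl⟩, ?_⟩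
    have h4 := hB' c
    have h5 := ht.trans (polynomial_eval_mono T h4)
    have h6 := ha.trans (Nat.mul_le_mul_right _ h4)
    change a.time + t + 1 ≤ _ * ((a.calls + 0) .multi + 1)
    simp only [Polynomial.eval_add, Polynomial.eval_comp, Polynomial.eval_one, add_zero]
    nlinarith [Nat.zero_le (T.eval (B'.eval (esize c)) * a.calls .multi)]
  · change (Prog.seq P post).runWith _ _ _ ≤ _
    rw [← lintegral_indicator_one (Outcome.measurableSet _), lintegral_seq]
    refine le_trans (le_of_eq ?_) (h3 n)
    rw [← lintegral_indicator_one (Outcome.measurableSet _)]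
    refine lintegral_congr_ae (hd.mono fun a ⟨t, ht, l, hl, ha, h⟩ => ?_)
    dsimp only
    rw [h, lintegral_dirac' _ (Outcome.measurable _)]
    simp [Set.indicator, Outcome.after]

theorem mainTheorem3 (c : ℝ) :
    ∃ (Q : Prog Subroutine) (q : Polynomial ℕ),
      ∀ (A R : Prog Empty) (ρ : ℝ), IsMultiApprox A c → IsRentOrBuyApprox R ρ →
        (∀ I : BaB,
          let μ := Q.runSub (Subroutine.prog A R) I.encode
          μ Set.univ = 1 ∧
          (∀ᵐ o ∂μ, I.IsDist (I.readDist o.val) ∧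
            (I.readDist o.val).length ≤ 1 + I.logD) ∧
          (∀ f : ℝ → ℝ, IsAggregation f →
            ∫⁻ o, ENNReal.ofReal (I.distCost f (I.readDist o.val)) ∂μ ≤
              ENNReal.ofReal (2 * c * ρ * I.opt f)) ∧
          (IsSureRentOrBuyApprox R ρ →
            ∀ᵐ o ∂μ, ∀ f : ℝ → ℝ, IsAggregation f →
              I.distCost f (I.readDist o.val) ≤ 2 * c * ρ * I.opt f) ∧
          ∀ t : ℕ, μ {o | t * q.eval I.logD < o.calls Subroutine.multi} ≤ 2⁻¹ ^ t) ∧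
        ∀ k : ℕ, ∃ p : Polynomial ℕ, ∀ I : BaB,
          Q.runSub (Subroutine.prog A R) I.encode {o | p.eval I.encode.size < o.time} ≤
            ((I.encode.size : ENNReal) ^ k)⁻¹ := by
  -- an algorithm with a ratio below `1` does not exist
  by_cases hc : c < 1
  · exact ⟨.op .ident, 0, fun A R ρ hA => absurd hA.one_le hc.not_ge⟩
  rw [not_lt] at hc
  -- trees are accepted at `5 / 4` times the expected normalized cost `k / 25`; rounding `25 c` up
  -- to an integer is harmless, as `1 ≤ c`
  set k := ⌈25 * c⌉₊ with hk
  have hk1 : 25 * c ≤ k := Nat.le_ceil _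
  have hk2 : (k : ℝ) ≤ 26 * c := by
    have := Nat.ceil_lt_add_one (show 0 ≤ 25 * c by linarith)
    linarith
  have hk0 : 0 < k := Nat.ceil_pos.2 (by linarith)
  obtain ⟨P₁, hP₁⟩ := exists_collect
  obtain ⟨P₂, q, hP₂⟩ := exists_sample_reduce k hk0
  refine ⟨.seq P₁ P₂, q, fun A R ρ hA hR => ?_⟩
  have hρ := hR.one_le
  obtain ⟨B₁, hB₁', hB₁⟩ := hP₁ A R ρ hR
  obtain ⟨B₂, hB₂⟩ := hP₂ A R c hk1 hA
  -- the level `24 k / 400` of the reduction, the factor `5 / 4` of the approximation by atomic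
  -- functions and `k ≤ 26 c` give the factor `1.95 c`
  have hratio : ∀ (I : BaB) (f : ℝ → ℝ), IsAggregation f →
      3 * k / 40 * ∑ i ∈ Finset.range I.numAtomic, atomicCoeff f I.logD i * (ρ * I.opt (atomic i)) ≤
        2 * c * ρ * I.opt f := by
    intro I f hf
    have h1 := I.sum_opt_le hf
    have h2 := I.opt_nonneg fun x hx => hf.nonneg hx
    have e : ∑ i ∈ Finset.range I.numAtomic, atomicCoeff f I.logD i * (ρ * I.opt (atomic i)) =
        ρ * ∑ i ∈ Finset.range I.numAtomic, atomicCoeff f I.logD i * I.opt (atomic i) := by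
      rw [Finset.mul_sum]
      exact Finset.sum_congr rfl fun i _ => by ring
    rw [e]
    calc 3 * k / 40 * (ρ * ∑ i ∈ Finset.range I.numAtomic, atomicCoeff f I.logD i * I.opt (atomic i))
        ≤ 3 * k / 40 * (ρ * I.opt f) := by gcongr
      _ ≤ 2 * c * (ρ * I.opt f) := by gcongr; linarith
      _ = _ := by ring
  have main : ∀ I : BaB,
      let μ := (Prog.seq P₁ P₂).runSub (Subroutine.prog A R) I.encode
      (μ Set.univ = 1 ∧
      (∀ᵐ x ∂μ, (∃ (C : Context) (l : List (Val × ℕ)), x.val = enc (C.result k l) ∧ C.1 = I ∧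
        C.Valid ∧ C.Finished k l ∧ (IsSureRentOrBuyApprox R ρ → ∀ i < I.numAtomic,
          I.cost (atomic i) (I.readTree (C.2.getD i (.int 0))) ≤ ρ * I.opt (atomic i))) ∧
        x.time ≤ (B₁ I + B₂.eval (B₁ I) + 1) * (x.calls .multi + 1)) ∧
      (∀ f : ℝ → ℝ, IsAggregation f →
            ∫⁻ o, ENNReal.ofReal (I.distCost f (I.readDist o.val)) ∂μ ≤
              ENNReal.ofReal (2 * c * ρ * I.opt f)) ∧
      ∀ t : ℕ, μ {x | t * q.eval I.logD < x.calls .multi} ≤ 2⁻¹ ^ t) := by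
    intro I μ
    obtain ⟨h1, h2, h3⟩ := hB₁ I
    refine ⟨univ_seq h1 (h2.mono fun a ⟨⟨C, hv, hI, hC, hs⟩, ha⟩ => ?_),
      ae_seq (h2.mono fun a ⟨⟨C, hv, hI, hC, hs, hsure⟩, ha, ht⟩ => ?_), fun f hf => ?_,
      fun t => measure_seq_le h1 (h2.mono fun a ⟨⟨C, hv, hI, hC, hs⟩, ha, _⟩ => ?_)⟩
    · rw [hv]
      exact (hB₂ C hC).1
    · rw [hv]
      refine (hB₂ C hC).2.1.mono fun b ⟨⟨l, hl, hf⟩, hb⟩ =>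
        ⟨⟨C, l, hl, hI, hC, hf, hsure⟩, ?_⟩
      have h4 := Nat.mul_le_mul_right (b.calls .multi + 1) (polynomial_eval_mono B₂ hs)
      change a.time + b.time + 1 ≤ _ * (a.calls .multi + b.calls .multi + 1)
      rw [ha, zero_add]
      nlinarith [Nat.zero_le (B₁ I * b.calls .multi)]
    · change ∫⁻ o, _ ∂(Prog.seq P₁ P₂).runWith _ _ ≤ _
      rw [lintegral_seq]
      calc _ ≤ ∫⁻ x, ∑ i ∈ Finset.range I.numAtomic,
            ENNReal.ofReal (3 * k / 40 * atomicCoeff f I.logD i) * ENNReal.ofReal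
            (I.cost (atomic i) (I.readTree (x.val.snd.toList.getD i (.int 0))))
            ∂P₁.runSub (Subroutine.prog A R) I.encode := by
            refine lintegral_mono_ae (h2.mono fun a ⟨⟨C, hv, hI, hC, hs⟩, _⟩ => ?_)
            obtain ⟨g1, g2, -⟩ := hB₂ C hC
            have e : (enc C : Val).snd.toList = C.2 := by
              change (enc C.2).toList = C.2
              rw [toList_enc]
              exact List.map_id _
            rw [hv, e]
            refine (lintegral_mono_ae (g := fun _ => ∑ i ∈ Finset.range I.numAtomic,
              ENNReal.ofReal (3 * k / 40 * atomicCoeff f I.logD i) * ENNReal.ofReal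
              (I.cost (atomic i) (I.readTree (C.2.getD i (.int 0)))))
              (g2.mono fun b ⟨⟨l, hl, hfin⟩, _⟩ => ?_)).trans (le_of_eq ?_)
            · have h5 := Context.distCost_result_le hC hfin hf
              subst hI
              change ENNReal.ofReal (C.1.distCost f (C.1.readDist b.val)) ≤ _
              rw [hl, ← Finset.sum_congr rfl fun i _ => ENNReal.ofReal_mul
                (mul_nonneg (by positivity) (hf.atomicCoeff_nonneg _ _)),
                ← ENNReal.ofReal_sum_of_nonneg fun i _ => mul_nonneg
                  (mul_nonneg (by positivity) (hf.atomicCoeff_nonneg _ _))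
                  (C.1.cost_nonneg (BaB.atomic_nonneg i) _)]
              refine ENNReal.ofReal_le_ofReal ?_
              simp only [mul_assoc, ← Finset.mul_sum] at h5 ⊢
              linarith
            · change ∫⁻ _, _ ∂P₂.runSub _ _ = _
              rw [lintegral_const, g1, mul_one]
        _ ≤ ∑ i ∈ Finset.range I.numAtomic, ENNReal.ofReal (3 * k / 40 * atomicCoeff f I.logD i) *
            ENNReal.ofReal (ρ * I.opt (atomic i)) := h3 _
        _ = ENNReal.ofReal (3 * k / 40 * ∑ i ∈ Finset.range I.numAtomic,
            atomicCoeff f I.logD i * (ρ * I.opt (atomic i))) := by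
            rw [Finset.mul_sum, ENNReal.ofReal_sum_of_nonneg fun i _ => mul_nonneg (by positivity)
              (mul_nonneg (hf.atomicCoeff_nonneg _ _) (mul_nonneg (by linarith)
                (I.opt_nonneg (BaB.atomic_nonneg i))))]
            refine Finset.sum_congr rfl fun i _ => ?_
            rw [← mul_assoc, ENNReal.ofReal_mul
              (mul_nonneg (by positivity) (hf.atomicCoeff_nonneg _ _))]
        _ ≤ _ := ENNReal.ofReal_le_ofReal (hratio I f hf)
    · rw [hv]
      have : ∀ b : Outcome Subroutine, (a.after b).calls .multi = b.calls .multi := fun b => by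
        change a.calls .multi + b.calls .multi = _
        rw [ha, zero_add]
      simp only [Set.mem_ofPred_eq, this]
      rw [← hI]
      exact (hB₂ C hC).2.2 t
  refine ⟨fun I => ?_, fun j => ?_⟩
  · obtain ⟨h1, h2, h3, h4⟩ := main I
    refine ⟨h1, h2.mono fun x ⟨⟨C, l, hl, hI, hC, hf, _⟩, _⟩ => ?_, h3, fun hR => ?_, h4⟩
    · subst hI
      rw [hl]
      exact Context.isDist_result hC hf
    · refine h2.mono fun x ⟨⟨C, l, hl, hI, hC, hfin, hsure⟩, _⟩ f hf => ?_
      have h5 := Context.distCost_result_le hC hfin hf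
      subst hI
      rw [hl]
      have h6 : ∑ i ∈ Finset.range C.1.numAtomic, atomicCoeff f C.1.logD i *
          C.1.cost (atomic i) (C.1.readTree (C.2.getD i (.int 0))) ≤
          ∑ i ∈ Finset.range C.1.numAtomic, atomicCoeff f C.1.logD i * (ρ * C.1.opt (atomic i)) :=
        Finset.sum_le_sum fun i hi => mul_le_mul_of_nonneg_left
          (hsure hR i (Finset.mem_range.1 hi)) (hf.atomicCoeff_nonneg _ _)
      have h7 := mul_le_mul_of_nonneg_left h6 (show (0 : ℝ) ≤ 3 * k / 40 by positivity)
      have h8 := hratio C.1 f hf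
      linarith
  -- the tail bound is applied with `j` times the number of bits of the size of the instance
  · have hq : PolyBounded fun I : BaB =>
        (B₁ I + B₂.eval (B₁ I) + 1) * (j * (esize I).size * q.eval I.logD + 1) := by
      have h1 := PolyBounded.eval hB₁' B₂
      have h2 := PolyBounded.eval (PolyBounded.logD (PT.id' (α := BaB))) q
      have h3 : PolyBounded fun I : BaB => (esize I).size :=
        PolyBounded.size_self.mono fun I => Nat.size_le_self _
      fun_prop
    obtain ⟨p, hp⟩ := hq
    refine ⟨p, fun I => ?_⟩
    obtain ⟨-, h2, -, h4⟩ := main I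
    refine ((measure_mono_ae ?_).trans (h4 (j * (esize I).size))).trans ?_
    · filter_upwards [h2] with x hx h
      by_contra hle
      refine absurd (show p.eval (esize I) < x.time from h) (not_lt.2 ?_)
      refine hx.2.trans ((Nat.mul_le_mul_left _ ?_).trans (hp I))
      exact Nat.add_le_add_right (not_lt.1 hle) 1
    · rw [← ENNReal.inv_pow, ENNReal.inv_le_inv, mul_comm, pow_mul]
      gcongr
      exact_mod_cast (Nat.lt_size_self (esize I)).le
end
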